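/- Let $d\ge 2$ and let $\Omega\subset\mathbb R^d$ be compact and connected, with nonempty interior $\Omega^\circ$ and smooth ($C^\infty$) connected boundary $\partial\Omega$, such that $\Omega$ lies locally on one side of $\partial\Omega$. Let $\lambda$ be the Lebesgue measure on $\Omega$, $\sigma$ the surface measure on $\partial\Omega$, $c=1/(\lambda(\Omega)+\sigma(\partial\Omega))$ and $\mu=c(\lambda+\sigma)$. For $a>0$ let $(\mathcal E,\mathcal D(\mathcal E))$ be the closure in $L^2(\mu)$ of the form $$\mathcal E(f,g)=\int_{\Omega^\circ}\nabla f\cdot\nabla g\;c\,d\lambda+a\int_{\partial\Omega}\nabla^\tau f\cdot\nabla^\tau g\;c\,d\sigma,\qquad f,g\in C^1(\Omega),$$ where $\nabla^\tau$ is the tangential gradient on $\partial\Omega$; that is, $\mathcal D(\mathcal E)$ is the closure of $C^1(\Omega)$ under the norm $(\mathcal E(f,f)+\|f\|_{L^2(\mu)}^2)^{1/2}$. Let $\mathcal D_b^c=\mathcal D(\mathcal E)\cap C_b(\Omega)$, $$\mathcal D_0=\Big\{f\in\mathcal D_b^c:\ \mathcal E(fh,f)-\tfrac12\mathcal E(f^2,h)\le\|h\|_{L^1(\mu)}\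 \text{ for all } h\in\mathcal D_b^c\Big\},$$ and let $d_i(x,y)=\sup\{f(x)-f(y): f\in\mathcal D_0\}$ be the intrinsic distance on $\Omega$ induced by $\mathcal E$. If $a\in(0,1]$, then for all $x,y\in\Omega$ the supremum $d_i(x,y)$ is finite and $$d_i(x,y)=d_\Omega(x,y):=\min\int_0^1|\dot X_t|\,dt,$$ where the minimum is over all absolutely continuous paths $X:[0,1]\to\mathbb R^d$ with $X_0=x$, $X_1=y$ and $X_t\in\Omega$ for all $t\in[0,1]$, and is attained. If $\Omega$ is convex, then $d_\Omega(x,y)=|x-y|$ for all $x,y\in\Omega$. In particular, $d_i$ does not depend on $a\in(0,1]$. -/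

import Mathlib

open Set Filter Topology MeasureTheory
open scoped ENNReal ContDiff

namespace SRBD

noncomputable section

/-- Near each of its boundary points, `Ω` is a sublevel set `{g ≤ 0}` of a `C^∞` function with
nonvanishing differential: the boundary is smooth and `Ω` lies locally on one side of it. -/
def HasSmoothBoundary {d : ℕ} (Ω : Set (EuclideanSpace ℝ (Fin d))) : Prop :=
  ∀ p ∈ frontier Ω, ∃ U : Set (EuclideanSpace ℝ (Fin d)), IsOpen U ∧ p ∈ U ∧
    ∃ g : EuclideanSpace ℝ (Fin d) → ℝ, ContDiff ℝ ∞ g ∧ fderiv ℝ g p ≠ 0 ∧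
      Ω ∩ U = {x ∈ U | g x ≤ 0}

/-- `λ`: Lebesgue measure restricted to `Ω`. -/
def bulkMeasure {d : ℕ} (Ω : Set (EuclideanSpace ℝ (Fin d))) :
    Measure (EuclideanSpace ℝ (Fin d)) :=
  volume.restrict Ω

/-- `σ`: the `(d-1)`-dimensional Hausdorff measure (normalised to be the usual surface measure)
restricted to the boundary `∂Ω`. -/
def surfaceMeasure {d : ℕ} (Ω : Set (EuclideanSpace ℝ (Fin d))) :
    Measure (EuclideanSpace ℝ (Fin d)) :=
  (μHE[d - 1] : Measure (EuclideanSpace ℝ (Fin d))).restrict (frontier Ω)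

/-- `c = 1 / (λ(Ω) + σ(∂Ω))`. -/
def normConst {d : ℕ} (Ω : Set (EuclideanSpace ℝ (Fin d))) : ℝ≥0∞ :=
  (bulkMeasure Ω Ω + surfaceMeasure Ω (frontier Ω))⁻¹

/-- The invariant measure `μ = c (λ + σ)`. -/
def invMeasure {d : ℕ} (Ω : Set (EuclideanSpace ℝ (Fin d))) :
    Measure (EuclideanSpace ℝ (Fin d)) :=
  normConst Ω • (bulkMeasure Ω + surfaceMeasure Ω)

/-- The tangent space `T_x ∂Ω`, as a linear subspace of `ℝ^d`. -/
def tangentSpace {d : ℕ} (Ω : Set (EuclideanSpace ℝ (Fin d))) (x : EuclideanSpace ℝ (Fin d)) :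
    Submodule ℝ (EuclideanSpace ℝ (Fin d)) :=
  Submodule.span ℝ (tangentConeAt ℝ (frontier Ω) x)

/-- The tangential gradient `∇^τ φ (x)` of a `C¹` function at a boundary point `x`: the orthogonal
projection of `∇φ (x)` onto `T_x ∂Ω`. -/
def tangentialGradient {d : ℕ} (Ω : Set (EuclideanSpace ℝ (Fin d)))
    (φ : EuclideanSpace ℝ (Fin d) → ℝ) (x : EuclideanSpace ℝ (Fin d)) :
    EuclideanSpace ℝ (Fin d) :=
  (tangentSpace Ω x).starProjection (gradient φ x)

/-- The bilinear form `E(φ, ψ) = ∫_{Ω°} ∇φ·∇ψ c dλ + a ∫_{∂Ω} ∇^τ φ·∇^τ ψ c dσ` on `C¹` functions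
(those on `Ω` are represented by their `C¹` extensions to `ℝ^d`). -/
def preForm {d : ℕ} (Ω : Set (EuclideanSpace ℝ (Fin d))) (a : ℝ)
    (φ ψ : EuclideanSpace ℝ (Fin d) → ℝ) : ℝ :=
  (∫ x in interior Ω, inner ℝ (gradient φ x) (gradient ψ x) * (normConst Ω).toReal
      ∂(bulkMeasure Ω)) +
    a * ∫ x in frontier Ω,
      inner ℝ (tangentialGradient Ω φ x) (tangentialGradient Ω ψ x) * (normConst Ω).toReal
        ∂(surfaceMeasure Ω)

/-- `φ_n` is a sequence in `C¹(Ω)` that converges to `f` in `L²(μ)` and is Cauchy for the energy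
`E`; that is, it is Cauchy for the norm `‖u‖² = E(u, u) + ‖u‖²_{L²(μ)}` and represents `f`. -/
structure IsApprox {d : ℕ} (Ω : Set (EuclideanSpace ℝ (Fin d))) (a : ℝ)
    (f : EuclideanSpace ℝ (Fin d) → ℝ) (φ : ℕ → EuclideanSpace ℝ (Fin d) → ℝ) : Prop where
  contDiff : ∀ n, ContDiff ℝ 1 (φ n)
  tendsto : Tendsto (fun n => eLpNorm (φ n - f) 2 (invMeasure Ω)) atTop (𝓝 0)
  cauchy : ∀ ε > 0, ∃ N, ∀ m ≥ N, ∀ n ≥ N, preForm Ω a (φ m - φ n) (φ m - φ n) < ε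

/-- The domain `D(E)`: the closure of `C¹(Ω)` in `L²(μ)` under the norm
`‖u‖² = E(u, u) + ‖u‖²_{L²(μ)}`. -/
def formDomain {d : ℕ} (Ω : Set (EuclideanSpace ℝ (Fin d))) (a : ℝ) :
    Set (EuclideanSpace ℝ (Fin d) → ℝ) :=
  {f | MemLp f 2 (invMeasure Ω) ∧ ∃ φ, IsApprox Ω a f φ}

/-- `r` is a value of the extended form at `(f, g)`: the limit of `E(φ_n, ψ_n)` along
approximations of `f` and `g`. -/
def IsFormValue {d : ℕ} (Ω : Set (EuclideanSpace ℝ (Fin d))) (a : ℝ)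
    (f g : EuclideanSpace ℝ (Fin d) → ℝ) (r : ℝ) : Prop :=
  ∃ φ ψ, IsApprox Ω a f φ ∧ IsApprox Ω a g ψ ∧
    Tendsto (fun n => preForm Ω a (φ n) (ψ n)) atTop (𝓝 r)

open Classical in
/-- The Dirichlet form `E(f, g)` for `f, g ∈ D(E)`, the extension of `preForm` by closure
(`0` outside the domain). -/
def dirichletForm {d : ℕ} (Ω : Set (EuclideanSpace ℝ (Fin d))) (a : ℝ)
    (f g : EuclideanSpace ℝ (Fin d) → ℝ) : ℝ :=
  if h : ∃ r, IsFormValue Ω a f g r then h.choose else 0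

/-- `D_b^c = D(E) ∩ C_b(Ω)`. The sets `Ω` under consideration are compact, so that continuous
functions on `Ω` are bounded. -/
def boundedDomain {d : ℕ} (Ω : Set (EuclideanSpace ℝ (Fin d))) (a : ℝ) :
    Set (EuclideanSpace ℝ (Fin d) → ℝ) :=
  {f | f ∈ formDomain Ω a ∧ ContinuousOn f Ω}

/-- `D_0`: the functions `f ∈ D_b^c` whose energy measure is at most `μ`, that is,
`E(f h, f) - E(f², h) / 2 ≤ ‖h‖_{L¹(μ)}` for all `h ∈ D_b^c`. -/
def unitEnergyFunctions {d : ℕ} (Ω : Set (EuclideanSpace ℝ (Fin d))) (a : ℝ) :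
    Set (EuclideanSpace ℝ (Fin d) → ℝ) :=
  {f | f ∈ boundedDomain Ω a ∧ ∀ h ∈ boundedDomain Ω a,
    dirichletForm Ω a (f * h) f - dirichletForm Ω a (f ^ 2) h / 2 ≤ ∫ x, |h x| ∂(invMeasure Ω)}

/-- The increments `f x - f y` of functions `f ∈ D_0`. -/
def increments {d : ℕ} (Ω : Set (EuclideanSpace ℝ (Fin d))) (a : ℝ)
    (x y : EuclideanSpace ℝ (Fin d)) : Set ℝ :=
  {r | ∃ f ∈ unitEnergyFunctions Ω a, r = f x - f y}

/-- The intrinsic distance `d_i(x, y) = sup {f x - f y : f ∈ D_0}`. -/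
def intrinsicDist {d : ℕ} (Ω : Set (EuclideanSpace ℝ (Fin d))) (a : ℝ)
    (x y : EuclideanSpace ℝ (Fin d)) : ℝ :=
  sSup (increments Ω a x y)

/-- The lengths `∫₀¹ |X'_t| dt` of the absolutely continuous paths from `x` to `y` that stay
in `Ω`. -/
def pathLengths {d : ℕ} (Ω : Set (EuclideanSpace ℝ (Fin d)))
    (x y : EuclideanSpace ℝ (Fin d)) : Set ℝ :=
  {r | ∃ X : ℝ → EuclideanSpace ℝ (Fin d), AbsolutelyContinuousOnInterval X 0 1 ∧
    X 0 = x ∧ X 1 = y ∧ (∀ t ∈ Icc (0 : ℝ) 1, X t ∈ Ω) ∧ r = ∫ t in (0 : ℝ)..1, ‖deriv X t‖}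

/-- The induced length distance `d_Ω`. -/
def inducedDist {d : ℕ} (Ω : Set (EuclideanSpace ℝ (Fin d)))
    (x y : EuclideanSpace ℝ (Fin d)) : ℝ :=
  sInf (pathLengths Ω x y)

end

end SRBD

/-! Both distances are identified with a third one, `reachDist`: the least `L` such that `x` and `y`
are joined by chains of points lying in arbitrarily thin neighbourhoods of `Ω`, with arbitrarily
small steps and total length exceeding `L` by arbitrarily little. It is finite because `Ω` is
connected and each of its points can be pushed into the interior (`exists_reach`).

Path lengths. An absolutely continuous path yields chains no longer than itself. Conversely, chains
followed at constant speed are almost Lipschitz step functions, and a compactness argument extracts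
an `L`-Lipschitz path in `Ω` (`Reach.exists_lipschitz_path`). Hence `reachDist` is the minimal path
length, and it is attained.

Lower bound for the intrinsic distance. If `L < reachDist Ω x y`, then for some `δ` all chains from
`y` to `x` in the `δ`-thickening with steps below `δ` have length at least `L + δ`. The truncated
chain distance to `y` is `1`-Lipschitz at scale `δ` on this thickening, which leaves room to mollify
it; the result is a `C¹` function with gradient at most `1` on `Ω` and increment at least `L`
(`exists_contDiff_of_lt_reachDist`). The energy measure of a `C¹` function `F` is `c|∇F|² dλ + a
c|∇^τ F|² dσ`, so for `a ≤ 1` such a function lies in `D_0`.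

Upper bound. For `f` in `D_0`, testing with functions `h ≥ 0` supported in the interior bounds the
weak gradient there by `1` in an averaged sense, which suffices for the mollifications of `f`, hence
`f` itself, to be locally `1`-Lipschitz (`eventually_abs_sub_le_of_mem`). A path that touches the
boundary is shifted inwards by a small vector, and continuity of `f` on `Ω` carries the estimate
back to the path (`sub_le_of_reach`).

The formula for the energy measure (`HasGradients.energyMeasure_eq`) presupposes that the closed
form is computed by well-defined limit gradients, that is, closability of `∇` and `∇^τ`. Both come
from integration by parts, in the interior and in bi-Lipschitz charts of the boundary. -/

namespace SRBD

/-! ### Absolutely continuous paths: displacement is at most length. -/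

section Paths

variable {E : Type*} [NormedAddCommGroup E]

/-- Postcomposition with a Lipschitz map preserves absolute continuity. -/
lemma absolutelyContinuousOnInterval_comp_lipschitz {F : Type*} [NormedAddCommGroup F]
    {X : ℝ → E} {a b : ℝ} (hX : AbsolutelyContinuousOnInterval X a b) {K : NNReal} {g : E → F}
    (hg : LipschitzWith K g) : AbsolutelyContinuousOnInterval (g ∘ X) a b := by
  have h := Filter.Tendsto.const_mul (K : ℝ) hX
  rw [mul_zero] at h
  refine squeeze_zero (fun _ => Finset.sum_nonneg fun _ _ => dist_nonneg) (fun I => ?_) h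
  rw [Finset.mul_sum]
  exact Finset.sum_le_sum fun i _ => hg.dist_le_mul _ _

variable [InnerProductSpace ℝ E]

lemma absolutelyContinuous_inner {X : ℝ → E} {a b : ℝ}
    (hX : AbsolutelyContinuousOnInterval X a b) (e : E) :
    AbsolutelyContinuousOnInterval (fun t => inner ℝ e (X t)) a b :=
  absolutelyContinuousOnInterval_comp_lipschitz hX (innerSL ℝ e).lipschitz

variable [FiniteDimensional ℝ E]

lemma ae_differentiableAt_of_absolutelyContinuous {X : ℝ → E} {a b : ℝ}
    (hX : AbsolutelyContinuousOnInterval X a b) :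
    ∀ᵐ t, t ∈ uIcc a b → DifferentiableAt ℝ X t :=
  hX.boundedVariationOn.ae_differentiableAt_of_mem_uIcc

lemma ae_deriv_inner_eq {X : ℝ → E} {a b : ℝ} (hX : AbsolutelyContinuousOnInterval X a b) (e : E) :
    ∀ᵐ t, t ∈ uIcc a b → deriv (fun t => inner ℝ e (X t)) t = inner ℝ e (deriv X t) := by
  filter_upwards [ae_differentiableAt_of_absolutelyContinuous hX] with t ht hmem
  simpa using ((hasDerivAt_const t e).inner ℝ (ht hmem).hasDerivAt).deriv

/-- The coordinates in an orthonormal basis are absolutely continuous real functions, whose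
derivatives are integrable; almost everywhere the vector derivative is assembled from them. -/
lemma intervalIntegrable_deriv_of_absolutelyContinuous {X : ℝ → E} {a b : ℝ}
    (hX : AbsolutelyContinuousOnInterval X a b) : IntervalIntegrable (deriv X) volume a b := by
  let e := stdOrthonormalBasis ℝ E
  have h1 : IntervalIntegrable
      (∑ i, fun t => deriv (fun t => inner ℝ (e i) (X t)) t • e i) volume a b := by
    refine IntervalIntegrable.sum _ fun i _ => ?_
    have h := (absolutelyContinuous_inner hX (e i)).intervalIntegrable_deriv
    exact ⟨h.1.smul_const (e i), h.2.smul_const (e i)⟩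
  refine h1.congr_ae ?_
  have h2 : ∀ᵐ t, ∀ i, t ∈ uIcc a b →
      deriv (fun t => inner ℝ (e i) (X t)) t = inner ℝ (e i) (deriv X t) :=
    ae_all_iff.2 fun i => ae_deriv_inner_eq hX (e i)
  refine (ae_restrict_iff' measurableSet_uIoc).2 ?_
  filter_upwards [h2] with t ht hmem
  rw [Finset.sum_apply]
  conv_rhs => rw [← e.sum_repr' (deriv X t)]
  exact Finset.sum_congr rfl fun i _ => by rw [ht i (uIoc_subset_uIcc hmem)]

/-- The scalar fundamental theorem of calculus for `t ↦ ⟪e, X t⟫`, with `e` arbitrary, identifies `X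
b - X a` with the integral of `deriv X`. -/
lemma norm_sub_le_integral_norm_deriv {X : ℝ → E} {a b : ℝ} (hab : a ≤ b)
    (hX : AbsolutelyContinuousOnInterval X a b) :
    ‖X b - X a‖ ≤ ∫ t in a..b, ‖deriv X t‖ := by
  have hint := intervalIntegrable_deriv_of_absolutelyContinuous hX
  have key : ∀ e : E, inner ℝ e (X b - X a) = inner ℝ e (∫ t in a..b, deriv X t) := by
    intro e
    have h := (absolutelyContinuous_inner hX e).integral_deriv_eq_sub
    rw [inner_sub_right, ← h]
    have h3 := (innerSL ℝ e).intervalIntegral_comp_comm hint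
    simp only [innerSL_apply_apply] at h3
    rw [← h3]
    refine intervalIntegral.integral_congr_ae ?_
    filter_upwards [ae_deriv_inner_eq hX e] with t ht hmem
    exact ht (uIoc_subset_uIcc hmem)
  rw [ext_inner_left ℝ key]
  exact intervalIntegral.norm_integral_le_integral_norm hab

end Paths

/-! ### Chains and the step functions that follow them. -/

/-- `Chain S δ x y ℓ`: the points `x` and `y` are joined by a finite chain of points of `S` with
steps shorter than `δ` and total length `ℓ`. -/
inductive Chain {E : Type*} [PseudoMetricSpace E] (S : Set E) (δ : ℝ) (x : E) : E → ℝ → Prop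
  | refl (hx : x ∈ S) : Chain S δ x x 0
  | step {y z : E} {ℓ : ℝ} (h : Chain S δ x y ℓ) (hz : z ∈ S) (hd : dist y z < δ) :
      Chain S δ x z (ℓ + dist y z)

namespace Chain

variable {E : Type*} [MetricSpace E] {S T : Set E} {δ δ' : ℝ} {x y z : E} {ℓ ℓ' : ℝ}

lemma nonneg (h : Chain S δ x y ℓ) : 0 ≤ ℓ := by
  induction h with
  | refl => exact le_rfl
  | step _ _ _ ih => exact add_nonneg ih dist_nonneg

lemma right_mem (h : Chain S δ x y ℓ) : y ∈ S := by
  cases h with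
  | refl hx => exact hx
  | step _ hz _ => exact hz

lemma mono (hST : S ⊆ T) (hδ : δ ≤ δ') (h : Chain S δ x y ℓ) : Chain T δ' x y ℓ := by
  induction h with
  | refl hx => exact .refl (hST hx)
  | step _ hz hd ih => exact .step ih (hST hz) (hd.trans_le hδ)

lemma trans (h : Chain S δ x y ℓ) (h' : Chain S δ y z ℓ') : Chain S δ x z (ℓ + ℓ') := by
  induction h' with
  | refl => simpa using h
  | step _ hz hd ih => rw [← add_assoc]; exact .step ih hz hd

lemma symm (h : Chain S δ x y ℓ) : Chain S δ y x ℓ := by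
  induction h with
  | refl hx => exact .refl hx
  | step h hz hd ih =>
    have h1 := (Chain.refl hz).step (right_mem h) (by rwa [dist_comm])
    simpa [dist_comm, add_comm] using h1.trans ih

/-- Following a chain at unit speed gives a function that is `1`-Lipschitz up to an error `δ`. -/
lemma exists_stepFunction (h : Chain S δ x y ℓ) (hδ : 0 ≤ δ) :
    ∃ X : ℝ → E, X 0 = x ∧ (∀ t, ℓ ≤ t → X t = y) ∧ (∀ t, X t ∈ S) ∧
      ∀ s t, dist (X s) (X t) ≤ |s - t| + δ := by
  induction h with
  | refl hx =>
    refine ⟨fun _ => x, rfl, fun _ _ => rfl, fun _ => hx, fun s t => ?_⟩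
    rw [dist_self]; positivity
  | @step y z ℓ h hz hd ih =>
    obtain ⟨X, h0, h1, hS, hL⟩ := ih
    rcases eq_or_ne y z with rfl | hyz
    · exact ⟨X, h0, fun t ht => h1 t (by simpa using ht), hS, hL⟩
    have hpos : 0 < dist y z := dist_pos.2 hyz
    have hℓ : 0 ≤ ℓ := h.nonneg
    refine ⟨fun t => if t < ℓ + dist y z then X (min t ℓ) else z, ?_, fun t ht => ?_, fun t => ?_,
      ?_⟩
    · dsimp only
      rw [if_pos (by positivity), min_eq_left hℓ, h0]
    · simp [ht]
    · dsimp only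
      split_ifs
      exacts [hS _, hz]
    · have key : ∀ s t : ℝ, s < ℓ + dist y z → ℓ + dist y z ≤ t →
          dist (X (min s ℓ)) z ≤ |s - t| + δ := by
        intro s t hs ht
        rw [abs_of_neg (by linarith)]
        rcases le_total s ℓ with hsl | hsl
        · have h2 := hL s ℓ
          rw [h1 ℓ le_rfl, abs_of_nonpos (by linarith)] at h2
          rw [min_eq_left hsl]
          linarith [dist_triangle (X s) y z]
        · rw [min_eq_right hsl, h1 ℓ le_rfl]
          linarith
      intro s t
      dsimp only
      split_ifs with hs ht ht
      · have h3 : |min s ℓ - min t ℓ| ≤ |s - t| :=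
          (abs_min_sub_min_le_max s ℓ t ℓ).trans (by simp)
        linarith [hL (min s ℓ) (min t ℓ)]
      · exact key s t hs (not_lt.1 ht)
      · rw [dist_comm, abs_sub_comm]
        exact key t s ht (not_lt.1 hs)
      · rw [dist_self]; positivity

end Chain

/-! ### The chain length distance and its realisation by Lipschitz paths. -/

/-- `x` and `y` are joined by chains in arbitrarily small neighbourhoods of `Ω`, with arbitrarily
small steps and with lengths that exceed `L` by arbitrarily little. -/
def Reach {E : Type*} [MetricSpace E] (Ω : Set E) (L : ℝ) (x y : E) : Prop :=
  ∀ δ > 0, ∃ ℓ < L + δ, Chain (Metric.thickening δ Ω) δ x y ℓ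

section Reach

variable {E : Type*} [MetricSpace E] {Ω : Set E} {x y z : E} {L L' : ℝ}

lemma Reach.nonneg (h : Reach Ω L x y) : 0 ≤ L := by
  refine le_of_forall_pos_le_add fun δ hδ => ?_
  obtain ⟨ℓ, hℓ, hc⟩ := h δ hδ
  exact hc.nonneg.trans hℓ.le

lemma Reach.symm (h : Reach Ω L x y) : Reach Ω L y x := fun δ hδ => by
  obtain ⟨ℓ, hℓ, hc⟩ := h δ hδ
  exact ⟨ℓ, hℓ, hc.symm⟩

lemma Reach.trans (h : Reach Ω L x y) (h' : Reach Ω L' y z) : Reach Ω (L + L') x z := by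
  intro δ hδ
  obtain ⟨ℓ, hℓ, hc⟩ := h (δ / 2) (by positivity)
  obtain ⟨ℓ', hℓ', hc'⟩ := h' (δ / 2) (by positivity)
  exact ⟨ℓ + ℓ', by linarith, (hc.trans hc').mono (Metric.thickening_mono (by linarith) _)
    (by linarith)⟩

lemma reach_of_forall_chain (h : ∀ δ > 0, ∃ ℓ ≤ L, Chain Ω δ x y ℓ) : Reach Ω L x y := by
  intro δ hδ
  obtain ⟨ℓ, hℓ, hc⟩ := h δ hδ
  exact ⟨ℓ, by linarith, hc.mono (Metric.self_subset_thickening hδ _) le_rfl⟩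

/-- The slack `δ` in `Reach` absorbs `ε`, so the set of admissible lengths is closed; this is why
the infimum `reachDist` is attained. -/
lemma reach_of_forall_lt (h : ∀ ε > 0, ∃ L' < L + ε, Reach Ω L' x y) : Reach Ω L x y := by
  intro δ hδ
  obtain ⟨L', hL', h'⟩ := h (δ / 2) (by positivity)
  obtain ⟨ℓ, hℓ, hc⟩ := h' (δ / 2) (by positivity)
  exact ⟨ℓ, by linarith, hc.mono (Metric.thickening_mono (by linarith) _) (by linarith)⟩

/-- The least length `L` with `Reach Ω L x y`. -/
noncomputable def reachDist (Ω : Set E) (x y : E) : ℝ := sInf {L | Reach Ω L x y}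

lemma reach_reachDist (h : ∃ L, Reach Ω L x y) : Reach Ω (reachDist Ω x y) x y := by
  refine reach_of_forall_lt fun ε hε => ?_
  obtain ⟨L', h', hL'⟩ := exists_lt_of_csInf_lt (s := {L | Reach Ω L x y}) h
    (lt_add_of_pos_right (reachDist Ω x y) hε)
  exact ⟨L', hL', h'⟩

lemma reachDist_le (h : Reach Ω L x y) : reachDist Ω x y ≤ L :=
  csInf_le ⟨0, fun _ h => h.nonneg⟩ h

/-- The unit-speed step function of a chain, rescaled to speed `L + δ`, reaches `y` before time `1`.
All functions are thus parametrised by the same time interval, with every error controlled by `δ`.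
-/
lemma exists_dist_le_stepFunction (h : Reach Ω L x y) {δ : ℝ} (hδ : 0 < δ) :
    ∃ Y : ℝ → E, Y 0 = x ∧ Y 1 = y ∧ (∀ t, Y t ∈ Metric.cthickening δ Ω) ∧
      ∀ s t, dist (Y s) (Y t) ≤ (L + δ) * |s - t| + δ := by
  obtain ⟨ℓ, hℓ, hc⟩ := h δ hδ
  obtain ⟨X, h0, h1, hS, hX⟩ := hc.exists_stepFunction hδ.le
  have hL : 0 < L + δ := by linarith [h.nonneg]
  refine ⟨fun t => X ((L + δ) * t), by simp [h0], h1 _ (by linarith),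
    fun t => Metric.thickening_subset_cthickening _ _ (hS _), fun s t => (hX _ _).trans ?_⟩
  rw [← mul_sub, abs_mul, abs_of_pos hL]

/-- By compactness, points related by `Reach Ω L` are joined by an `L`-Lipschitz path in `Ω`. -/
lemma Reach.exists_lipschitz_path [ProperSpace E] (h : Reach Ω L x y) (hΩ : IsCompact Ω) :
    ∃ X : ℝ → E, X 0 = x ∧ X 1 = y ∧ (∀ t, X t ∈ Ω) ∧ LipschitzWith L.toNNReal X := by
  let u : ℕ → ℝ := fun n => 1 / ((n : ℝ) + 1)
  have hu : ∀ n, 0 < u n := fun n => Nat.one_div_pos_of_nat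
  have hulim : Tendsto u atTop (𝓝 0) := tendsto_one_div_add_atTop_nhds_zero_nat
  have hanti : ∀ n, u (n + 1) ≤ u n := fun n => by
    simp only [u]; push_cast; gcongr; linarith
  -- Step functions are discontinuous, so compactness is taken in the product topology on `ℝ → E`:
  -- each `K n` is given by closed pointwise conditions, the `K n` decrease, and `K 0` is compact by
  -- Tychonoff. For a common element all the errors `u n` disappear.
  let K : ℕ → Set (ℝ → E) := fun n =>
    {Y | Y 0 = x ∧ Y 1 = y ∧ (∀ t, Y t ∈ Metric.cthickening (u n) Ω) ∧
      ∀ s t, dist (Y s) (Y t) ≤ (L + u n) * |s - t| + u n}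
  have hclosed : ∀ n, IsClosed (K n) := fun n => by
    have h1 : IsClosed {Y : ℝ → E | ∀ t, Y t ∈ Metric.cthickening (u n) Ω} := by
      rw [Set.ofPred_forall]
      exact isClosed_iInter fun t => Metric.isClosed_cthickening.preimage (continuous_apply t)
    have h2 : IsClosed {Y : ℝ → E | ∀ s t, dist (Y s) (Y t) ≤ (L + u n) * |s - t| + u n} := by
      simp_rw [Set.ofPred_forall]
      exact isClosed_iInter fun s => isClosed_iInter fun t =>
        isClosed_le ((continuous_apply s).dist (continuous_apply t)) continuous_const
    exact (isClosed_eq (continuous_apply 0) continuous_const).inter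
      ((isClosed_eq (continuous_apply 1) continuous_const).inter (h1.inter h2))
  have hcompact : IsCompact (K 0) :=
    (isCompact_univ_pi fun _ : ℝ => hΩ.cthickening (r := u 0)).of_isClosed_subset (hclosed 0)
      fun Y hY t _ => hY.2.2.1 t
  obtain ⟨X, hX⟩ := IsCompact.nonempty_iInter_of_sequence_nonempty_isCompact_isClosed K
    (fun n Y hY => ⟨hY.1, hY.2.1,
      fun t => Metric.cthickening_mono (hanti n) _ (hY.2.2.1 t),
      fun s t => (hY.2.2.2 s t).trans (by gcongr <;> exact hanti n)⟩)
    (fun n => exists_dist_le_stepFunction h (hu n)) hcompact hclosed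
  rw [mem_iInter] at hX
  refine ⟨X, (hX 0).1, (hX 0).2.1, fun t => ?_, LipschitzWith.of_dist_le_mul fun s t => ?_⟩
  · rw [← hΩ.isClosed.closure_eq, Metric.closure_eq_iInter_cthickening]
    refine mem_iInter₂.2 fun δ hδ => ?_
    obtain ⟨n, hn⟩ := (hulim.eventually (gt_mem_nhds hδ)).exists
    exact Metric.cthickening_mono hn.le _ ((hX n).2.2.1 t)
  · rw [Real.coe_toNNReal _ h.nonneg, Real.dist_eq]
    have hlim : Tendsto (fun n => (L + u n) * |s - t| + u n) atTop (𝓝 ((L + 0) * |s - t| + 0)) :=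
      ((hulim.const_add L).mul_const _).add hulim
    simpa using ge_of_tendsto' hlim fun n => (hX n).2.2.2 s t

end Reach

/-! ### Chains along paths, pointwise Lipschitz functions, and shortest paths. -/

/-- A path in `Ω` gives chains that are no longer than the path. -/
lemma exists_chain_of_absolutelyContinuous {E : Type*} [NormedAddCommGroup E]
    [InnerProductSpace ℝ E] [FiniteDimensional ℝ E] {Ω : Set E} {X : ℝ → E}
    (hX : AbsolutelyContinuousOnInterval X 0 1) (hΩ : ∀ t ∈ Icc (0 : ℝ) 1, X t ∈ Ω)
    {δ : ℝ} (hδ : 0 < δ) :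
    ∃ ℓ ≤ ∫ t in (0 : ℝ)..1, ‖deriv X t‖, Chain Ω δ (X 0) (X 1) ℓ := by
  obtain ⟨η, hη, hunif⟩ := Metric.uniformContinuousOn_iff.1 hX.uniformContinuousOn δ hδ
  rw [uIcc_of_le zero_le_one] at hunif
  obtain ⟨n, hn⟩ := exists_nat_one_div_lt hη
  have hn0 : (0 : ℝ) < n + 1 := by positivity
  have hmem : ∀ i : ℕ, i ≤ n + 1 → (i : ℝ) / (n + 1) ∈ Icc (0 : ℝ) 1 := fun i hi =>
    ⟨by positivity, (div_le_one hn0).2 (by exact_mod_cast hi)⟩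
  have hint := (intervalIntegrable_deriv_of_absolutelyContinuous hX).norm
  have key : ∀ i : ℕ, i ≤ n + 1 → ∃ ℓ ≤ ∫ t in (0 : ℝ)..((i : ℝ) / (n + 1)), ‖deriv X t‖,
      Chain Ω δ (X 0) (X ((i : ℝ) / (n + 1))) ℓ := by
    intro i
    induction i with
    | zero => exact fun _ => ⟨0, by simp, by simpa using Chain.refl (hΩ 0 (by simp))⟩
    | succ i ih =>
      intro hi
      obtain ⟨ℓ, hℓ, hc⟩ := ih (by omega)
      have hm := hmem i (by omega)
      have hm' := hmem (i + 1) hi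
      have hle : (i : ℝ) / (n + 1) ≤ ((i + 1 : ℕ) : ℝ) / (n + 1) := by
        push_cast; gcongr; linarith
      have hsub : uIcc ((i : ℝ) / (n + 1)) (((i + 1 : ℕ) : ℝ) / (n + 1)) ⊆ uIcc (0 : ℝ) 1 := by
        rw [uIcc_of_le hle, uIcc_of_le zero_le_one]
        exact Icc_subset_Icc hm.1 hm'.2
      refine ⟨_, ?_, hc.step (hΩ _ hm') (hunif _ hm _ hm' ?_)⟩
      · have h1 := norm_sub_le_integral_norm_deriv hle (hX.mono hsub)
        have h2 := intervalIntegral.integral_add_adjacent_intervals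
          (hint.mono_set (c := 0) (d := (i : ℝ) / (n + 1))
            (by rw [uIcc_of_le hm.1, uIcc_of_le zero_le_one]; exact Icc_subset_Icc le_rfl hm.2))
          (hint.mono_set hsub)
        rw [dist_comm, dist_eq_norm]
        linarith
      · rw [dist_comm, Real.dist_eq, abs_of_nonneg (sub_nonneg.2 hle)]
        refine lt_of_eq_of_lt ?_ hn
        push_cast; field_simp; ring
  have h1 : ((n + 1 : ℕ) : ℝ) / (n + 1) = 1 := by push_cast; exact div_self hn0.ne'
  have h2 := key (n + 1) le_rfl
  rwa [h1] at h2

/-- A function on an interval that is pointwise `L`-Lipschitz is `L`-Lipschitz. -/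
lemma abs_sub_le_of_eventually_abs_sub_le {h : ℝ → ℝ} {a b L : ℝ} (hab : a ≤ b)
    (hloc : ∀ t ∈ Icc a b, ∀ᶠ s in 𝓝[Icc a b] t, |h s - h t| ≤ L * |s - t|) :
    |h b - h a| ≤ L * (b - a) := by
  have hcont : ContinuousOn h (Icc a b) := by
    intro t ht
    rw [ContinuousWithinAt, tendsto_iff_dist_tendsto_zero]
    refine squeeze_zero' (.of_forall fun _ => dist_nonneg) (hloc t ht) ?_
    have : Tendsto (fun s => L * |s - t|) (𝓝 t) (𝓝 (L * |t - t|)) := by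
      exact (Continuous.tendsto (by fun_prop) t)
    simpa using this.mono_left nhdsWithin_le_nhds
  rcases hab.eq_or_lt with rfl | hlt
  · simp
  refine le_of_forall_pos_le_add fun ε hε => ?_
  have hpos : 0 < b - a := sub_pos.2 hlt
  -- The comparison principle needs a boundary function of slope strictly above `L`; the excess `ε /
  -- (b - a)` adds up to `ε` over the interval.
  have hfin := image_norm_le_of_liminf_right_slope_norm_lt_deriv_boundary
    (f := fun t => h t - h a) (f' := fun _ => L) (B := fun t => (L + ε / (b - a)) * (t - a))
    (B' := fun _ => L + ε / (b - a)) (a := a) (b := b) (hcont.sub continuousOn_const) ?_ (by simp)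
    (by fun_prop) ?_ (fun _ _ _ => lt_add_of_pos_right _ (by positivity)) (right_mem_Icc.2 hab)
  · simp only [Real.norm_eq_abs] at hfin
    refine hfin.trans (le_of_eq ?_)
    field_simp
  · intro x hx r hr
    refine Eventually.frequently ?_
    have h1 : ∀ᶠ s in 𝓝[>] x, |h s - h x| ≤ L * |s - x| := by
      have h2 : 𝓝[>] x ≤ 𝓝[Icc a b] x := by
        rw [← nhdsWithin_Ioc_eq_nhdsGT hx.2]
        exact nhdsWithin_mono _ fun s hs => ⟨hx.1.trans hs.1.le, hs.2⟩
      exact h2 (hloc x ⟨hx.1, hx.2.le⟩)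
    filter_upwards [h1, self_mem_nhdsWithin] with s hs hsx
    have hsx' : 0 < s - x := sub_pos.2 hsx
    refine lt_of_le_of_lt ?_ hr
    simp only [slope_def_field, Function.comp_apply, Real.norm_eq_abs]
    rw [div_le_iff₀ hsx']
    rw [abs_of_pos hsx'] at hs
    have h3 := abs_sub_abs_le_abs_sub (h s - h a) (h x - h a)
    rw [sub_sub_sub_cancel_right] at h3
    exact h3.trans hs
  · intro x _
    simpa using (((hasDerivAt_id x).sub_const a).const_mul (L + ε / (b - a))).hasDerivWithinAt

section PathLengths

variable {d : ℕ} {Ω : Set (EuclideanSpace ℝ (Fin d))} {x y : EuclideanSpace ℝ (Fin d)} {L : ℝ}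

lemma reach_of_mem_pathLengths (h : L ∈ pathLengths Ω x y) : Reach Ω L x y := by
  obtain ⟨X, hX, rfl, rfl, hΩ, rfl⟩ := h
  exact reach_of_forall_chain fun δ hδ => exists_chain_of_absolutelyContinuous hX hΩ hδ

/-- The speed of an `L`-Lipschitz path on `[0, 1]` is at most `L`, hence so is its length. -/
lemma Reach.exists_mem_pathLengths (h : Reach Ω L x y) (hΩ : IsCompact Ω) :
    ∃ r ∈ pathLengths Ω x y, r ≤ L := by
  obtain ⟨X, h0, h1, hmem, hLip⟩ := h.exists_lipschitz_path hΩ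
  refine ⟨_, ⟨X, (hLip.lipschitzOnWith (s := _)).absolutelyContinuousOnInterval, h0, h1,
    fun t _ => hmem t, rfl⟩, ?_⟩
  have hle : ∀ t, ‖deriv X t‖ ≤ L := fun t => by
    simpa [Real.coe_toNNReal _ h.nonneg] using norm_deriv_le_of_lipschitz hLip (x₀ := t)
  have h2 := intervalIntegral.norm_integral_le_of_norm_le_const (a := (0 : ℝ)) (b := 1) (C := L)
    (f := fun t => ‖deriv X t‖) (fun t _ => by simpa using hle t)
  simpa using (le_abs_self _).trans h2

/-- The length of a shortest path is `reachDist`. -/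
lemma isLeast_pathLengths (hΩ : IsCompact Ω) (h : ∃ L, Reach Ω L x y) :
    IsLeast (pathLengths Ω x y) (reachDist Ω x y) := by
  refine ⟨?_, fun r hr => reachDist_le (reach_of_mem_pathLengths hr)⟩
  obtain ⟨r, hr, hle⟩ := (reach_reachDist h).exists_mem_pathLengths hΩ
  rwa [hle.antisymm' (reachDist_le (reach_of_mem_pathLengths hr))]

/-- In a convex set, the segment is a shortest path. -/
lemma isLeast_pathLengths_of_convex (hΩ : Convex ℝ Ω) (hx : x ∈ Ω) (hy : y ∈ Ω) :
    IsLeast (pathLengths Ω x y) (dist x y) := by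
  have hder : ∀ t, HasDerivAt (fun t : ℝ => AffineMap.lineMap x y t) (y - x) t := fun t =>
    AffineMap.hasDerivAt_lineMap
  refine ⟨⟨fun t => AffineMap.lineMap x y t, ?_, by simp, by simp, fun t ht => ?_, ?_⟩, ?_⟩
  · have hc : ContDiff ℝ 1 (fun t : ℝ => AffineMap.lineMap (k := ℝ) x y t) := by
      simp only [AffineMap.lineMap_apply, vsub_eq_sub, vadd_eq_add]
      fun_prop
    exact hc.contDiffOn.absolutelyContinuousOnInterval
  · exact hΩ.segment_subset hx hy (segment_eq_image_lineMap ℝ x y ▸ mem_image_of_mem _ ht)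
  · simp [(hder _).deriv, dist_eq_norm, norm_sub_rev]
  · rintro r ⟨X, hX, rfl, rfl, -, rfl⟩
    rw [dist_comm, dist_eq_norm]
    exact norm_sub_le_integral_norm_deriv zero_le_one hX

end PathLengths

end SRBD

/-! ### Truncated chain distances and their mollification. -/

namespace SRBD

section ChainDist

variable {E : Type*} [MetricSpace E] {S : Set E} {δ M : ℝ} {y z z' : E}

/-- The length of a shortest `δ`-chain from `y` to `z` in `S`, truncated at `M`. -/
noncomputable def truncChainDist (S : Set E) (δ M : ℝ) (y z : E) : ℝ :=
  min M (sInf {ℓ | Chain S δ y z ℓ})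

lemma truncChainDist_nonneg (hM : 0 ≤ M) : 0 ≤ truncChainDist S δ M y z :=
  le_min hM (Real.sInf_nonneg fun _ h => h.nonneg)

lemma truncChainDist_self (hM : 0 ≤ M) (hy : y ∈ S) : truncChainDist S δ M y y = 0 :=
  le_antisymm ((min_le_right _ _).trans (csInf_le ⟨0, fun _ h => h.nonneg⟩ (.refl hy)))
    (truncChainDist_nonneg hM)

/-- No chain in `S` ends outside `S`, and the infimum of the empty set is `0`. The function
therefore equals its own indicator on `S`, which gives its measurability. -/
lemma truncChainDist_of_notMem (hM : 0 ≤ M) (hz : z ∉ S) : truncChainDist S δ M y z = 0 := by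
  have : {ℓ | Chain S δ y z ℓ} = ∅ := eq_empty_of_forall_notMem fun ℓ h => hz h.right_mem
  rw [truncChainDist, this, Real.sInf_empty, min_eq_right hM]

/-- Some chain has to exist: without one the infimum would take the default value `0` instead of
being large. -/
lemma truncChainDist_eq (h : ∃ ℓ, Chain S δ y z ℓ) (hM : ∀ ℓ, Chain S δ y z ℓ → M ≤ ℓ) :
    truncChainDist S δ M y z = M :=
  min_eq_left (le_csInf h hM)

lemma sInf_chain_le_add (hz : z ∈ S) (hz' : z' ∈ S) (hd : dist z z' < δ) :
    sInf {ℓ | Chain S δ y z' ℓ} ≤ sInf {ℓ | Chain S δ y z ℓ} + dist z z' := by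
  -- If no chain reaches `z`, then none reaches the nearby point `z'` either, and both infima take
  -- the default value `0`.
  rcases Set.eq_empty_or_nonempty {ℓ | Chain S δ y z ℓ} with h | h
  · have h' : {ℓ | Chain S δ y z' ℓ} = ∅ := eq_empty_of_forall_notMem fun ℓ hℓ =>
      (Set.eq_empty_iff_forall_notMem.1 h) _ (Chain.step hℓ hz (by rwa [dist_comm]))
    rw [h, h', Real.sInf_empty]
    positivity
  · rw [← sub_le_iff_le_add]
    refine le_csInf h fun ℓ hℓ => ?_
    rw [sub_le_iff_le_add]
    exact csInf_le ⟨0, fun _ h => h.nonneg⟩ (Chain.step hℓ hz' hd)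

lemma abs_truncChainDist_sub_le (hz : z ∈ S) (hz' : z' ∈ S) (hd : dist z z' < δ) :
    |truncChainDist S δ M y z - truncChainDist S δ M y z'| ≤ dist z z' := by
  refine (abs_min_sub_min_le_max _ _ _ _).trans ?_
  rw [sub_self, abs_zero, max_eq_right (abs_nonneg _), abs_le]
  have h1 := sInf_chain_le_add (y := y) hz hz' hd
  have h2 := sInf_chain_le_add (y := y) hz' hz (by rwa [dist_comm])
  rw [dist_comm z' z] at h2
  constructor <;> linarith

end ChainDist

variable {E : Type*} [NormedAddCommGroup E] [InnerProductSpace ℝ E] [FiniteDimensional ℝ E]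
  [MeasurableSpace E] [BorelSpace E]

/-- The function is continuous on the open set `S`, being `1`-Lipschitz at scale `δ`, and vanishes
elsewhere. -/
lemma aestronglyMeasurable_truncChainDist {S : Set E} (hS : IsOpen S) {δ M : ℝ} (hδ : 0 < δ)
    (hM : 0 ≤ M) (y : E) : AEStronglyMeasurable (truncChainDist S δ M y) volume := by
  have h1 : ContinuousOn (truncChainDist S δ M y) S := by
    intro z hz
    refine ContinuousAt.continuousWithinAt ?_
    rw [ContinuousAt, tendsto_iff_dist_tendsto_zero]
    refine squeeze_zero' (.of_forall fun _ => dist_nonneg) (g := fun z' => dist z' z) ?_ ?_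
    · filter_upwards [hS.mem_nhds hz, Metric.ball_mem_nhds z hδ] with z' h1 h2
      exact abs_truncChainDist_sub_le h1 hz h2
    · have : Tendsto (fun z' => dist z' z) (𝓝 z) (𝓝 (dist z z)) :=
        Continuous.tendsto (by fun_prop) z
      simpa using this
  have h2 : truncChainDist S δ M y = S.indicator (truncChainDist S δ M y) := by
    refine (indicator_eq_self.2 fun z hz => ?_).symm
    by_contra hzS
    exact hz (truncChainDist_of_notMem hM hzS)
  rw [h2, aestronglyMeasurable_indicator_iff hS.measurableSet]
  exact h1.aestronglyMeasurable hS.measurableSet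

/-- A bounded measurable function that is `1`-Lipschitz at small scales near `Ω` has smooth
approximations whose gradient is at most `1` on `Ω`. -/
lemma exists_contDiff_of_locally_lipschitz {Ω : Set E} {δ M : ℝ} (hδ : 0 < δ) {u : E → ℝ}
    (hu : AEStronglyMeasurable u volume) (hM : ∀ z, |u z| ≤ M)
    (hLip : ∀ z ∈ Metric.thickening δ Ω, ∀ z' ∈ Metric.thickening δ Ω, dist z z' < δ →
      |u z - u z'| ≤ dist z z') :
    ∃ F : E → ℝ, ContDiff ℝ 1 F ∧ ∀ z ∈ Ω, ‖fderiv ℝ F z‖ ≤ 1 ∧ |F z - u z| ≤ δ / 2 := by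
  -- The outer radius `δ / 2` keeps `z' - w` in the `δ`-thickening whenever `z'` is within `δ / 2`
  -- of a point of `Ω`. The inner radius plays no role.
  let ψ : ContDiffBump (0 : E) := ⟨δ / 4, δ / 2, by positivity, by linarith⟩
  have hloc : LocallyIntegrable u volume :=
    (memLp_top_of_bound hu M (.of_forall hM)).locallyIntegrable le_top
  let F : E → ℝ := convolution (ψ.normed volume) u (ContinuousLinearMap.lsmul ℝ ℝ) volume
  have hF : ContDiff ℝ 1 F :=
    ψ.hasCompactSupport_normed.contDiff_convolution_left (n := 1) _ ψ.contDiff_normed hloc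
  have hint : ∀ z, Integrable (fun w => ψ.normed volume w • u (z - w)) volume := fun z =>
    ψ.hasCompactSupport_normed.convolutionExists_left (ContinuousLinearMap.lsmul ℝ ℝ)
      ψ.continuous_normed hloc z
  refine ⟨F, hF, fun z hz => ⟨?_, ?_⟩⟩
  · refine norm_fderiv_le_of_lip' ℝ zero_le_one ?_
    filter_upwards [Metric.ball_mem_nhds z (half_pos hδ)] with z' hz'
    have h1 : F z' - F z = ∫ w, (ψ.normed volume w • u (z' - w) - ψ.normed volume w • u (z - w)) :=
      (integral_sub (hint z') (hint z)).symm
    rw [h1, one_mul]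
    have h2 : ∫ w, ψ.normed volume w * ‖z' - z‖ = ‖z' - z‖ := by
      rw [integral_mul_const, ψ.integral_normed, one_mul]
    rw [← h2]
    refine norm_integral_le_of_norm_le (ψ.integrable_normed.mul_const _) (.of_forall fun w => ?_)
    rw [← smul_sub, norm_smul, Real.norm_of_nonneg (ψ.nonneg_normed w)]
    by_cases hw : w ∈ Metric.ball (0 : E) (δ / 2)
    · refine mul_le_mul_of_nonneg_left ?_ (ψ.nonneg_normed w)
      rw [mem_ball_zero_iff] at hw
      rw [Metric.mem_ball, dist_eq_norm] at hz'
      have h3 : dist (z' - w) (z - w) = ‖z' - z‖ := by rw [dist_sub_right, dist_eq_norm]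
      have h4 := hLip (z' - w) ?_ (z - w) ?_ (by rw [h3]; linarith)
      · rwa [h3] at h4
      · refine Metric.mem_thickening_iff.2 ⟨z, hz, ?_⟩
        rw [dist_eq_norm, sub_right_comm]
        linarith [norm_sub_le (z' - z) w]
      · refine Metric.mem_thickening_iff.2 ⟨z, hz, ?_⟩
        rw [dist_eq_norm, sub_right_comm, sub_self, zero_sub, norm_neg]
        linarith
    · have : ψ.normed volume w = 0 := by
        by_contra h
        exact hw (ψ.support_normed_eq (μ := volume) ▸ (Function.mem_support.2 h))
      simp [this]
  · refine ψ.dist_normed_convolution_le hu fun z' hz' => ?_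
    have hz'' : dist z' z < δ / 2 := hz'
    exact (hLip z' (Metric.mem_thickening_iff.2 ⟨z, hz, by linarith⟩) z
      (Metric.self_subset_thickening hδ _ hz) (by linarith)).trans hz''.le

/-- `C¹` functions with gradient at most `1` on `Ω` see the whole length distance. -/
lemma exists_contDiff_of_lt_reachDist {Ω : Set E} {x y : E} (hx : x ∈ Ω) (hy : y ∈ Ω)
    (h : ∃ L, Reach Ω L x y) {L : ℝ} (hL : L < reachDist Ω x y) :
    ∃ F : E → ℝ, ContDiff ℝ 1 F ∧ (∀ z ∈ Ω, ‖fderiv ℝ F z‖ ≤ 1) ∧ L ≤ F x - F y := by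
  rcases lt_or_ge L 0 with hL0 | hL0
  · exact ⟨fun _ => 0, contDiff_const, by simp, by simpa using hL0.le⟩
  -- Failure of `Reach` provides a `δ` for which every chain from `y` to `x` has length at least `L
  -- + δ`. With this truncation level `u x = L + δ` and `u y = 0`, and mollifying costs `δ / 2` at
  -- each of the two points, which leaves `L`.
  have hnot : ¬ Reach Ω L y x := fun h => (reachDist_le h.symm).not_gt hL
  simp only [Reach, not_forall, not_exists, not_and] at hnot
  obtain ⟨δ, hδ, hno⟩ := hnot
  have hM : 0 ≤ L + δ := by positivity
  obtain ⟨L₀, hL₀⟩ := h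
  -- At least one chain at scale `δ` exists, so `u x` is not the default value `0`.
  obtain ⟨ℓ, -, hc⟩ := hL₀.symm δ hδ
  let u := truncChainDist (Metric.thickening δ Ω) δ (L + δ) y
  obtain ⟨F, hF, hF'⟩ := exists_contDiff_of_locally_lipschitz (Ω := Ω) (u := u) (M := L + δ) hδ
    (aestronglyMeasurable_truncChainDist Metric.isOpen_thickening hδ hM y)
    (fun z => by rw [abs_of_nonneg (truncChainDist_nonneg hM)]; exact min_le_left _ _)
    (fun z hz z' hz' hd => abs_truncChainDist_sub_le hz hz' hd)
  refine ⟨F, hF, fun z hz => (hF' z hz).1, ?_⟩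
  have hux : u x = L + δ := truncChainDist_eq ⟨ℓ, hc⟩ fun ℓ hℓ => not_lt.1 fun hlt => hno ℓ hlt hℓ
  have huy : u y = 0 := truncChainDist_self hM (Metric.self_subset_thickening hδ _ hy)
  have h1 := abs_le.1 (hF' x hx).2
  have h2 := abs_le.1 (hF' y hy).2
  rw [hux] at h1
  rw [huy] at h2
  linarith [h1.1, h2.2]

end SRBD

/-! ### Pushing `Ω` into its interior: finiteness of the distance and Lipschitz bounds up to the
boundary. -/

namespace SRBD

variable {d : ℕ} {Ω : Set (EuclideanSpace ℝ (Fin d))}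

/-- A defining function vanishes at boundary points. -/
lemma eq_zero_of_mem_frontier {X : Type*} [TopologicalSpace X] {Ω U : Set X} (hΩ : IsClosed Ω)
    (hU : IsOpen U) {g : X → ℝ} (hg : Continuous g) (hΩU : Ω ∩ U = {x ∈ U | g x ≤ 0}) {x : X}
    (hx : x ∈ frontier Ω) (hxU : x ∈ U) : g x = 0 := by
  have h1 : x ∈ Ω ∩ U := ⟨hΩ.frontier_subset hx, hxU⟩
  rw [hΩU] at h1
  refine h1.2.antisymm (not_lt.1 fun hlt => hx.2 ?_)
  refine mem_interior.2 ⟨U ∩ {z | g z < 0}, fun z hz => ?_, hU.inter (isOpen_lt hg continuous_const),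
    hxU, hlt⟩
  have : z ∈ {x ∈ U | g x ≤ 0} := ⟨hz.1, le_of_lt hz.2⟩
  rw [← hΩU] at this
  exact this.1

/-- Near each of its points, `Ω` is pushed into its interior by a constant vector field. -/
lemma exists_inward_vector (hΩ : IsClosed Ω) (hsmooth : HasSmoothBoundary Ω)
    {p : EuclideanSpace ℝ (Fin d)} (hp : p ∈ Ω) :
    ∃ v : EuclideanSpace ℝ (Fin d), ∃ r > 0, ∀ x ∈ Ω ∩ Metric.ball p r, ∀ ε ∈ Ioo 0 r,
      x + ε • v ∈ interior Ω := by
  by_cases hpi : p ∈ interior Ω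
  · obtain ⟨r, hr, hball⟩ := Metric.isOpen_iff.1 isOpen_interior p hpi
    exact ⟨0, r, hr, fun x hx ε _ => by simpa using hball hx.2⟩
  · obtain ⟨U, hU, hpU, g, hg, hg', hΩU⟩ := hsmooth p ⟨subset_closure hp, hpi⟩
    obtain ⟨w, hw⟩ : ∃ w, fderiv ℝ g p w < 0 := by
      by_contra! h
      refine hg' (ContinuousLinearMap.ext fun w => le_antisymm ?_ (h w))
      simpa using h (-w)
    have hcont : Continuous fun x => fderiv ℝ g x w :=
      (hg.continuous_fderiv (by simp)).clm_apply continuous_const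
    obtain ⟨ρ, hρ, hball⟩ := Metric.isOpen_iff.1
      (hU.inter (isOpen_lt hcont continuous_const)) p ⟨hpU, hw⟩
    have hw0 : 0 < ‖w‖ := norm_pos_iff.2 fun h => by simp [h] at hw
    -- Half of `ρ` is for the distance from `x` to `p`, the other half for the shift `ε • w`. On the
    -- whole segment `g` is then strictly decreasing.
    refine ⟨w, min (ρ / 2) (ρ / (2 * ‖w‖)), by positivity, fun x hx ε hε => ?_⟩
    have hseg : ∀ t ∈ Icc 0 ε, x + t • w ∈ Metric.ball p ρ := fun t ht => by
      have h1 : dist x p < ρ / 2 := (Metric.mem_ball.1 hx.2).trans_le (min_le_left _ _)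
      have h2 : t * ‖w‖ < ρ / 2 := by
        have := (ht.2.trans_lt hε.2).trans_le (min_le_right _ _)
        rw [lt_div_iff₀ (by positivity)] at this
        linarith
      have h3 : dist (x + t • w) x = t * ‖w‖ := by
        rw [dist_eq_norm, add_sub_cancel_left, norm_smul, Real.norm_of_nonneg ht.1]
      rw [Metric.mem_ball]
      linarith [dist_triangle (x + t • w) x p]
    have hder : ∀ t : ℝ, HasDerivAt (fun t : ℝ => g (x + t • w)) (fderiv ℝ g (x + t • w) w) t := by
      intro t
      have h1 : HasDerivAt (fun t : ℝ => x + t • w) w t := by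
        simpa using ((hasDerivAt_id t).smul_const w).const_add x
      exact ((hg.differentiable (by simp) _).hasFDerivAt).comp_hasDerivAt t h1
    have hanti : StrictAntiOn (fun t : ℝ => g (x + t • w)) (Icc 0 ε) := by
      refine strictAntiOn_of_deriv_neg (convex_Icc _ _)
        (fun t _ => (hder t).continuousAt.continuousWithinAt) fun t ht => ?_
      rw [(hder t).deriv]
      exact (hball (hseg t (interior_subset ht))).2
    have h0 : g x ≤ 0 := by
      have hxU : x ∈ U := by simpa using (hball (hseg 0 ⟨le_rfl, hε.1.le⟩)).1
      have : x ∈ Ω ∩ U := ⟨hx.1, hxU⟩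
      rw [hΩU] at this
      exact this.2
    have hneg : g (x + ε • w) < 0 := by
      have := hanti (left_mem_Icc.2 hε.1.le) (right_mem_Icc.2 hε.1.le) hε.1
      simp only [zero_smul, add_zero] at this
      linarith
    have hεU := (hball (hseg ε ⟨hε.1.le, le_rfl⟩)).1
    have hmem : x + ε • w ∈ Ω ∩ U := by
      rw [hΩU]
      exact ⟨hεU, hneg.le⟩
    by_contra hni
    exact hneg.ne (eq_zero_of_mem_frontier hΩ hU hg.continuous hΩU ⟨subset_closure hmem.1, hni⟩ hεU)

lemma reach_of_segment_subset {x y : EuclideanSpace ℝ (Fin d)} (h : segment ℝ x y ⊆ Ω) :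
    Reach Ω (dist x y) x y := by
  have h1 := (isLeast_pathLengths_of_convex (convex_segment x y) (left_mem_segment ℝ x y)
    (right_mem_segment ℝ x y)).1
  obtain ⟨X, hX, h0, h1, hmem, hr⟩ := h1
  exact reach_of_mem_pathLengths ⟨X, hX, h0, h1, fun t ht => h (hmem t ht), hr⟩

/-- Any two points of a connected set with smooth boundary are at finite length distance. -/
lemma exists_reach (hΩ : IsClosed Ω) (hconn : IsConnected Ω) (hsmooth : HasSmoothBoundary Ω)
    {x y : EuclideanSpace ℝ (Fin d)} (hx : x ∈ Ω) (hy : y ∈ Ω) : ∃ L, Reach Ω L x y := by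
  -- Being at finite distance is symmetric and transitive, so on a connected set it suffices to
  -- prove it locally.
  refine hconn.isPreconnected.induction₂ (fun x y => ∃ L, Reach Ω L x y) (fun p hp => ?_)
    (fun x y z _ _ _ ⟨L, h⟩ ⟨L', h'⟩ => ⟨_, h.trans h'⟩) (fun x y _ _ ⟨L, h⟩ => ⟨L, h.symm⟩) hx hy
  obtain ⟨v, r, hr, hv⟩ := exists_inward_vector hΩ hsmooth hp
  have hpush : ∀ x ∈ Ω ∩ Metric.ball p r, Reach Ω (dist x (x + (r / 2) • v)) x (x + (r / 2) • v) := by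
    intro x hx
    refine reach_of_segment_subset ?_
    rw [segment_eq_image']
    rintro _ ⟨t, ht, rfl⟩
    rcases ht.1.eq_or_lt with rfl | ht0
    · simpa using hx.1
    · have := interior_subset (hv x hx (t * (r / 2)) ⟨by positivity, by nlinarith [ht.2]⟩)
      simpa [mul_smul] using this
  have hpi : p + (r / 2) • v ∈ interior Ω :=
    hv p ⟨hp, Metric.mem_ball_self hr⟩ _ ⟨by positivity, by linarith⟩
  obtain ⟨ρ, hρ, hball⟩ := Metric.isOpen_iff.1 isOpen_interior _ hpi
  filter_upwards [self_mem_nhdsWithin, nhdsWithin_le_nhds (Metric.ball_mem_nhds p hr),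
    nhdsWithin_le_nhds (Metric.ball_mem_nhds p hρ)] with x hxΩ hxr hxρ
  have hmid : Reach Ω (dist (p + (r / 2) • v) (x + (r / 2) • v))
      (p + (r / 2) • v) (x + (r / 2) • v) := by
    refine reach_of_segment_subset (((convex_ball _ _).segment_subset (Metric.mem_ball_self hρ) ?_)
      |>.trans (hball.trans interior_subset))
    rwa [Metric.mem_ball, dist_add_right]
  -- From `p` inwards along `v`, then across a ball inside the interior, then back outwards along
  -- `v` to `x`.
  exact ⟨_, ((hpush p ⟨hp, Metric.mem_ball_self hr⟩).trans hmid).trans (hpush x ⟨hxΩ, hxr⟩).symm⟩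

/-- A continuous function on `Ω` that is pointwise `1`-Lipschitz in the interior is
`1`-Lipschitz for the length distance. -/
lemma sub_le_of_reach (hΩ : IsCompact Ω) (hsmooth : HasSmoothBoundary Ω)
    {f : EuclideanSpace ℝ (Fin d) → ℝ} (hf : ContinuousOn f Ω)
    (hLip : ∀ z ∈ interior Ω, ∀ᶠ w in 𝓝 z, |f w - f z| ≤ dist w z)
    {x y : EuclideanSpace ℝ (Fin d)} {L : ℝ} (h : Reach Ω L x y) : f x - f y ≤ L := by
  obtain ⟨X, rfl, rfl, hmem, hX⟩ := h.exists_lipschitz_path hΩ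
  have hL := h.nonneg
  have hXL : ∀ s t, dist (X s) (X t) ≤ L * |s - t| := fun s t => by
    simpa [Real.coe_toNNReal _ hL, Real.dist_eq] using hX.dist_le_mul s t
  have key := abs_sub_le_of_eventually_abs_sub_le (h := f ∘ X) (L := L) zero_le_one ?_
  · simp only [Function.comp_apply, sub_zero, mul_one] at key
    linarith [(abs_le.1 key).1]
  intro t _
  obtain ⟨v, r, hr, hv⟩ := exists_inward_vector hΩ.isClosed hsmooth (hmem t)
  obtain ⟨τ, hτ, hball⟩ := Metric.mem_nhds_iff.1
    (hX.continuous.continuousAt.preimage_mem_nhds (Metric.ball_mem_nhds (X t) hr))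
  have hmono : ∀ a b, a ≤ b → a ∈ Metric.ball t τ → b ∈ Metric.ball t τ →
      |f (X b) - f (X a)| ≤ L * (b - a) := by
    intro a b hab ha hb
    have hsub : Icc a b ⊆ Metric.ball t τ := (convex_ball t τ).ordConnected.out ha hb
    -- The path itself may run along the boundary, where nothing is known about increments of `f`.
    -- Its translate by `ε • v` lies in the interior and has the same Lipschitz constant; then `ε`
    -- tends to `0`. As `v` is only adapted to points near `X t`, this is done near each time `t`.
    have hε : ∀ ε ∈ Ioo 0 r, |f (X b + ε • v) - f (X a + ε • v)| ≤ L * (b - a) := by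
      intro ε hε
      refine abs_sub_le_of_eventually_abs_sub_le (h := fun s => f (X s + ε • v)) hab fun s hs => ?_
      have hint := hv (X s) ⟨hmem s, hball (hsub hs)⟩ ε hε
      have hc : Tendsto (fun s' => X s' + ε • v) (𝓝 s) (𝓝 (X s + ε • v)) :=
        (hX.continuous.add continuous_const).tendsto s
      refine nhdsWithin_le_nhds ((hc.eventually (hLip _ hint)).mono fun s' hs' => hs'.trans ?_)
      rw [dist_add_right]
      exact hXL s' s
    have hlim : ∀ s ∈ Metric.ball t τ,
        Tendsto (fun ε : ℝ => f (X s + ε • v)) (𝓝[>] 0) (𝓝 (f (X s))) := by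
      intro s hs
      have h1 : Tendsto (fun ε : ℝ => X s + ε • v) (𝓝[>] 0) (𝓝[Ω] (X s)) := by
        refine tendsto_nhdsWithin_iff.2 ⟨?_, ?_⟩
        · have : Tendsto (fun ε : ℝ => X s + ε • v) (𝓝 0) (𝓝 (X s + (0 : ℝ) • v)) :=
            Continuous.tendsto (by fun_prop) _
          simpa using this.mono_left nhdsWithin_le_nhds
        · filter_upwards [Ioo_mem_nhdsGT hr] with ε hε
          exact interior_subset (hv (X s) ⟨hmem s, hball hs⟩ ε hε)
      exact (hf (X s) (hmem s)).tendsto.comp h1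
    refine le_of_tendsto ((hlim b hb).sub (hlim a ha)).abs ?_
    filter_upwards [Ioo_mem_nhdsGT hr] with ε hε'
    exact hε ε hε'
  refine nhdsWithin_le_nhds ?_
  filter_upwards [Metric.ball_mem_nhds t hτ] with s hs
  rcases le_total t s with hts | hts
  · rw [abs_of_nonneg (sub_nonneg.2 hts)]
    exact hmono t s hts (Metric.mem_ball_self hτ) hs
  · rw [abs_sub_comm, abs_sub_comm s, abs_of_nonneg (sub_nonneg.2 hts)]
    exact hmono s t hts hs (Metric.mem_ball_self hτ)

end SRBD

/-! ### Limits in `L²`, integration by parts, and closability of directional derivatives. -/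

namespace SRBD

section L2

variable {α : Type*} [MeasurableSpace α] {ν : Measure α} {F : Type*} [NormedAddCommGroup F]

lemma tendsto_toLp_iff {u : ℕ → α → F} {v : α → F} (hu : ∀ n, MemLp (u n) 2 ν)
    (hv : MemLp v 2 ν) : Tendsto (fun n => (hu n).toLp (u n)) atTop (𝓝 (hv.toLp v)) ↔
      Tendsto (fun n => eLpNorm (u n - v) 2 ν) atTop (𝓝 0) :=
  Lp.tendsto_Lp_iff_tendsto_eLpNorm'' u hu v hv

/-- The property `eLpNorm → 0` passes to sequences dominated pointwise. -/
lemma tendsto_eLpNorm_of_le_mul {β : Type*} {G : Type*} [NormedAddCommGroup G] {l : Filter β}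
    {u : β → α → F} {w : β → α → G} {C : ℝ} {p : ℝ≥0∞}
    (h : ∀ n, ∀ᵐ x ∂ν, ‖w n x‖ ≤ C * ‖u n x‖)
    (hl : Tendsto (fun n => eLpNorm (u n) p ν) l (𝓝 0)) :
    Tendsto (fun n => eLpNorm (w n) p ν) l (𝓝 0) := by
  have h1 : Tendsto (fun n => ENNReal.ofReal C * eLpNorm (u n) p ν) l (𝓝 0) := by
    simpa using ENNReal.Tendsto.const_mul hl (Or.inr ENNReal.ofReal_ne_top)
  exact tendsto_of_tendsto_of_tendsto_of_le_of_le tendsto_const_nhds h1 (fun _ => zero_le)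
    fun n => eLpNorm_le_mul_eLpNorm_of_ae_le_mul (h n) p

/-- Products of a bounded a.e. convergent sequence of factors with a fixed `L²` function. -/
lemma tendsto_eLpNorm_mul_of_dominated [NormedSpace ℝ F] [IsFiniteMeasure ν] {a : ℕ → α → ℝ}
    {G : α → F} {C : ℝ} (ha : ∀ n, AEStronglyMeasurable (a n) ν) (hG : MemLp G 2 ν)
    (hC : ∀ n x, |a n x| ≤ C) (hlim : ∀ᵐ x ∂ν, Tendsto (fun n => a n x) atTop (𝓝 0)) :
    Tendsto (fun n => eLpNorm (fun x => a n x • G x) 2 ν) atTop (𝓝 0) := by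
  have h1 : Tendsto (fun n => ∫⁻ x, ‖a n x • G x‖ₑ ^ (2 : ℝ) ∂ν) atTop (𝓝 (∫⁻ _, 0 ∂ν)) := by
    refine tendsto_lintegral_of_dominated_convergence'
      (fun x => ENNReal.ofReal C ^ (2 : ℝ) * ‖G x‖ₑ ^ (2 : ℝ))
      (fun n => ((ha n).smul hG.1).enorm.pow_const _) (fun n => .of_forall fun x => ?_) ?_ ?_
    · dsimp only
      rw [enorm_smul, ENNReal.mul_rpow_of_nonneg _ _ zero_le_two]
      gcongr
      rw [Real.enorm_eq_ofReal_abs]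
      exact ENNReal.ofReal_le_ofReal (hC n x)
    · rw [lintegral_const_mul'' _ (hG.1.enorm.pow_const _)]
      refine ENNReal.mul_ne_top (by simp) ?_
      have := lintegral_rpow_enorm_lt_top_of_eLpNorm_lt_top (two_ne_zero) (by simp) hG.2
      simpa using this.ne
    · filter_upwards [hlim] with x hx
      have h2 : Tendsto (fun n => ‖a n x • G x‖ₑ) atTop (𝓝 0) := by
        simpa using (hx.smul_const (G x)).enorm
      have h4 := ((ENNReal.continuous_rpow_const (y := (2 : ℝ))).tendsto 0).comp h2
      rwa [ENNReal.zero_rpow_of_pos two_pos] at h4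
  rw [lintegral_zero] at h1
  have h3 := ((ENNReal.continuous_rpow_const (y := (1 / 2 : ℝ))).tendsto 0).comp h1
  rw [ENNReal.zero_rpow_of_pos (by norm_num)] at h3
  refine h3.congr fun n => ?_
  rw [eLpNorm_eq_lintegral_rpow_enorm_toReal two_ne_zero (by simp)]
  simp

variable [InnerProductSpace ℝ F]

lemma integral_inner_eq_inner_toLp {u v : α → F} (hu : MemLp u 2 ν) (hv : MemLp v 2 ν) :
    ∫ x, inner ℝ (u x) (v x) ∂ν = inner ℝ (hu.toLp u) (hv.toLp v) := by
  rw [L2.inner_def]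
  refine integral_congr_ae ?_
  filter_upwards [hu.coeFn_toLp, hv.coeFn_toLp] with x h1 h2
  rw [h1, h2]

lemma integral_inner_self_sub_eq {u v : α → F} (hu : MemLp u 2 ν) (hv : MemLp v 2 ν) :
    ∫ x, inner ℝ (u x - v x) (u x - v x) ∂ν = dist (hu.toLp u) (hv.toLp v) ^ 2 := by
  have h := integral_inner_eq_inner_toLp (hu.sub hv) (hu.sub hv)
  rw [real_inner_self_eq_norm_sq, MemLp.toLp_sub, ← dist_eq_norm] at h
  exact h

lemma tendsto_integral_inner {u v : ℕ → α → F} {u' v' : α → F} (hu : ∀ n, MemLp (u n) 2 ν)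
    (hu' : MemLp u' 2 ν) (hv : ∀ n, MemLp (v n) 2 ν) (hv' : MemLp v' 2 ν)
    (hul : Tendsto (fun n => eLpNorm (u n - u') 2 ν) atTop (𝓝 0))
    (hvl : Tendsto (fun n => eLpNorm (v n - v') 2 ν) atTop (𝓝 0)) :
    Tendsto (fun n => ∫ x, inner ℝ (u n x) (v n x) ∂ν) atTop (𝓝 (∫ x, inner ℝ (u' x) (v' x) ∂ν)) := by
  simp_rw [integral_inner_eq_inner_toLp (hu _) (hv _), integral_inner_eq_inner_toLp hu' hv']
  exact ((tendsto_toLp_iff hu hu').2 hul).inner ((tendsto_toLp_iff hv hv').2 hvl)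

lemma exists_tendsto_of_cauchy [CompleteSpace F] {u : ℕ → α → F} (hu : ∀ n, MemLp (u n) 2 ν)
    (hc : ∀ ε > 0, ∃ N, ∀ m ≥ N, ∀ n ≥ N, ∫ x, inner ℝ (u m x - u n x) (u m x - u n x) ∂ν < ε) :
    ∃ v, MemLp v 2 ν ∧ Tendsto (fun n => eLpNorm (u n - v) 2 ν) atTop (𝓝 0) := by
  have hcs : CauchySeq fun n => (hu n).toLp (u n) := by
    refine Metric.cauchySeq_iff.2 fun ε hε => ?_
    obtain ⟨N, hN⟩ := hc (ε ^ 2) (by positivity)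
    refine ⟨N, fun m hm n hn => ?_⟩
    have := hN m hm n hn
    rw [integral_inner_self_sub_eq (hu m) (hu n)] at this
    exact lt_of_pow_lt_pow_left₀ 2 hε.le this
  obtain ⟨v, hv⟩ := cauchySeq_tendsto_of_complete hcs
  refine ⟨v, Lp.memLp v, (tendsto_toLp_iff hu (Lp.memLp v)).1 ?_⟩
  rwa [Lp.toLp_coeFn]

lemma cauchy_of_tendsto {u : ℕ → α → F} {v : α → F} (hu : ∀ n, MemLp (u n) 2 ν)
    (hv : MemLp v 2 ν) (hl : Tendsto (fun n => eLpNorm (u n - v) 2 ν) atTop (𝓝 0))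
    {ε : ℝ} (hε : 0 < ε) :
    ∃ N, ∀ m ≥ N, ∀ n ≥ N, ∫ x, inner ℝ (u m x - u n x) (u m x - u n x) ∂ν < ε := by
  obtain ⟨N, hN⟩ := Metric.cauchySeq_iff.1 ((tendsto_toLp_iff hu hv).2 hl).cauchySeq (√ε)
    (Real.sqrt_pos.2 hε)
  refine ⟨N, fun m hm n hn => ?_⟩
  rw [integral_inner_self_sub_eq (hu m) (hu n), ← Real.sq_sqrt hε.le]
  exact pow_lt_pow_left₀ (hN m hm n hn) dist_nonneg two_ne_zero

end L2

section WeakDerivative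

variable {V : Type*} [NormedAddCommGroup V] [InnerProductSpace ℝ V] [FiniteDimensional ℝ V]
  [MeasurableSpace V] [BorelSpace V]

/-- Outside `W` the function `w` may be arbitrary. Every product involved vanishes off `tsupport η`,
so the integrals over `W` are integrals over the whole space, where the boundaryless formula
applies. -/
lemma integral_mul_fderiv_of_contDiffOn {W : Set V} (hW : IsOpen W) {w η : V → ℝ} {v : V}
    (hw : ContDiffOn ℝ 1 w W) (hη : ContDiff ℝ 1 η) (hc : HasCompactSupport η)
    (hsupp : tsupport η ⊆ W) :
    ∫ x in W, w x * fderiv ℝ η x v = - ∫ x in W, fderiv ℝ w x v * η x := by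
  have hη' : Continuous fun x => fderiv ℝ η x v :=
    (hη.continuous_fderiv (by simp)).clm_apply continuous_const
  have hw' : ContinuousOn (fun x => fderiv ℝ w x v) W :=
    (hw.continuousOn_fderiv_of_isOpen hW (by simp)).clm_apply continuousOn_const
  have hzero : ∀ x, x ∉ tsupport η → η x = 0 ∧ fderiv ℝ η x v = 0 := fun x hx => by
    refine ⟨image_eq_zero_of_notMem_tsupport hx, ?_⟩
    have : fderiv ℝ η x = 0 :=
      image_eq_zero_of_notMem_tsupport fun h => hx (tsupport_fderiv_subset ℝ h)
    rw [this]; rfl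
  have hint : ∀ h : V → ℝ, ContinuousOn h W → (∀ x, x ∉ tsupport η → h x = 0) →
      Integrable h volume := fun h hcont hz => by
    rw [← integrableOn_iff_integrable_of_support_subset (s := tsupport η)
      fun x hx => by_contra fun hxs => hx (hz x hxs)]
    exact (hcont.mono hsupp).integrableOn_compact hc
  rw [setIntegral_eq_integral_of_forall_compl_eq_zero fun x hx => by
      rw [(hzero x fun h => hx (hsupp h)).2, mul_zero],
    setIntegral_eq_integral_of_forall_compl_eq_zero fun x hx => by
      rw [(hzero x fun h => hx (hsupp h)).1, mul_zero]]
  refine integral_mul_fderiv_eq_neg_fderiv_mul_of_integrable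
    (hint _ (hw'.mul hη.continuous.continuousOn) fun x hx => by rw [(hzero x hx).1, mul_zero])
    (hint _ (hw.continuousOn.mul hη'.continuousOn) fun x hx => by rw [(hzero x hx).2, mul_zero])
    (hint _ (hw.continuousOn.mul hη.continuous.continuousOn) fun x hx => by
      rw [(hzero x hx).1, mul_zero])
    (fun x hx => (hw.differentiableOn (by simp)).differentiableAt (hW.mem_nhds (hsupp hx)))
    fun x _ => hη.differentiable (by simp) x

/-- Limits in `L²` of `C¹` functions and of their derivatives in the direction `v` satisfy the
integration by parts formula. -/
lemma integral_mul_fderiv_of_tendsto {W : Set V} (hW : IsOpen W) {w : ℕ → V → ℝ} {f q : V → ℝ}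
    {v : V} (hw : ∀ n, ContDiffOn ℝ 1 (w n) W) (hw2 : ∀ n, MemLp (w n) 2 (volume.restrict W))
    (hw2' : ∀ n, MemLp (fun x => fderiv ℝ (w n) x v) 2 (volume.restrict W))
    (hf : MemLp f 2 (volume.restrict W)) (hq : MemLp q 2 (volume.restrict W))
    (hlf : Tendsto (fun n => eLpNorm (w n - f) 2 (volume.restrict W)) atTop (𝓝 0))
    (hlq : Tendsto (fun n => eLpNorm ((fun x => fderiv ℝ (w n) x v) - q) 2 (volume.restrict W))
      atTop (𝓝 0))
    {η : V → ℝ} (hη : ContDiff ℝ 1 η) (hc : HasCompactSupport η) (hsupp : tsupport η ⊆ W) :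
    ∫ x in W, f x * fderiv ℝ η x v = - ∫ x in W, q x * η x := by
  have hη2 : MemLp η 2 (volume.restrict W) :=
    (hη.continuous.memLp_of_hasCompactSupport hc).restrict W
  have hη2' : MemLp (fun x => fderiv ℝ η x v) 2 (volume.restrict W) := by
    refine (Continuous.memLp_of_hasCompactSupport
      ((hη.continuous_fderiv (by simp)).clm_apply continuous_const) ?_).restrict W
    exact (hc.fderiv ℝ).comp_left (g := fun A : V →L[ℝ] ℝ => A v) rfl
  have hconst : ∀ u : V → ℝ, Tendsto (fun _ : ℕ => eLpNorm (u - u) 2 (volume.restrict W)) atTop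
      (𝓝 0) := fun u => by simp
  have h1 := tendsto_integral_inner (fun _ => hη2') hη2' hw2 hf (hconst _) hlf
  have h2 := tendsto_integral_inner (fun _ => hη2) hη2 hw2' hq (hconst _) hlq
  refine tendsto_nhds_unique h1 (h2.neg.congr fun n => ?_)
  exact (integral_mul_fderiv_of_contDiffOn hW (hw n) hη hc hsupp).symm

/-- Closability of the directional derivative. -/
lemma ae_eq_zero_of_tendsto_fderiv {W : Set V} (hW : IsOpen W) {w : ℕ → V → ℝ} {q : V → ℝ}
    {v : V} (hw : ∀ n, ContDiffOn ℝ 1 (w n) W) (hw2 : ∀ n, MemLp (w n) 2 (volume.restrict W))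
    (hw2' : ∀ n, MemLp (fun x => fderiv ℝ (w n) x v) 2 (volume.restrict W))
    (hq : MemLp q 2 (volume.restrict W))
    (hlf : Tendsto (fun n => eLpNorm (w n) 2 (volume.restrict W)) atTop (𝓝 0))
    (hlq : Tendsto (fun n => eLpNorm ((fun x => fderiv ℝ (w n) x v) - q) 2 (volume.restrict W))
      atTop (𝓝 0)) : ∀ᵐ x ∂(volume.restrict W), q x = 0 := by
  rw [ae_restrict_iff' hW.measurableSet]
  refine hW.ae_eq_zero_of_integral_contDiff_smul_eq_zero ?_ fun η hη hc hsupp => ?_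
  · refine (locallyIntegrableOn_of_locallyIntegrable_restrict ?_)
    exact hq.locallyIntegrable one_le_two
  · have h := integral_mul_fderiv_of_tendsto hW hw hw2 hw2' (f := 0) MemLp.zero' hq (by simpa) hlq
      (hη.of_le (by exact_mod_cast le_top)) hc hsupp
    simp only [Pi.zero_apply, zero_mul, integral_zero, zero_eq_neg] at h
    rw [← h, setIntegral_eq_integral_of_forall_compl_eq_zero fun x hx => by
      rw [image_eq_zero_of_notMem_tsupport fun h => hx (hsupp h), mul_zero]]
    exact integral_congr_ae (.of_forall fun x => by simp [mul_comm])

end WeakDerivative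

end SRBD

/-! ### Boundary charts from the inverse function theorem. -/

namespace SRBD

section Straighten

variable {E : Type*} [NormedAddCommGroup E] [InnerProductSpace ℝ E] [CompleteSpace E]

/-- A change of coordinates near `p` that replaces the function `g` by the affine function
`x ↦ ⟪∇g(p), x - p⟫`. -/
noncomputable def straighten (g : E → ℝ) (p x : E) : E :=
  x + ((g x - inner ℝ (gradient g p) (x - p)) / ‖gradient g p‖ ^ 2) • gradient g p

lemma inner_straighten {g : E → ℝ} {p : E} (h : gradient g p ≠ 0) (x : E) :
    inner ℝ (gradient g p) (straighten g p x - p) = g x := by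
  have h0 : ‖gradient g p‖ ^ 2 ≠ 0 := by positivity
  rw [straighten, add_sub_right_comm, inner_add_right, inner_smul_right, real_inner_self_eq_norm_sq,
    div_mul_cancel₀ _ h0]
  ring

lemma straighten_self {g : E → ℝ} {p : E} (hp : g p = 0) : straighten g p p = p := by
  simp [straighten, hp]

lemma contDiff_straighten {g : E → ℝ} {n : WithTop ℕ∞} (hg : ContDiff ℝ n g) (p : E) :
    ContDiff ℝ n (straighten g p) := by
  exact contDiff_id.add (((hg.sub (contDiff_const.inner ℝ
    (contDiff_id.sub contDiff_const))).div_const _).smul contDiff_const)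

/-- The correction term is `g` minus its own linear part at `p`, so it does not contribute to first
order. With the identity as derivative, the inverse function theorem applies at `p`. -/
lemma hasFDerivAt_straighten {g : E → ℝ} {p : E} (hg : DifferentiableAt ℝ g p) :
    HasFDerivAt (straighten g p) ((ContinuousLinearEquiv.refl ℝ E : E ≃L[ℝ] E) : E →L[ℝ] E) p := by
  have h1 : HasFDerivAt (fun x => g x - inner ℝ (gradient g p) (x - p)) (0 : E →L[ℝ] ℝ) p := by
    have h2 : HasFDerivAt (fun x => inner ℝ (gradient g p) (x - p)) (innerSL ℝ (gradient g p)) p := by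
      exact (innerSL ℝ (gradient g p)).hasFDerivAt.comp p ((hasFDerivAt_id p).sub_const p)
    have h3 : fderiv ℝ g p - innerSL ℝ (gradient g p) = 0 := by
      ext w
      simp [inner_gradient_left]
    rw [← h3]
    exact hg.hasFDerivAt.sub h2
  have h4 := (hasFDerivAt_id p).add ((h1.mul_const ((‖gradient g p‖ ^ 2)⁻¹)).smul_const
    (gradient g p))
  convert! h4 using 1
  ext w
  simp

end Straighten

/-- `Φ : W → ∂Ω ∩ N` is a bi-Lipschitz `C¹` parametrisation of an open piece of `∂Ω`, with
inverse `Θ`. -/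
structure IsBoundaryChart {d k : ℕ} (Ω N : Set (EuclideanSpace ℝ (Fin d)))
    (W : Set (EuclideanSpace ℝ (Fin k))) (Φ : EuclideanSpace ℝ (Fin k) → EuclideanSpace ℝ (Fin d))
    (Θ : EuclideanSpace ℝ (Fin d) → EuclideanSpace ℝ (Fin k)) (K : NNReal) : Prop where
  isOpen_nhd : IsOpen N
  isOpen_dom : IsOpen W
  isBounded_dom : Bornology.IsBounded W
  contDiffOn : ContDiffOn ℝ 1 Φ W
  contDiffOn_inv : ContDiffOn ℝ 1 Θ N
  image_eq : Φ '' W = frontier Ω ∩ N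
  left_inv : ∀ u ∈ W, Θ (Φ u) = u
  lipschitz : LipschitzOnWith K Φ W
  lipschitz_inv : LipschitzOnWith K Θ N

variable {d k : ℕ} {Ω : Set (EuclideanSpace ℝ (Fin d))}

lemma gradient_ne_zero {E : Type*} [NormedAddCommGroup E] [InnerProductSpace ℝ E] [CompleteSpace E]
    {g : E → ℝ} {p : E} (h : fderiv ℝ g p ≠ 0) : gradient g p ≠ 0 := fun h0 => h <| by
  ext w
  rw [← inner_gradient_left, h0, inner_zero_left]
  rfl

/-- Boundary charts exist, and the differential at the centre maps onto `∇g(p)^⊥`. -/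
theorem exists_isBoundaryChart (hd : d = k + 1) (hΩ : IsClosed Ω) {p : EuclideanSpace ℝ (Fin d)}
    (hp : p ∈ frontier Ω) {U : Set (EuclideanSpace ℝ (Fin d))} (hU : IsOpen U) (hpU : p ∈ U)
    {g : EuclideanSpace ℝ (Fin d) → ℝ} (hg : ContDiff ℝ ∞ g) (hg' : fderiv ℝ g p ≠ 0)
    (hΩU : Ω ∩ U = {x ∈ U | g x ≤ 0}) :
    ∃ N W Φ Θ K, IsBoundaryChart (k := k) Ω N W Φ Θ K ∧ p ∈ N ∧ ∃ u ∈ W, Φ u = p ∧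
      ∃ ι : EuclideanSpace ℝ (Fin k) →L[ℝ] EuclideanSpace ℝ (Fin d), HasFDerivAt Φ ι u ∧
        ∀ w, inner ℝ (gradient g p) w = 0 → w ∈ range ι := by
  have ha := gradient_ne_zero hg'
  set a := gradient g p with ha_def
  have hgp : g p = 0 := eq_zero_of_mem_frontier hΩ hU hg.continuous hΩU hp hpU
  have hΨ : ContDiff ℝ 1 (straighten g p) :=
    contDiff_straighten (hg.of_le (by exact_mod_cast le_top)) p
  have hΨ' := hasFDerivAt_straighten (hg.differentiable (by simp) p)
  -- In the coordinates `e` the zero set of `g` near `p` is the hyperplane through `p` orthogonal to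
  -- `a = ∇g(p)`.
  let e := hΨ.contDiffAt.toOpenPartialHomeomorph (straighten g p) hΨ' one_ne_zero
  have hecoe : ∀ x, e x = straighten g p x := fun x => rfl
  have hps : p ∈ e.source :=
    hΨ.contDiffAt.mem_toOpenPartialHomeomorph_source hΨ' one_ne_zero
  have hep : e p = p := straighten_self hgp
  have hpt : p ∈ e.target := by simpa [hep] using e.map_source hps
  have hesp : e.symm p = p := by simpa [hep] using e.left_inv hps
  have hsymm : ContDiffAt ℝ 1 e.symm p :=
    e.contDiffAt_symm hpt (by rw [hesp]; exact hΨ') (by rw [hesp]; exact hΨ.contDiffAt)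
  have hsymm' : HasFDerivAt e.symm (ContinuousLinearMap.id ℝ _) p := by
    have := e.hasFDerivAt_symm hpt (f' := ContinuousLinearEquiv.refl ℝ _) (by rw [hesp]; exact hΨ')
    exact this
  obtain ⟨K₁, t₁, ht₁, hK₁⟩ := hsymm.exists_lipschitzOnWith
  obtain ⟨K₂, t₂, ht₂, hK₂⟩ := (hΨ.contDiffAt (x := p)).exists_lipschitzOnWith
  have hcont : ContinuousAt e.symm p := hsymm.continuousAt
  -- On the ball of radius `ρ` the inverse is defined, `K₁`-Lipschitz and `C¹` at every point, and
  -- takes values in `U`, where `g` describes `Ω`, and in `t₂`, where `e` is `K₂`-Lipschitz.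
  obtain ⟨ρ, hρ, hball⟩ := Metric.mem_nhds_iff.1 (inter_mem (inter_mem (e.open_target.mem_nhds hpt)
    ht₁) (inter_mem (hsymm.eventually (by simp))
      (hcont.preimage_mem_nhds (by rw [hesp]; exact inter_mem (hU.mem_nhds hpU) ht₂))))
  have : Fact (Module.finrank ℝ (EuclideanSpace ℝ (Fin d)) = k + 1) := ⟨by simpa using hd⟩
  let J := (OrthonormalBasis.fromOrthogonalSpanSingleton (𝕜 := ℝ) k ha).repr
  -- `ι` identifies `ℝ^k` isometrically with the hyperplane `a^⊥`; `π` is the orthogonal projection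
  -- onto it read in these coordinates.
  let ι : EuclideanSpace ℝ (Fin k) →ₗᵢ[ℝ] EuclideanSpace ℝ (Fin d) :=
    (Submodule.subtypeₗᵢ (ℝ ∙ a)ᗮ).comp J.symm.toLinearIsometry
  let π : EuclideanSpace ℝ (Fin d) →L[ℝ] EuclideanSpace ℝ (Fin k) :=
    (J.toContinuousLinearEquiv : _ →L[ℝ] _) ∘L (ℝ ∙ a)ᗮ.orthogonalProjectionOnto
  have hπι : ∀ u, π (ι u) = u := fun u => by
    simp [π, ι]
  have hιa : ∀ u, inner ℝ a (ι u) = 0 := fun u =>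
    Submodule.mem_orthogonal_singleton_iff_inner_right.1 (J.symm u).2
  have hιr : ∀ w, inner ℝ a w = 0 → ι (π w) = w := fun w hw => by
    have hw' : w ∈ (ℝ ∙ a)ᗮ := Submodule.mem_orthogonal_singleton_iff_inner_right.2 hw
    lift w to (ℝ ∙ a)ᗮ using hw'
    simp [π, ι]
  let N := e.source ∩ e ⁻¹' Metric.ball p ρ
  let W : Set (EuclideanSpace ℝ (Fin k)) := Metric.ball 0 ρ
  have hWball : ∀ u ∈ W, p + ι u ∈ Metric.ball p ρ := fun u hu => by
    rw [Metric.mem_ball, dist_eq_norm, add_sub_cancel_left, ι.norm_map]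
    exact mem_ball_zero_iff.1 hu
  have hNU : ∀ x ∈ N, x ∈ U ∩ t₂ := fun x hx => by
    have := (hball hx.2).2.2
    rwa [mem_preimage, e.left_inv hx.1] at this
  have hgΨ : ∀ x, inner ℝ a (e x - p) = g x := inner_straighten ha
  have hge : ∀ q ∈ Metric.ball p ρ, g (e.symm q) = inner ℝ a (q - p) := fun q hq => by
    rw [← hgΨ, e.right_inv (hball hq).1.1]
  have hsN : ∀ q ∈ Metric.ball p ρ, e.symm q ∈ N := fun q hq =>
    ⟨e.map_target (hball hq).1.1, by rwa [mem_preimage, e.right_inv (hball hq).1.1]⟩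
  have htrans : LipschitzWith 1 fun u => p + ι u := by
    refine LipschitzWith.of_dist_le_mul fun u v => ?_
    simp
  have hπL : LipschitzWith ‖π‖₊ fun x => π (x - p) := by
    refine LipschitzWith.of_dist_le_mul fun x y => ?_
    rw [dist_eq_norm, ← map_sub, sub_sub_sub_cancel_right, dist_eq_norm]
    exact π.le_opNorm _
  refine ⟨N, W, fun u => e.symm (p + ι u), fun x => π (e x - p), max K₁ (‖π‖₊ * K₂),
    ⟨e.isOpen_inter_preimage Metric.isOpen_ball, Metric.isOpen_ball, Metric.isBounded_ball, ?_, ?_,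
      ?_, ?_, ?_, ?_⟩, ⟨hps, by simp [hep, hρ]⟩, 0, Metric.mem_ball_self hρ, ?_, ι.toContinuousLinearMap,
      ?_, ?_⟩
  · intro u hu
    refine ContDiffAt.contDiffWithinAt (ContDiffAt.comp u (hball (hWball u hu)).2.1 ?_)
    exact contDiffAt_const.add ι.toContinuousLinearMap.contDiff.contDiffAt
  · exact (π.contDiff.comp (hΨ.sub contDiff_const)).contDiffOn
  · ext x
    constructor
    · rintro ⟨u, hu, rfl⟩
      have hq := hWball u hu
      have hxN := hsN _ hq
      refine ⟨?_, hxN⟩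
      have hgx : g (e.symm (p + ι u)) = 0 := by
        rw [hge _ hq, add_sub_cancel_left, hιa]
      have hxΩ : e.symm (p + ι u) ∈ Ω ∩ U := by
        rw [hΩU]
        exact ⟨(hNU _ hxN).1, hgx.le⟩
      refine ⟨subset_closure hxΩ.1, fun hint => ?_⟩
      -- If the point were interior to `Ω`, a small move in the direction `a` in straightened
      -- coordinates would stay in `Ω`; but there `g` equals `t * ‖a‖ ^ 2 > 0`.
      have hlim : Tendsto (fun t : ℝ => p + ι u + t • a) (𝓝[>] 0) (𝓝 (p + ι u)) := by
        have : Tendsto (fun t : ℝ => p + ι u + t • a) (𝓝 0) (𝓝 (p + ι u + (0 : ℝ) • a)) :=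
          Continuous.tendsto (by fun_prop) _
        simpa using this.mono_left nhdsWithin_le_nhds
      have hsd : ContDiffAt ℝ 1 e.symm (p + ι u) := (hball hq).2.1
      have hsc := hsd.continuousAt
      have hev := hlim.eventually ((hsc.preimage_mem_nhds (isOpen_interior.mem_nhds hint)))
      obtain ⟨t, ht1, ht2, ht0⟩ := (hev.and ((hlim.eventually
        (Metric.isOpen_ball.mem_nhds hq)).and self_mem_nhdsWithin)).exists
      have h1 : e.symm (p + ι u + t • a) ∈ Ω ∩ U :=
        ⟨interior_subset ht1, (hNU _ (hsN _ ht2)).1⟩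
      rw [hΩU] at h1
      have h2 := h1.2
      rw [hge _ ht2, add_assoc, add_sub_cancel_left, inner_add_right, hιa, inner_smul_right,
        real_inner_self_eq_norm_sq, zero_add] at h2
      have : 0 < t * ‖a‖ ^ 2 := mul_pos ht0 (by positivity)
      linarith
    · rintro ⟨hxf, hxN⟩
      have hgx := eq_zero_of_mem_frontier hΩ hU hg.continuous hΩU hxf (hNU _ hxN).1
      rw [← hgΨ] at hgx
      refine ⟨π (e x - p), ?_, ?_⟩
      · rw [mem_ball_zero_iff, ← ι.norm_map, hιr _ hgx, ← dist_eq_norm]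
        exact hxN.2
      · dsimp only
        rw [hιr _ hgx, add_sub_cancel, e.left_inv hxN.1]
  · intro u hu
    rw [e.right_inv (hball (hWball u hu)).1.1, add_sub_cancel_left, hπι]
  · have := hK₁.comp (htrans.lipschitzOnWith (s := W)) fun u hu => (hball (hWball u hu)).1.2
    exact this.weaken (by simp)
  · have h1 : LipschitzOnWith K₂ e N := hK₂.mono fun x hx => (hNU x hx).2
    exact (hπL.comp_lipschitzOnWith h1).weaken (le_max_right _ _)
  · simp [hesp]
  · have h1 : HasFDerivAt (fun u => p + ι u) ι.toContinuousLinearMap 0 :=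
      ι.toContinuousLinearMap.hasFDerivAt.const_add p
    have h2 : HasFDerivAt e.symm (ContinuousLinearMap.id ℝ _) (p + ι 0) := by simpa using hsymm'
    have h3 := h2.comp 0 h1
    rw [ContinuousLinearMap.id_comp] at h3
    exact h3
  · exact fun w hw => ⟨π w, hιr w hw⟩

end SRBD

/-! ### Tangent spaces, tangential gradients and surface measure in charts. -/

namespace SRBD

variable {d k : ℕ} {Ω : Set (EuclideanSpace ℝ (Fin d))}

section TangentSpace

/-- The tangent cone of the open set `W` is everything, and a derivative maps tangent cones into the
tangent cone of the image. -/
lemma mem_tangentSpace_of_hasFDerivAt {N : Set (EuclideanSpace ℝ (Fin d))}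
    {W : Set (EuclideanSpace ℝ (Fin k))} {Φ : EuclideanSpace ℝ (Fin k) → EuclideanSpace ℝ (Fin d)}
    {Θ : EuclideanSpace ℝ (Fin d) → EuclideanSpace ℝ (Fin k)} {K : NNReal}
    (h : IsBoundaryChart Ω N W Φ Θ K) {u : EuclideanSpace ℝ (Fin k)} (hu : u ∈ W)
    {A : EuclideanSpace ℝ (Fin k) →L[ℝ] EuclideanSpace ℝ (Fin d)} (hA : HasFDerivAt Φ A u)
    (v : EuclideanSpace ℝ (Fin k)) : A v ∈ tangentSpace Ω (Φ u) := by
  refine Submodule.subset_span ?_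
  have hv : v ∈ tangentConeAt ℝ W u := by
    rw [tangentConeAt_of_mem_nhds (h.isOpen_dom.mem_nhds hu)]
    trivial
  have h1 := (hA.hasFDerivWithinAt (s := W)).mapsTo_tangent_cone hv
  rw [h.image_eq] at h1
  exact tangentConeAt_mono inter_subset_left h1

/-- The tangent space of the zero set of a defining function. -/
lemma tangentSpace_eq (hd : d = k + 1) (hΩ : IsClosed Ω) {p : EuclideanSpace ℝ (Fin d)}
    (hp : p ∈ frontier Ω) {U : Set (EuclideanSpace ℝ (Fin d))} (hU : IsOpen U) (hpU : p ∈ U)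
    {g : EuclideanSpace ℝ (Fin d) → ℝ} (hg : ContDiff ℝ ∞ g) (hg' : fderiv ℝ g p ≠ 0)
    (hΩU : Ω ∩ U = {x ∈ U | g x ≤ 0}) : tangentSpace Ω p = (ℝ ∙ gradient g p)ᗮ := by
  refine le_antisymm (Submodule.span_le.2 fun w hw => ?_) fun w hw => ?_
  · refine Submodule.mem_orthogonal_singleton_iff_inner_right.2 ?_
    rw [inner_gradient_left]
    have hzero : ∀ x ∈ frontier Ω ∩ U, g x = 0 := fun x hx =>
      eq_zero_of_mem_frontier hΩ hU hg.continuous hΩU hx.1 hx.2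
    -- Since `g` vanishes on the boundary near `p`, zero is also a derivative of `g` within the
    -- boundary; two such derivatives agree on the tangent cone.
    have h1 : HasFDerivWithinAt g (0 : EuclideanSpace ℝ (Fin d) →L[ℝ] ℝ) (frontier Ω) p := by
      refine (hasFDerivWithinAt_const (0 : ℝ) p (frontier Ω)).congr_of_eventuallyEq ?_
        (hzero p ⟨hp, hpU⟩)
      filter_upwards [self_mem_nhdsWithin, nhdsWithin_le_nhds (hU.mem_nhds hpU)] with x hx hxU
      exact hzero x ⟨hx, hxU⟩
    exact (hg.differentiable (by simp) p).hasFDerivAt.hasFDerivWithinAt.unique_on h1 hw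
  · obtain ⟨N, W, Φ, Θ, K, hchart, -, u, hu, rfl, ι, hι, hrange⟩ :=
      exists_isBoundaryChart hd hΩ hp hU hpU hg hg' hΩU
    obtain ⟨v, rfl⟩ := hrange w (Submodule.mem_orthogonal_singleton_iff_inner_right.1 hw)
    exact mem_tangentSpace_of_hasFDerivAt hchart hu hι v

lemma continuous_gradient {E : Type*} [NormedAddCommGroup E] [InnerProductSpace ℝ E]
    [CompleteSpace E] {φ : E → ℝ} (hφ : ContDiff ℝ 1 φ) : Continuous (gradient φ) :=
  (InnerProductSpace.toDual ℝ E).symm.continuous.comp (hφ.continuous_fderiv one_ne_zero)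

lemma norm_gradient {E : Type*} [NormedAddCommGroup E] [InnerProductSpace ℝ E]
    [CompleteSpace E] (φ : E → ℝ) (x : E) : ‖gradient φ x‖ = ‖fderiv ℝ φ x‖ :=
  (InnerProductSpace.toDual ℝ E).symm.norm_map _

lemma norm_tangentialGradient_le (φ : EuclideanSpace ℝ (Fin d) → ℝ)
    (x : EuclideanSpace ℝ (Fin d)) : ‖tangentialGradient Ω φ x‖ ≤ ‖gradient φ x‖ :=
  (tangentSpace Ω x).norm_starProjection_apply_le _

lemma tangentialGradient_mem (φ : EuclideanSpace ℝ (Fin d) → ℝ) (x : EuclideanSpace ℝ (Fin d)) :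
    tangentialGradient Ω φ x ∈ tangentSpace Ω x :=
  Submodule.starProjection_apply_mem _ _

lemma inner_tangentialGradient {φ : EuclideanSpace ℝ (Fin d) → ℝ} {x w : EuclideanSpace ℝ (Fin d)}
    (hw : w ∈ tangentSpace Ω x) : inner ℝ (tangentialGradient Ω φ x) w = fderiv ℝ φ x w := by
  rw [← inner_gradient_left, tangentialGradient, Submodule.inner_starProjection_left_eq_right,
    Submodule.starProjection_eq_self_iff.2 hw]

lemma starProjection_congr {E : Type*} [NormedAddCommGroup E] [InnerProductSpace ℝ E]
    {S T : Submodule ℝ E} [S.HasOrthogonalProjection] [T.HasOrthogonalProjection] (h : S = T)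
    (v : E) : S.starProjection v = T.starProjection v := by
  subst h
  rfl

/-- The tangential gradient of a `C¹` function is continuous on a smooth boundary. -/
lemma continuousOn_tangentialGradient (hd : d = k + 1) (hΩ : IsClosed Ω)
    (hsmooth : HasSmoothBoundary Ω) {φ : EuclideanSpace ℝ (Fin d) → ℝ} (hφ : ContDiff ℝ 1 φ) :
    ContinuousOn (tangentialGradient Ω φ) (frontier Ω) := by
  intro p hp
  obtain ⟨U, hU, hpU, g, hg, hg', hΩU⟩ := hsmooth p hp
  have hgc := continuous_gradient (hg.of_le (by exact_mod_cast le_top) : ContDiff ℝ 1 g)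
  have hφc := continuous_gradient hφ
  -- The same `g` is a defining function at all boundary points near `p`, so its gradient spans the
  -- normal line there and the projection is explicit and continuous in `x`.
  have heq : ∀ x ∈ frontier Ω, x ∈ U → fderiv ℝ g x ≠ 0 → tangentialGradient Ω φ x =
      gradient φ x - (inner ℝ (gradient g x) (gradient φ x) / ‖gradient g x‖ ^ 2) • gradient g x := by
    intro x hx hxU hgx
    rw [tangentialGradient, starProjection_congr (tangentSpace_eq hd hΩ hx hU hxU hg hgx hΩU),
      Submodule.starProjection_orthogonal_val, Submodule.starProjection_singleton]
    rfl
  have hne : ∀ᶠ x in 𝓝 p, fderiv ℝ g x ≠ 0 :=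
    (hg.continuous_fderiv (by simp)).continuousAt.eventually_ne hg'
  have hcont : ContinuousAt (fun x => gradient φ x -
      (inner ℝ (gradient g x) (gradient φ x) / ‖gradient g x‖ ^ 2) • gradient g x) p := by
    have h0 : ‖gradient g p‖ ^ 2 ≠ 0 := by
      have := gradient_ne_zero hg'
      positivity
    exact hφc.continuousAt.sub (((hgc.inner hφc).continuousAt.div
      (hgc.norm.pow 2).continuousAt h0).smul hgc.continuousAt)
  refine hcont.continuousWithinAt.congr_of_eventuallyEq ?_ (heq p hp hpU hg')
  filter_upwards [self_mem_nhdsWithin, nhdsWithin_le_nhds (hU.mem_nhds hpU),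
    nhdsWithin_le_nhds hne] with x hx hxU hgx
  exact heq x hx hxU hgx

end TangentSpace

section Charts

lemma exists_isBoundaryChart_of_mem (hd : d = k + 1) (hΩ : IsClosed Ω)
    (hsmooth : HasSmoothBoundary Ω) {p : EuclideanSpace ℝ (Fin d)} (hp : p ∈ frontier Ω) :
    ∃ N W Φ Θ K, IsBoundaryChart (k := k) Ω N W Φ Θ K ∧ p ∈ N := by
  obtain ⟨U, hU, hpU, g, hg, hg', hΩU⟩ := hsmooth p hp
  obtain ⟨N, W, Φ, Θ, K, hchart, hpN, -⟩ := exists_isBoundaryChart hd hΩ hp hU hpU hg hg' hΩU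
  exact ⟨N, W, Φ, Θ, K, hchart, hpN⟩

lemma euclideanHausdorffMeasure_image_le {X Y : Type*} [EMetricSpace X] [EMetricSpace Y]
    [MeasurableSpace X] [BorelSpace X] [MeasurableSpace Y] [BorelSpace Y] {K : NNReal} {f : X → Y}
    {s : Set X} (h : LipschitzOnWith K f s) (k : ℕ) :
    (μHE[k] : Measure Y) (f '' s) ≤ (K : ℝ≥0∞) ^ k * (μHE[k] : Measure X) s := by
  simp only [Measure.euclideanHausdorffMeasure_def, Measure.smul_apply, ENNReal.smul_def,
    smul_eq_mul]
  have := h.hausdorffMeasure_image_le (d := k) (by positivity)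
  rw [ENNReal.rpow_natCast] at this
  rw [mul_left_comm]
  gcongr

namespace IsBoundaryChart

variable {N : Set (EuclideanSpace ℝ (Fin d))}
  {W : Set (EuclideanSpace ℝ (Fin k))} {Φ : EuclideanSpace ℝ (Fin k) → EuclideanSpace ℝ (Fin d)}
  {Θ : EuclideanSpace ℝ (Fin d) → EuclideanSpace ℝ (Fin k)} {K : NNReal}

/-- With `volume_le` this compares surface measure and Lebesgue measure up to the factor `K ^ k`.
Only null sets, finiteness and `L²` convergence are transferred through charts, so no exact area
formula is needed. -/
lemma measure_le (h : IsBoundaryChart Ω N W Φ Θ K) (A : Set (EuclideanSpace ℝ (Fin d))) :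
    (μHE[k] : Measure (EuclideanSpace ℝ (Fin d))) (A ∩ (frontier Ω ∩ N)) ≤
      (K : ℝ≥0∞) ^ k * volume (W ∩ Φ ⁻¹' A) := by
  rw [← h.image_eq, inter_comm A, ← image_inter_preimage,
    ← EuclideanSpace.euclideanHausdorffMeasure_eq_volume]
  exact euclideanHausdorffMeasure_image_le (h.lipschitz.mono inter_subset_left) k

lemma volume_le (h : IsBoundaryChart Ω N W Φ Θ K) (A : Set (EuclideanSpace ℝ (Fin d))) :
    volume (W ∩ Φ ⁻¹' A) ≤ (K : ℝ≥0∞) ^ k *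
      (μHE[k] : Measure (EuclideanSpace ℝ (Fin d))) (A ∩ (frontier Ω ∩ N)) := by
  have h1 : W ∩ Φ ⁻¹' A = Θ '' (A ∩ (frontier Ω ∩ N)) := by
    rw [← h.image_eq, inter_comm A, ← image_inter_preimage, image_image]
    ext u
    constructor
    · exact fun hu => ⟨u, hu, h.left_inv u hu.1⟩
    · rintro ⟨v, hv, rfl⟩
      change Θ (Φ v) ∈ _
      rwa [h.left_inv v hv.1]
  rw [h1, ← EuclideanSpace.euclideanHausdorffMeasure_eq_volume]
  exact euclideanHausdorffMeasure_image_le (h.lipschitz_inv.mono fun x hx => hx.2.2) k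

lemma aemeasurable (h : IsBoundaryChart Ω N W Φ Θ K) : AEMeasurable Φ (volume.restrict W) :=
  h.contDiffOn.continuousOn.aemeasurable h.isOpen_dom.measurableSet

lemma map_le (h : IsBoundaryChart Ω N W Φ Θ K) (hd : d = k + 1) :
    (volume.restrict W).map Φ ≤ ((K : ℝ≥0∞) ^ k) • surfaceMeasure Ω := by
  subst hd
  refine Measure.le_iff.2 fun A hA => ?_
  rw [Measure.map_apply_of_aemeasurable h.aemeasurable hA, Measure.restrict_apply₀
    (h.aemeasurable.nullMeasurable hA), inter_comm, Measure.smul_apply, smul_eq_mul, surfaceMeasure,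
    Measure.restrict_apply hA]
  refine (h.volume_le A).trans ?_
  gcongr
  · simp
  · exact inter_subset_left

lemma differentiableAt (h : IsBoundaryChart Ω N W Φ Θ K) {u : EuclideanSpace ℝ (Fin k)}
    (hu : u ∈ W) : DifferentiableAt ℝ Φ u :=
  (h.contDiffOn.differentiableOn one_ne_zero).differentiableAt (h.isOpen_dom.mem_nhds hu)

lemma fderiv_mem_tangentSpace (h : IsBoundaryChart Ω N W Φ Θ K) {u : EuclideanSpace ℝ (Fin k)}
    (hu : u ∈ W) (v : EuclideanSpace ℝ (Fin k)) : fderiv ℝ Φ u v ∈ tangentSpace Ω (Φ u) :=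
  mem_tangentSpace_of_hasFDerivAt h hu (h.differentiableAt hu).hasFDerivAt v

/-- On the boundary near `Φ u` the map `Φ ∘ Θ` is the identity, so differentiating along a tangent
direction `w` gives `w = DΦ (DΘ w)`. -/
lemma tangentSpace_le_range (h : IsBoundaryChart Ω N W Φ Θ K) {u : EuclideanSpace ℝ (Fin k)}
    (hu : u ∈ W) : tangentSpace Ω (Φ u) ≤ LinearMap.range (fderiv ℝ Φ u).toLinearMap := by
  refine Submodule.span_le.2 fun w hw => ?_
  have hx : Φ u ∈ frontier Ω ∩ N := h.image_eq ▸ mem_image_of_mem Φ hu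
  have hΘ : HasFDerivAt Θ (fderiv ℝ Θ (Φ u)) (Φ u) :=
    ((h.contDiffOn_inv.differentiableOn one_ne_zero).differentiableAt
      (h.isOpen_nhd.mem_nhds hx.2)).hasFDerivAt
  have hΦ : HasFDerivAt Φ (fderiv ℝ Φ u) (Θ (Φ u)) := by
    rw [h.left_inv u hu]
    exact (h.differentiableAt hu).hasFDerivAt
  have h1 : HasFDerivWithinAt (fun x => x) (fderiv ℝ Φ u ∘L fderiv ℝ Θ (Φ u)) (frontier Ω) (Φ u) := by
    refine (hΦ.comp (Φ u) hΘ).hasFDerivWithinAt.congr_of_eventuallyEq ?_ ?_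
    · filter_upwards [self_mem_nhdsWithin, nhdsWithin_le_nhds (h.isOpen_nhd.mem_nhds hx.2)]
        with x hxf hxN
      have hxm : x ∈ frontier Ω ∩ N := ⟨hxf, hxN⟩
      rw [← h.image_eq] at hxm
      obtain ⟨v, hv, rfl⟩ := hxm
      rw [Function.comp_apply, h.left_inv v hv]
    · rw [Function.comp_apply, h.left_inv u hu]
  have h2 := (hasFDerivWithinAt_id (𝕜 := ℝ) (Φ u) (frontier Ω)).unique_on h1 hw
  exact ⟨fderiv ℝ Θ (Φ u) w, h2.symm⟩

lemma norm_fderiv_le (h : IsBoundaryChart Ω N W Φ Θ K) {u : EuclideanSpace ℝ (Fin k)}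
    (hu : u ∈ W) : ‖fderiv ℝ Φ u‖ ≤ K :=
  norm_fderiv_le_of_lipschitzOn ℝ (h.isOpen_dom.mem_nhds hu) h.lipschitz

/-- The chain rule in a boundary chart only sees the tangential gradient. -/
lemma fderiv_comp (h : IsBoundaryChart Ω N W Φ Θ K) {u : EuclideanSpace ℝ (Fin k)}
    (hu : u ∈ W) {φ : EuclideanSpace ℝ (Fin d) → ℝ} (hφ : ContDiff ℝ 1 φ)
    (v : EuclideanSpace ℝ (Fin k)) :
    fderiv ℝ (φ ∘ Φ) u v = inner ℝ (tangentialGradient Ω φ (Φ u)) (fderiv ℝ Φ u v) := by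
  rw [inner_tangentialGradient (h.fderiv_mem_tangentSpace hu v),
    _root_.fderiv_comp u (hφ.differentiable one_ne_zero _) (h.differentiableAt hu)]
  rfl

end IsBoundaryChart

/-- A compact smooth boundary has finite surface measure. -/
lemma surfaceMeasure_frontier_lt_top (hd : d = k + 1) (hΩ : IsCompact Ω)
    (hsmooth : HasSmoothBoundary Ω) : surfaceMeasure Ω (frontier Ω) < ⊤ := by
  have hc : IsCompact (frontier Ω) :=
    hΩ.of_isClosed_subset isClosed_frontier hΩ.isClosed.frontier_subset
  refine hc.measure_lt_top_of_nhdsWithin fun p hp => ?_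
  obtain ⟨N, W, Φ, Θ, K, h, hpN⟩ := exists_isBoundaryChart_of_mem hd hΩ.isClosed hsmooth hp
  refine ⟨N, nhdsWithin_le_nhds (h.isOpen_nhd.mem_nhds hpN), ?_⟩
  subst hd
  rw [surfaceMeasure, Measure.restrict_apply h.isOpen_nhd.measurableSet]
  have h1 := h.measure_le univ
  rw [univ_inter, preimage_univ, inter_univ, inter_comm] at h1
  refine h1.trans_lt (ENNReal.mul_lt_top (by simp) h.isBounded_dom.measure_lt_top)

end Charts

end SRBD

/-! ### The measures, limits of gradients, and closability of the form. -/

namespace SRBD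

variable {d : ℕ} {Ω : Set (EuclideanSpace ℝ (Fin d))}

/-- Compact sets with nonempty interior and smooth boundary in a space of positive dimension. -/
structure IsSmoothDomain (Ω : Set (EuclideanSpace ℝ (Fin d))) : Prop where
  dim : ∃ k, d = k + 1
  isCompact : IsCompact Ω
  nonempty_interior : (interior Ω).Nonempty
  smooth : HasSmoothBoundary Ω

section Measures

lemma tendsto_eLpNorm_of_measure_le {α β F : Type*} [MeasurableSpace α] [NormedAddCommGroup F]
    {ν ν' : Measure α} {c : ℝ≥0∞} (hc : c ≠ ⊤) (h : ν' ≤ c • ν) {l : Filter β} {u : β → α → F}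
    (hu : Tendsto (fun n => eLpNorm (u n) 2 ν) l (𝓝 0)) :
    Tendsto (fun n => eLpNorm (u n) 2 ν') l (𝓝 0) := by
  have h1 : Tendsto (fun n => c ^ (1 / (2 : ℝ≥0∞)).toReal • eLpNorm (u n) 2 ν) l (𝓝 0) := by
    simpa using ENNReal.Tendsto.const_mul hu
      (Or.inr (ENNReal.rpow_ne_top_of_nonneg (by positivity) hc))
  refine tendsto_of_tendsto_of_tendsto_of_le_of_le tendsto_const_nhds h1 (fun _ => zero_le)
    fun n => (eLpNorm_mono_measure _ h).trans ?_
  rw [eLpNorm_smul_measure_of_ne_top (by simp)]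

lemma bulkMeasure_restrict_interior (Ω : Set (EuclideanSpace ℝ (Fin d))) :
    (bulkMeasure Ω).restrict (interior Ω) = volume.restrict (interior Ω) := by
  rw [bulkMeasure, Measure.restrict_restrict isOpen_interior.measurableSet,
    inter_eq_left.2 interior_subset]

lemma surfaceMeasure_restrict_frontier (Ω : Set (EuclideanSpace ℝ (Fin d))) :
    (surfaceMeasure Ω).restrict (frontier Ω) = surfaceMeasure Ω := by
  rw [surfaceMeasure, Measure.restrict_restrict isClosed_frontier.measurableSet, inter_self]

namespace IsSmoothDomain

variable (h : IsSmoothDomain Ω)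
include h

lemma isFiniteMeasure_surfaceMeasure : IsFiniteMeasure (surfaceMeasure Ω) := by
  obtain ⟨k, hk⟩ := h.dim
  refine ⟨?_⟩
  have h1 := surfaceMeasure_frontier_lt_top hk h.isCompact h.smooth
  rwa [← Measure.restrict_apply_univ, surfaceMeasure_restrict_frontier] at h1

lemma isFiniteMeasure_bulkMeasure : IsFiniteMeasure (bulkMeasure Ω) :=
  ⟨by rw [bulkMeasure, Measure.restrict_apply_univ]; exact h.isCompact.measure_lt_top⟩

lemma isFiniteMeasure_restrict_interior : IsFiniteMeasure (volume.restrict (interior Ω)) :=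
  ⟨by
    rw [Measure.restrict_apply_univ]
    exact (measure_mono interior_subset).trans_lt h.isCompact.measure_lt_top⟩

lemma normConst_ne_zero : normConst Ω ≠ 0 := by
  have := h.isFiniteMeasure_surfaceMeasure
  have := h.isFiniteMeasure_bulkMeasure
  exact ENNReal.inv_ne_zero.2 (ENNReal.add_ne_top.2 ⟨measure_ne_top _ _, measure_ne_top _ _⟩)

lemma normConst_ne_top : normConst Ω ≠ ⊤ := by
  refine ENNReal.inv_ne_top.2 fun h0 => ?_
  have h1 : bulkMeasure Ω Ω = 0 := (add_eq_zero.1 h0).1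
  rw [bulkMeasure, Measure.restrict_apply_self] at h1
  exact (isOpen_interior.measure_pos volume h.nonempty_interior).ne'
    (measure_mono_null interior_subset h1)

lemma normConst_toReal_pos : 0 < (normConst Ω).toReal :=
  ENNReal.toReal_pos h.normConst_ne_zero h.normConst_ne_top

lemma isFiniteMeasure_invMeasure : IsFiniteMeasure (invMeasure Ω) := by
  have := h.isFiniteMeasure_surfaceMeasure
  have := h.isFiniteMeasure_bulkMeasure
  exact Measure.smul_finite _ h.normConst_ne_top

lemma inv_normConst_ne_top : (normConst Ω)⁻¹ ≠ ⊤ := ENNReal.inv_ne_top.2 h.normConst_ne_zero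

lemma inv_smul_invMeasure : (normConst Ω)⁻¹ • invMeasure Ω = bulkMeasure Ω + surfaceMeasure Ω := by
  rw [invMeasure, smul_smul, ENNReal.inv_mul_cancel h.normConst_ne_zero h.normConst_ne_top, one_smul]

lemma restrict_interior_le : volume.restrict (interior Ω) ≤ (normConst Ω)⁻¹ • invMeasure Ω := by
  rw [h.inv_smul_invMeasure]
  exact (Measure.restrict_mono interior_subset le_rfl).trans (Measure.le_add_right le_rfl)

lemma surfaceMeasure_le : surfaceMeasure Ω ≤ (normConst Ω)⁻¹ • invMeasure Ω := by
  rw [h.inv_smul_invMeasure]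
  exact Measure.le_add_left le_rfl

lemma ae_mem_invMeasure : ∀ᵐ x ∂(invMeasure Ω), x ∈ Ω := by
  refine Measure.ae_smul_measure ?_ _
  rw [ae_add_measure_iff]
  refine ⟨ae_restrict_mem h.isCompact.measurableSet, ?_⟩
  filter_upwards [ae_restrict_mem isClosed_frontier.measurableSet] with x hx
  exact h.isCompact.isClosed.frontier_subset hx

lemma ae_restrict_interior {p : EuclideanSpace ℝ (Fin d) → Prop}
    (hp : ∀ᵐ x ∂(invMeasure Ω), p x) : ∀ᵐ x ∂(volume.restrict (interior Ω)), p x :=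
  Measure.absolutelyContinuous_of_le_smul h.restrict_interior_le hp

lemma ae_surfaceMeasure {p : EuclideanSpace ℝ (Fin d) → Prop}
    (hp : ∀ᵐ x ∂(invMeasure Ω), p x) : ∀ᵐ x ∂(surfaceMeasure Ω), p x :=
  Measure.absolutelyContinuous_of_le_smul h.surfaceMeasure_le hp

lemma memLp_restrict_interior {F : Type*} [NormedAddCommGroup F]
    {f : EuclideanSpace ℝ (Fin d) → F} (hf : MemLp f 2 (invMeasure Ω)) :
    MemLp f 2 (volume.restrict (interior Ω)) :=
  hf.of_measure_le_smul h.inv_normConst_ne_top h.restrict_interior_le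

lemma memLp_surfaceMeasure {F : Type*} [NormedAddCommGroup F]
    {f : EuclideanSpace ℝ (Fin d) → F} (hf : MemLp f 2 (invMeasure Ω)) :
    MemLp f 2 (surfaceMeasure Ω) :=
  hf.of_measure_le_smul h.inv_normConst_ne_top h.surfaceMeasure_le

lemma memLp_of_continuous {F : Type*} [NormedAddCommGroup F] [SecondCountableTopology F]
    {f : EuclideanSpace ℝ (Fin d) → F} (hf : Continuous f) : MemLp f 2 (invMeasure Ω) := by
  have := h.isFiniteMeasure_invMeasure
  obtain ⟨C, hC⟩ := h.isCompact.exists_bound_of_continuousOn hf.continuousOn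
  exact MemLp.of_bound hf.aestronglyMeasurable C (h.ae_mem_invMeasure.mono hC)

lemma memLp_tangentialGradient {φ : EuclideanSpace ℝ (Fin d) → ℝ} (hφ : ContDiff ℝ 1 φ) :
    MemLp (tangentialGradient Ω φ) 2 (surfaceMeasure Ω) := by
  obtain ⟨k, hk⟩ := h.dim
  have h1 := h.memLp_surfaceMeasure (h.memLp_of_continuous (continuous_gradient hφ))
  exact h1.mono ((continuousOn_tangentialGradient hk h.isCompact.isClosed h.smooth
    hφ).aestronglyMeasurable isClosed_frontier.measurableSet)
    (.of_forall (norm_tangentialGradient_le φ))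

end IsSmoothDomain

end Measures

section Gradient

lemma gradient_sub' {E : Type*} [NormedAddCommGroup E] [InnerProductSpace ℝ E] [CompleteSpace E]
    {φ ψ : E → ℝ} (hφ : ContDiff ℝ 1 φ) (hψ : ContDiff ℝ 1 ψ) :
    gradient (φ - ψ) = gradient φ - gradient ψ := by
  ext1 x
  simp only [gradient, Pi.sub_apply]
  rw [fderiv_sub (hφ.differentiable one_ne_zero x) (hψ.differentiable one_ne_zero x), map_sub]

lemma tangentialGradient_sub {φ ψ : EuclideanSpace ℝ (Fin d) → ℝ} (hφ : ContDiff ℝ 1 φ)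
    (hψ : ContDiff ℝ 1 ψ) :
    tangentialGradient Ω (φ - ψ) = tangentialGradient Ω φ - tangentialGradient Ω ψ := by
  ext1 x
  simp only [tangentialGradient, Pi.sub_apply, gradient_sub' hφ hψ, map_sub]

lemma gradient_mul {E : Type*} [NormedAddCommGroup E] [InnerProductSpace ℝ E] [CompleteSpace E]
    {φ ψ : E → ℝ} (hφ : ContDiff ℝ 1 φ) (hψ : ContDiff ℝ 1 ψ) (x : E) :
    gradient (φ * ψ) x = φ x • gradient ψ x + ψ x • gradient φ x := by
  simp only [gradient]
  rw [fderiv_mul (hφ.differentiable one_ne_zero x) (hψ.differentiable one_ne_zero x), map_add,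
    map_smul, map_smul]

lemma tangentialGradient_mul {φ ψ : EuclideanSpace ℝ (Fin d) → ℝ} (hφ : ContDiff ℝ 1 φ)
    (hψ : ContDiff ℝ 1 ψ) (x : EuclideanSpace ℝ (Fin d)) :
    tangentialGradient Ω (φ * ψ) x =
      φ x • tangentialGradient Ω ψ x + ψ x • tangentialGradient Ω φ x := by
  simp only [tangentialGradient, gradient_mul hφ hψ, map_add, map_smul]

lemma gradient_comp {E : Type*} [NormedAddCommGroup E] [InnerProductSpace ℝ E] [CompleteSpace E]
    {φ : E → ℝ} (hφ : ContDiff ℝ 1 φ) {ζ : ℝ → ℝ} (hζ : Differentiable ℝ ζ) (x : E) :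
    gradient (ζ ∘ φ) x = deriv ζ (φ x) • gradient φ x := by
  simp only [gradient]
  rw [((hζ (φ x)).hasDerivAt.comp_hasFDerivAt x
    (hφ.differentiable one_ne_zero x).hasFDerivAt).fderiv, map_smul]

lemma tangentialGradient_comp {φ : EuclideanSpace ℝ (Fin d) → ℝ} (hφ : ContDiff ℝ 1 φ)
    {ζ : ℝ → ℝ} (hζ : Differentiable ℝ ζ) (x : EuclideanSpace ℝ (Fin d)) :
    tangentialGradient Ω (ζ ∘ φ) x = deriv ζ (φ x) • tangentialGradient Ω φ x := by
  simp only [tangentialGradient, gradient_comp hφ hζ, map_smul]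

lemma preForm_eq (Ω : Set (EuclideanSpace ℝ (Fin d))) (a : ℝ)
    (φ ψ : EuclideanSpace ℝ (Fin d) → ℝ) :
    preForm Ω a φ ψ = (normConst Ω).toReal *
      ((∫ x in interior Ω, inner ℝ (gradient φ x) (gradient ψ x)) +
        a * ∫ x, inner ℝ (tangentialGradient Ω φ x) (tangentialGradient Ω ψ x)
          ∂(surfaceMeasure Ω)) := by
  rw [preForm, bulkMeasure_restrict_interior, surfaceMeasure_restrict_frontier, integral_mul_const,
    integral_mul_const]
  ring

/-- `φ` is a sequence of `C¹` functions that converges to `f` in `L²(μ)`, with gradients and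
tangential gradients converging to `G` and `Γ`. -/
structure HasGradients (Ω : Set (EuclideanSpace ℝ (Fin d))) (f : EuclideanSpace ℝ (Fin d) → ℝ)
    (G Γ : EuclideanSpace ℝ (Fin d) → EuclideanSpace ℝ (Fin d))
    (φ : ℕ → EuclideanSpace ℝ (Fin d) → ℝ) : Prop where
  contDiff : ∀ n, ContDiff ℝ 1 (φ n)
  memLp : MemLp f 2 (invMeasure Ω)
  tendsto : Tendsto (fun n => eLpNorm (φ n - f) 2 (invMeasure Ω)) atTop (𝓝 0)
  memLp_bulk : MemLp G 2 (volume.restrict (interior Ω))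
  tendsto_bulk : Tendsto (fun n => eLpNorm (gradient (φ n) - G) 2 (volume.restrict (interior Ω)))
    atTop (𝓝 0)
  memLp_surface : MemLp Γ 2 (surfaceMeasure Ω)
  tendsto_surface : Tendsto (fun n => eLpNorm (tangentialGradient Ω (φ n) - Γ) 2 (surfaceMeasure Ω))
    atTop (𝓝 0)

variable {f f' : EuclideanSpace ℝ (Fin d) → ℝ}
  {G Γ G' Γ' : EuclideanSpace ℝ (Fin d) → EuclideanSpace ℝ (Fin d)}
  {φ φ' : ℕ → EuclideanSpace ℝ (Fin d) → ℝ}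

lemma IsSmoothDomain.hasGradients_const (h : IsSmoothDomain Ω)
    {f : EuclideanSpace ℝ (Fin d) → ℝ} (hf : ContDiff ℝ 1 f) :
    HasGradients Ω f (gradient f) (tangentialGradient Ω f) fun _ => f where
  contDiff _ := hf
  memLp := h.memLp_of_continuous hf.continuous
  tendsto := by simp
  memLp_bulk := h.memLp_restrict_interior (h.memLp_of_continuous (continuous_gradient hf))
  tendsto_bulk := by simp
  memLp_surface := h.memLp_tangentialGradient hf
  tendsto_surface := by simp

lemma IsSmoothDomain.memLp_gradient (h : IsSmoothDomain Ω)
    {φ : EuclideanSpace ℝ (Fin d) → ℝ} (hφ : ContDiff ℝ 1 φ) :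
    MemLp (gradient φ) 2 (volume.restrict (interior Ω)) := (h.hasGradients_const hφ).memLp_bulk

lemma preForm_sub_self (a : ℝ) {φ ψ : EuclideanSpace ℝ (Fin d) → ℝ} (hφ : ContDiff ℝ 1 φ) (hψ : ContDiff ℝ 1 ψ) :
    preForm Ω a (φ - ψ) (φ - ψ) = (normConst Ω).toReal *
      ((∫ x in interior Ω, inner ℝ (gradient φ x - gradient ψ x) (gradient φ x - gradient ψ x)) +
        a * ∫ x, inner ℝ (tangentialGradient Ω φ x - tangentialGradient Ω ψ x)
          (tangentialGradient Ω φ x - tangentialGradient Ω ψ x) ∂(surfaceMeasure Ω)) := by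
  rw [preForm_eq, gradient_sub' hφ hψ, tangentialGradient_sub hφ hψ]
  rfl

lemma HasGradients.isApprox (h : IsSmoothDomain Ω) {a : ℝ} (ha : 0 < a)
    (hf : HasGradients Ω f G Γ φ) : IsApprox Ω a f φ where
  contDiff := hf.contDiff
  tendsto := hf.tendsto
  cauchy := by
    intro ε hε
    have hc := h.normConst_toReal_pos
    obtain ⟨N₁, hN₁⟩ := cauchy_of_tendsto (fun n => h.memLp_gradient (hf.contDiff n)) hf.memLp_bulk
      hf.tendsto_bulk (ε := ε / (2 * (normConst Ω).toReal)) (by positivity)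
    obtain ⟨N₂, hN₂⟩ := cauchy_of_tendsto (fun n => h.memLp_tangentialGradient (hf.contDiff n))
      hf.memLp_surface hf.tendsto_surface (ε := ε / (2 * a * (normConst Ω).toReal)) (by positivity)
    refine ⟨max N₁ N₂, fun m hm n hn => ?_⟩
    have h1 := hN₁ m (le_of_max_le_left hm) n (le_of_max_le_left hn)
    have h2 := hN₂ m (le_of_max_le_right hm) n (le_of_max_le_right hn)
    rw [preForm_sub_self a (hf.contDiff m) (hf.contDiff n)]
    rw [lt_div_iff₀ (by positivity)] at h1 h2
    linarith

/-- For `a > 0` both summands of the energy are nonnegative multiples of squared `L²` distances, so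
an energy Cauchy sequence has Cauchy gradients and Cauchy tangential gradients separately. -/
lemma IsApprox.exists_hasGradients (h : IsSmoothDomain Ω) {a : ℝ} (ha : 0 < a)
    (hm : MemLp f 2 (invMeasure Ω)) (hf : IsApprox Ω a f φ) : ∃ G Γ, HasGradients Ω f G Γ φ := by
  have hc := h.normConst_toReal_pos
  have hnn : ∀ (ν : Measure (EuclideanSpace ℝ (Fin d)))
      (u : EuclideanSpace ℝ (Fin d) → EuclideanSpace ℝ (Fin d)), 0 ≤ ∫ x, inner ℝ (u x) (u x) ∂ν :=
    fun ν u => integral_nonneg fun x => real_inner_self_nonneg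
  obtain ⟨G, hG, hGl⟩ := exists_tendsto_of_cauchy (fun n => h.memLp_gradient (hf.contDiff n))
    fun ε hε => by
      obtain ⟨N, hN⟩ := hf.cauchy (ε * (normConst Ω).toReal) (by positivity)
      refine ⟨N, fun m hm n hn => ?_⟩
      have h1 := hN m hm n hn
      rw [preForm_sub_self a (hf.contDiff m) (hf.contDiff n), mul_comm] at h1
      have h2 := lt_of_mul_lt_mul_right h1 hc.le
      have h3 := mul_nonneg ha.le (hnn (surfaceMeasure Ω)
        fun x => tangentialGradient Ω (φ m) x - tangentialGradient Ω (φ n) x)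
      linarith
  obtain ⟨Γ, hΓ, hΓl⟩ := exists_tendsto_of_cauchy
    (fun n => h.memLp_tangentialGradient (hf.contDiff n))
    fun ε hε => by
      obtain ⟨N, hN⟩ := hf.cauchy (ε * a * (normConst Ω).toReal) (by positivity)
      refine ⟨N, fun m hm n hn => ?_⟩
      have h1 := hN m hm n hn
      rw [preForm_sub_self a (hf.contDiff m) (hf.contDiff n), mul_comm] at h1
      have h2 := lt_of_mul_lt_mul_right h1 hc.le
      have h3 := hnn (volume.restrict (interior Ω)) fun x => gradient (φ m) x - gradient (φ n) x
      rw [mul_comm ε] at h2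
      exact lt_of_mul_lt_mul_left (by linarith) ha.le
  exact ⟨G, Γ, hf.contDiff, hm, hf.tendsto, hG, hGl, hΓ, hΓl⟩

/-- Subtracting two approximations of the same function reduces uniqueness of the limit gradients to
the case of the zero function. -/
lemma HasGradients.sub (h : IsSmoothDomain Ω) (hf : HasGradients Ω f G Γ φ)
    (hf' : HasGradients Ω f' G' Γ' φ') :
    HasGradients Ω (f - f') (G - G') (Γ - Γ') fun n => φ n - φ' n := by
  have key : ∀ {F : Type} [NormedAddCommGroup F] {ν : Measure (EuclideanSpace ℝ (Fin d))}
      {u u' : ℕ → EuclideanSpace ℝ (Fin d) → F} {v v' : EuclideanSpace ℝ (Fin d) → F},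
      (∀ n, MemLp (u n) 2 ν) → (∀ n, MemLp (u' n) 2 ν) → MemLp v 2 ν → MemLp v' 2 ν →
      Tendsto (fun n => eLpNorm (u n - v) 2 ν) atTop (𝓝 0) →
      Tendsto (fun n => eLpNorm (u' n - v') 2 ν) atTop (𝓝 0) →
      Tendsto (fun n => eLpNorm (u n - u' n - (v - v')) 2 ν) atTop (𝓝 0) := by
    intro F _ ν u u' v v' hu hu' hv hv' hl hl'
    rw [← tendsto_toLp_iff (fun n => (hu n).sub (hu' n)) (hv.sub hv')]
    rw [MemLp.toLp_sub hv hv']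
    exact (((tendsto_toLp_iff hu hv).2 hl).sub ((tendsto_toLp_iff hu' hv').2 hl')).congr
      fun n => (MemLp.toLp_sub (hu n) (hu' n)).symm
  refine ⟨fun n => (hf.contDiff n).sub (hf'.contDiff n), hf.memLp.sub hf'.memLp,
    key (fun n => h.memLp_of_continuous (hf.contDiff n).continuous)
      (fun n => h.memLp_of_continuous (hf'.contDiff n).continuous) hf.memLp hf'.memLp hf.tendsto
      hf'.tendsto, hf.memLp_bulk.sub hf'.memLp_bulk, ?_, hf.memLp_surface.sub hf'.memLp_surface, ?_⟩
  · have h1 : ∀ n, gradient (φ n - φ' n) = gradient (φ n) - gradient (φ' n) := fun n =>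
      gradient_sub' (hf.contDiff n) (hf'.contDiff n)
    refine (key (fun n => h.memLp_gradient (hf.contDiff n))
      (fun n => h.memLp_gradient (hf'.contDiff n)) hf.memLp_bulk hf'.memLp_bulk hf.tendsto_bulk
      hf'.tendsto_bulk).congr fun n => ?_
    exact congrArg (fun u => eLpNorm (u - (G - G')) 2 (volume.restrict (interior Ω))) (h1 n).symm
  · have h1 : ∀ n, tangentialGradient Ω (φ n - φ' n) =
        tangentialGradient Ω (φ n) - tangentialGradient Ω (φ' n) := fun n =>
      tangentialGradient_sub (hf.contDiff n) (hf'.contDiff n)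
    refine (key (fun n => h.memLp_tangentialGradient (hf.contDiff n))
      (fun n => h.memLp_tangentialGradient (hf'.contDiff n))
      hf.memLp_surface hf'.memLp_surface hf.tendsto_surface hf'.tendsto_surface).congr fun n => ?_
    exact congrArg (fun u => eLpNorm (u - (Γ - Γ')) 2 (surfaceMeasure Ω)) (h1 n).symm

/-- The limit of the gradients is a weak gradient. -/
lemma HasGradients.integral_mul_fderiv (h : IsSmoothDomain Ω) (hf : HasGradients Ω f G Γ φ)
    {η : EuclideanSpace ℝ (Fin d) → ℝ} (hη : ContDiff ℝ 1 η) (hc : HasCompactSupport η)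
    (hsupp : tsupport η ⊆ interior Ω) (v : EuclideanSpace ℝ (Fin d)) :
    ∫ x in interior Ω, f x * fderiv ℝ η x v = - ∫ x in interior Ω, inner ℝ (G x) v * η x := by
  have hfd : ∀ n, (fun x => fderiv ℝ (φ n) x v) = fun x => inner ℝ (gradient (φ n) x) v :=
    fun n => funext fun x => inner_gradient_left.symm
  refine integral_mul_fderiv_of_tendsto isOpen_interior (fun n => (hf.contDiff n).contDiffOn)
    (fun n => h.memLp_restrict_interior (h.memLp_of_continuous (hf.contDiff n).continuous))
    (fun n => ?_) (h.memLp_restrict_interior hf.memLp) (hf.memLp_bulk.inner_const v)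
    (tendsto_eLpNorm_of_measure_le h.inv_normConst_ne_top h.restrict_interior_le hf.tendsto) ?_
    hη hc hsupp
  · rw [hfd]
    exact (h.memLp_gradient (hf.contDiff n)).inner_const v
  · simp_rw [hfd]
    refine tendsto_eLpNorm_of_le_mul (C := ‖v‖) (fun n => .of_forall fun x => ?_) hf.tendsto_bulk
    simp only [Pi.sub_apply]
    rw [← inner_sub_left, mul_comm]
    exact norm_inner_le_norm _ _

/-- A weak gradient of the zero function integrates to zero against every test function, hence
vanishes almost everywhere. -/
lemma HasGradients.bulk_ae_eq_zero (h : IsSmoothDomain Ω)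
    (hf : HasGradients Ω 0 G Γ φ) : ∀ᵐ x ∂(volume.restrict (interior Ω)), G x = 0 := by
  rw [ae_restrict_iff' isOpen_interior.measurableSet]
  refine isOpen_interior.ae_eq_zero_of_integral_contDiff_smul_eq_zero
    (locallyIntegrableOn_of_locallyIntegrable_restrict (hf.memLp_bulk.locallyIntegrable one_le_two))
    fun η hη hc hsupp => ?_
  have hint : Integrable (fun x => η x • G x) (volume.restrict (interior Ω)) := by
    have := h.isFiniteMeasure_restrict_interior
    obtain ⟨C, hC⟩ := hc.exists_bound_of_continuous hη.continuous
    exact (hf.memLp_bulk.integrable one_le_two).bdd_smul C hη.continuous.aestronglyMeasurable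
      (.of_forall hC)
  have h1 : ∫ x, η x • G x = ∫ x in interior Ω, η x • G x := by
    rw [setIntegral_eq_integral_of_forall_compl_eq_zero fun x hx => by
      rw [image_eq_zero_of_notMem_tsupport fun h => hx (hsupp h), zero_smul]]
  rw [h1]
  refine ext_inner_right ℝ fun v => ?_
  have h2 := hf.integral_mul_fderiv h (hη.of_le (by exact_mod_cast le_top)) hc hsupp v
  simp only [Pi.zero_apply, zero_mul, integral_zero, zero_eq_neg] at h2
  rw [inner_zero_left, real_inner_comm, ← integral_inner hint, ← h2]
  refine integral_congr_ae (.of_forall fun x => ?_)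
  simp only [inner_smul_right, real_inner_comm]
  ring

/-- A subsequence converges almost everywhere, and each tangent space is closed. Tangency is needed
because charts detect only tangential components. -/
lemma HasGradients.surface_mem_tangentSpace (h : IsSmoothDomain Ω) (hf : HasGradients Ω f G Γ φ) :
    ∀ᵐ x ∂(surfaceMeasure Ω), Γ x ∈ tangentSpace Ω x := by
  have h1 := tendstoInMeasure_of_tendsto_eLpNorm two_ne_zero
    (fun n => (h.memLp_tangentialGradient (hf.contDiff n)).1) hf.memLp_surface.1 hf.tendsto_surface
  obtain ⟨ns, -, hns⟩ := h1.exists_seq_tendsto_ae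
  filter_upwards [hns] with x hx
  exact (Submodule.closed_of_finiteDimensional (tangentSpace Ω x)).mem_of_tendsto hx
    (.of_forall fun n => tangentialGradient_mem _ _)

/-- Closability of the tangential gradient, by integration by parts in boundary charts. -/
lemma HasGradients.surface_ae_eq_zero (h : IsSmoothDomain Ω)
    (hf : HasGradients Ω 0 G Γ φ) : ∀ᵐ x ∂(surfaceMeasure Ω), Γ x = 0 := by
  obtain ⟨k, rfl⟩ := h.dim
  rw [surfaceMeasure, ae_restrict_iff' isClosed_frontier.measurableSet, ae_iff]
  refine measure_null_of_locally_null _ fun p hp => ?_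
  simp only [Set.mem_ofPred_eq, Classical.not_imp] at hp
  obtain ⟨N, W, Φ, Θ, K, hc, hpN⟩ :=
    exists_isBoundaryChart_of_mem rfl h.isCompact.isClosed h.smooth hp.1
  refine ⟨_, inter_mem_nhdsWithin _ (hc.isOpen_nhd.mem_nhds hpN), ?_⟩
  have hK : (K : ℝ≥0∞) ^ k ≠ ⊤ := by simp
  have hmap := hc.map_le rfl
  have hΦm := hc.aemeasurable
  have hcomp : ∀ {F : Type} [NormedAddCommGroup F] {u : EuclideanSpace ℝ (Fin (k + 1)) → F},
      MemLp u 2 (surfaceMeasure Ω) → MemLp (u ∘ Φ) 2 (volume.restrict W) := fun hu =>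
    (hu.of_measure_le_smul hK hmap).comp_of_map hΦm
  have hlim : ∀ {F : Type} [NormedAddCommGroup F] {u : ℕ → EuclideanSpace ℝ (Fin (k + 1)) → F},
      (∀ n, MemLp (u n) 2 (surfaceMeasure Ω)) →
      Tendsto (fun n => eLpNorm (u n) 2 (surfaceMeasure Ω)) atTop (𝓝 0) →
      Tendsto (fun n => eLpNorm (u n ∘ Φ) 2 (volume.restrict W)) atTop (𝓝 0) := by
    intro F _ u hu hl
    refine (tendsto_eLpNorm_of_measure_le hK hmap hl).congr fun n => ?_
    exact eLpNorm_map_measure (hu n |>.of_measure_le_smul hK hmap).1 hΦm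
  have hW : ∀ᵐ u ∂(volume.restrict W), u ∈ W := ae_restrict_mem hc.isOpen_dom.measurableSet
  have hDm : ∀ v, AEStronglyMeasurable (fun u => fderiv ℝ Φ u v) (volume.restrict W) := fun v =>
    ((hc.contDiffOn.continuousOn_fderiv_of_isOpen hc.isOpen_dom le_rfl).clm_apply
      continuousOn_const).aestronglyMeasurable hc.isOpen_dom.measurableSet
  have hDb : ∀ v, ∀ u ∈ W, ‖fderiv ℝ Φ u v‖ ≤ K * ‖v‖ := fun v u hu =>
    (fderiv ℝ Φ u).le_of_opNorm_le (hc.norm_fderiv_le hu) v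
  have hinner : ∀ (v : EuclideanSpace ℝ (Fin k))
      {T : EuclideanSpace ℝ (Fin (k + 1)) → EuclideanSpace ℝ (Fin (k + 1))},
      MemLp T 2 (surfaceMeasure Ω) →
      MemLp (fun u => inner ℝ (T (Φ u)) (fderiv ℝ Φ u v)) 2 (volume.restrict W) := by
    intro v T hT
    refine MemLp.of_le_mul (c := K * ‖v‖) (hcomp hT) ((hcomp hT).1.inner (hDm v)) ?_
    filter_upwards [hW] with u hu
    rw [mul_comm]
    exact (norm_inner_le_norm _ _).trans (by gcongr; exacts [le_rfl, hDb v u hu])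
  -- By the chain rule this function is the `L²` limit of the derivatives of `φ n ∘ Φ` in the
  -- direction `v`, while `φ n ∘ Φ` tends to `0`: closability in the flat domain `W` applies.
  have hzero : ∀ v : EuclideanSpace ℝ (Fin k), ∀ᵐ u ∂(volume.restrict W),
      inner ℝ (Γ (Φ u)) (fderiv ℝ Φ u v) = 0 := by
    intro v
    have hfd : ∀ n, (fun u => fderiv ℝ (φ n ∘ Φ) u v) =ᵐ[volume.restrict W]
        fun u => inner ℝ (tangentialGradient Ω (φ n) (Φ u)) (fderiv ℝ Φ u v) := fun n => by
      filter_upwards [hW] with u hu using hc.fderiv_comp hu (hf.contDiff n) v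
    have hmem : ∀ n, MemLp (φ n) 2 (surfaceMeasure Ω) := fun n =>
      h.memLp_surfaceMeasure (h.memLp_of_continuous (hf.contDiff n).continuous)
    refine ae_eq_zero_of_tendsto_fderiv hc.isOpen_dom (w := fun n => φ n ∘ Φ) (v := v)
      (fun n => (hf.contDiff n).comp_contDiffOn hc.contDiffOn) (fun n => hcomp (hmem n))
      (fun n => ?_) (hinner v hf.memLp_surface) (hlim hmem ?_) ?_
    · exact (memLp_congr_ae (hfd n)).2 (hinner v (h.memLp_tangentialGradient (hf.contDiff n)))
    · simpa using tendsto_eLpNorm_of_measure_le h.inv_normConst_ne_top h.surfaceMeasure_le hf.tendsto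
    · refine tendsto_eLpNorm_of_le_mul (C := K * ‖v‖) (fun n => ?_)
        (hlim (fun n => (h.memLp_tangentialGradient (hf.contDiff n)).sub hf.memLp_surface)
          hf.tendsto_surface)
      filter_upwards [hfd n, hW] with u h1 hu
      rw [Pi.sub_apply, h1, ← inner_sub_left, mul_comm]
      exact (norm_inner_le_norm _ _).trans (by gcongr; exacts [le_rfl, hDb v u hu])
  have hbasis : ∀ᵐ u ∂(volume.restrict W), ∀ i,
      inner ℝ (Γ (Φ u)) (fderiv ℝ Φ u (EuclideanSpace.basisFun (Fin k) ℝ i)) = 0 :=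
    ae_all_iff.2 fun i => hzero _
  have htan : ∀ᵐ u ∂(volume.restrict W), Γ (Φ u) ∈ tangentSpace Ω (Φ u) :=
    ae_of_ae_map hΦm (Measure.absolutelyContinuous_of_le_smul hmap (hf.surface_mem_tangentSpace h))
  -- `Γ (Φ u)` is tangent, so it has the form `DΦ v`; being orthogonal to the whole range of `DΦ`,
  -- it is orthogonal to itself.
  have hΓ0 : ∀ᵐ u ∂(volume.restrict W), Γ (Φ u) = 0 := by
    filter_upwards [hbasis, htan, hW] with u h1 h2 hu
    obtain ⟨v, hv⟩ := hc.tangentSpace_le_range hu h2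
    have h3 : inner ℝ (Γ (Φ u)) (fderiv ℝ Φ u v) = 0 := by
      conv_lhs => rw [← (EuclideanSpace.basisFun (Fin k) ℝ).sum_repr v]
      rw [map_sum, inner_sum]
      exact Finset.sum_eq_zero fun i _ => by rw [map_smul, inner_smul_right, h1 i, mul_zero]
    have hv' : fderiv ℝ Φ u v = Γ (Φ u) := hv
    rwa [hv', inner_self_eq_zero] at h3
  rw [ae_restrict_iff' hc.isOpen_dom.measurableSet, ae_iff] at hΓ0
  -- A null set of parameters corresponds to a null set on the boundary.
  have h4 := hc.measure_le {x | Γ x ≠ 0}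
  have h5 : volume (W ∩ Φ ⁻¹' {x | Γ x ≠ 0}) = 0 := by
    refine measure_mono_null (fun u hu => ?_) hΓ0
    simp only [Set.mem_ofPred_eq, Classical.not_imp]
    exact hu
  rw [h5, mul_zero] at h4
  refine measure_mono_null (fun x hx => ?_) (nonpos_iff_eq_zero.1 h4)
  have h6 := hx.1
  simp only [Set.mem_ofPred_eq, Classical.not_imp] at h6
  exact ⟨h6.2, h6.1, hx.2⟩

end Gradient

end SRBD

/-! ### Product and chain rules for limit gradients, and the energy measure. -/

namespace SRBD

section L2Products

variable {α : Type*} [MeasurableSpace α] {ν : Measure α} {F : Type*} [NormedAddCommGroup F]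

lemma tendsto_eLpNorm_add {u v : ℕ → α → F} (hu : ∀ n, AEStronglyMeasurable (u n) ν)
    (hv : ∀ n, AEStronglyMeasurable (v n) ν)
    (hul : Tendsto (fun n => eLpNorm (u n) 2 ν) atTop (𝓝 0))
    (hvl : Tendsto (fun n => eLpNorm (v n) 2 ν) atTop (𝓝 0)) :
    Tendsto (fun n => eLpNorm (u n + v n) 2 ν) atTop (𝓝 0) := by
  have h1 := hul.add hvl
  rw [add_zero] at h1
  exact tendsto_of_tendsto_of_tendsto_of_le_of_le tendsto_const_nhds h1 (fun _ => zero_le)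
    fun n => eLpNorm_add_le (hu n) (hv n) one_le_two

variable [NormedSpace ℝ F]

lemma memLp_bounded_smul {b : α → ℝ} {g : α → F} {C : ℝ} (hb : AEStronglyMeasurable b ν)
    (hC : ∀ᵐ x ∂ν, |b x| ≤ C) (hg : MemLp g 2 ν) : MemLp (fun x => b x • g x) 2 ν := by
  refine MemLp.of_le_mul (c := C) hg (hb.smul hg.1) ?_
  filter_upwards [hC] with x hx
  rw [norm_smul]
  exact mul_le_mul_of_nonneg_right hx (norm_nonneg _)

lemma memLp_smul_bounded {u : α → ℝ} {w : α → F} {C : ℝ} (hw : AEStronglyMeasurable w ν)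
    (hC : ∀ᵐ x ∂ν, ‖w x‖ ≤ C) (hu : MemLp u 2 ν) : MemLp (fun x => u x • w x) 2 ν := by
  refine MemLp.of_le_mul (c := C) hu (hu.1.smul hw) ?_
  filter_upwards [hC] with x hx
  rw [norm_smul, mul_comm]
  exact mul_le_mul_of_nonneg_right hx (norm_nonneg _)

/-- Convergence in `L²` for the product rule with bounded factors. -/
lemma tendsto_eLpNorm_product_rule {b : α → ℝ} {w : α → F} {C C' : ℝ}
    (hb : AEStronglyMeasurable b ν) (hbC : ∀ᵐ x ∂ν, |b x| ≤ C) (hw : AEStronglyMeasurable w ν)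
    (hwC : ∀ᵐ x ∂ν, ‖w x‖ ≤ C') {u : ℕ → α → ℝ} {u' : α → ℝ} {g : ℕ → α → F} {g' : α → F}
    (hu : ∀ n, AEStronglyMeasurable (u n) ν) (hu' : AEStronglyMeasurable u' ν)
    (hg : ∀ n, AEStronglyMeasurable (g n) ν) (hg' : AEStronglyMeasurable g' ν)
    (hul : Tendsto (fun n => eLpNorm (u n - u') 2 ν) atTop (𝓝 0))
    (hgl : Tendsto (fun n => eLpNorm (g n - g') 2 ν) atTop (𝓝 0)) :
    Tendsto (fun n => eLpNorm ((fun x => b x • g n x + u n x • w x) -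
      fun x => b x • g' x + u' x • w x) 2 ν) atTop (𝓝 0) := by
  have h1 : Tendsto (fun n => eLpNorm (fun x => b x • (g n x - g' x)) 2 ν) atTop (𝓝 0) := by
    refine tendsto_eLpNorm_of_le_mul (C := C) (fun n => ?_) hgl
    filter_upwards [hbC] with x hx
    rw [norm_smul]
    exact mul_le_mul_of_nonneg_right hx (norm_nonneg _)
  have h2 : Tendsto (fun n => eLpNorm (fun x => (u n x - u' x) • w x) 2 ν) atTop (𝓝 0) := by
    refine tendsto_eLpNorm_of_le_mul (C := C') (fun n => ?_) hul
    filter_upwards [hwC] with x hx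
    rw [norm_smul, mul_comm]
    exact mul_le_mul_of_nonneg_right hx (norm_nonneg _)
  refine (tendsto_eLpNorm_add (fun n => hb.smul ((hg n).sub hg'))
    (fun n => ((hu n).sub hu').smul hw) h1 h2).congr fun n => ?_
  congr 1
  ext x
  simp only [Pi.add_apply, Pi.sub_apply, smul_sub, sub_smul, Pi.smul_apply']
  abel

/-- Convergence in `L²` for the chain rule with bounded derivative. -/
lemma tendsto_eLpNorm_chain_rule [IsFiniteMeasure ν] {b : ℕ → α → ℝ} {b' : α → ℝ} {C : ℝ}
    (hb : ∀ n, AEStronglyMeasurable (b n) ν) (hb' : AEStronglyMeasurable b' ν)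
    (hbC : ∀ n x, |b n x| ≤ C) (hbC' : ∀ x, |b' x| ≤ C)
    (hbl : ∀ᵐ x ∂ν, Tendsto (fun n => b n x) atTop (𝓝 (b' x)))
    {g : ℕ → α → F} {g' : α → F} (hg : ∀ n, AEStronglyMeasurable (g n) ν) (hg' : MemLp g' 2 ν)
    (hgl : Tendsto (fun n => eLpNorm (g n - g') 2 ν) atTop (𝓝 0)) :
    Tendsto (fun n => eLpNorm ((fun x => b n x • g n x) - fun x => b' x • g' x) 2 ν) atTop
      (𝓝 0) := by
  have h1 : Tendsto (fun n => eLpNorm (fun x => b n x • (g n x - g' x)) 2 ν) atTop (𝓝 0) := by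
    refine tendsto_eLpNorm_of_le_mul (C := C) (fun n => .of_forall fun x => ?_) hgl
    rw [norm_smul]
    exact mul_le_mul_of_nonneg_right (hbC n x) (norm_nonneg _)
  have h2 : Tendsto (fun n => eLpNorm (fun x => (b n x - b' x) • g' x) 2 ν) atTop (𝓝 0) := by
    refine tendsto_eLpNorm_mul_of_dominated (C := C + C) (fun n => (hb n).sub hb') hg'
      (fun n x => (abs_sub _ _).trans (add_le_add (hbC n x) (hbC' x))) ?_
    filter_upwards [hbl] with x hx
    simpa using hx.sub_const (b' x)
  refine (tendsto_eLpNorm_add (fun n => (hb n).smul ((hg n).sub hg'.1))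
    (fun n => ((hb n).sub hb').smul hg'.1) h1 h2).congr fun n => ?_
  congr 1
  ext x
  simp only [Pi.add_apply, Pi.sub_apply, smul_sub, sub_smul, Pi.smul_apply']
  abel

lemma integrable_inner_of_memLp {F : Type*} [NormedAddCommGroup F] [InnerProductSpace ℝ F]
    {u v : α → F} (hu : MemLp u 2 ν) (hv : MemLp v 2 ν) :
    Integrable (fun x => inner ℝ (u x) (v x)) ν := by
  refine (L2.integrable_inner (𝕜 := ℝ) (hu.toLp u) (hv.toLp v)).congr ?_
  filter_upwards [hu.coeFn_toLp, hv.coeFn_toLp] with x h1 h2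
  rw [h1, h2]

end L2Products

variable {d : ℕ} {Ω : Set (EuclideanSpace ℝ (Fin d))} {a : ℝ}
  {f f' F : EuclideanSpace ℝ (Fin d) → ℝ}
  {G Γ G' Γ' : EuclideanSpace ℝ (Fin d) → EuclideanSpace ℝ (Fin d)}
  {φ φ' : ℕ → EuclideanSpace ℝ (Fin d) → ℝ}

/-- The limits of the gradients do not depend on the approximating sequence. -/
lemma HasGradients.unique (h : IsSmoothDomain Ω) (hf : HasGradients Ω f G Γ φ)
    (hf' : HasGradients Ω f G' Γ' φ') :
    G =ᵐ[volume.restrict (interior Ω)] G' ∧ Γ =ᵐ[surfaceMeasure Ω] Γ' := by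
  have h1 := hf.sub h hf'
  rw [sub_self] at h1
  refine ⟨?_, ?_⟩
  · filter_upwards [h1.bulk_ae_eq_zero h] with x hx using sub_eq_zero.1 hx
  · filter_upwards [h1.surface_ae_eq_zero h] with x hx using sub_eq_zero.1 hx

/-- The energy of two pairs of gradients. -/
noncomputable def gradientEnergy (Ω : Set (EuclideanSpace ℝ (Fin d))) (a : ℝ)
    (G Γ G' Γ' : EuclideanSpace ℝ (Fin d) → EuclideanSpace ℝ (Fin d)) : ℝ :=
  (normConst Ω).toReal * ((∫ x in interior Ω, inner ℝ (G x) (G' x)) +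
    a * ∫ x, inner ℝ (Γ x) (Γ' x) ∂(surfaceMeasure Ω))

lemma HasGradients.tendsto_preForm (h : IsSmoothDomain Ω) (hf : HasGradients Ω f G Γ φ)
    (hf' : HasGradients Ω f' G' Γ' φ') :
    Tendsto (fun n => preForm Ω a (φ n) (φ' n)) atTop (𝓝 (gradientEnergy Ω a G Γ G' Γ')) := by
  simp_rw [preForm_eq]
  refine Tendsto.const_mul _ (Tendsto.add ?_ (Tendsto.const_mul _ ?_))
  · exact tendsto_integral_inner (fun n => h.memLp_gradient (hf.contDiff n)) hf.memLp_bulk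
      (fun n => h.memLp_gradient (hf'.contDiff n)) hf'.memLp_bulk hf.tendsto_bulk hf'.tendsto_bulk
  · exact tendsto_integral_inner (fun n => h.memLp_tangentialGradient (hf.contDiff n))
      hf.memLp_surface (fun n => h.memLp_tangentialGradient (hf'.contDiff n)) hf'.memLp_surface
      hf.tendsto_surface hf'.tendsto_surface

/-- The Dirichlet form in terms of the gradients. -/
lemma HasGradients.dirichletForm_eq (h : IsSmoothDomain Ω) (ha : 0 < a)
    (hf : HasGradients Ω f G Γ φ) (hf' : HasGradients Ω f' G' Γ' φ') :
    dirichletForm Ω a f f' = gradientEnergy Ω a G Γ G' Γ' := by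
  have hex : ∃ r, IsFormValue Ω a f f' r :=
    ⟨_, φ, φ', hf.isApprox h ha, hf'.isApprox h ha, hf.tendsto_preForm h hf'⟩
  rw [dirichletForm, dif_pos hex]
  -- The value of the form comes from unspecified approximations `ψ`, `ψ'`. Their limit gradients
  -- agree almost everywhere with the given ones, so the energy is the same.
  obtain ⟨ψ, ψ', hψ, hψ', hlim⟩ := hex.choose_spec
  obtain ⟨G₁, Γ₁, h₁⟩ := hψ.exists_hasGradients h ha hf.memLp
  obtain ⟨G₂, Γ₂, h₂⟩ := hψ'.exists_hasGradients h ha hf'.memLp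
  rw [tendsto_nhds_unique hlim (h₁.tendsto_preForm h h₂)]
  obtain ⟨hG, hΓ⟩ := h₁.unique h hf
  obtain ⟨hG', hΓ'⟩ := h₂.unique h hf'
  rw [gradientEnergy, gradientEnergy]
  congr 2
  · refine integral_congr_ae ?_
    filter_upwards [hG, hG'] with x h1 h2
    rw [h1, h2]
  · congr 1
    refine integral_congr_ae ?_
    filter_upwards [hΓ, hΓ'] with x h1 h2
    rw [h1, h2]

lemma mem_formDomain_iff (h : IsSmoothDomain Ω) (ha : 0 < a) :
    f ∈ formDomain Ω a ↔ ∃ G Γ φ, HasGradients Ω f G Γ φ := by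
  constructor
  · rintro ⟨hf, φ, hφ⟩
    obtain ⟨G, Γ, hG⟩ := hφ.exists_hasGradients h ha hf
    exact ⟨G, Γ, φ, hG⟩
  · rintro ⟨G, Γ, φ, hG⟩
    exact ⟨hG.memLp, φ, hG.isApprox h ha⟩

lemma HasGradients.congr_ae (hf : HasGradients Ω f G Γ φ) (hff' : f =ᵐ[invMeasure Ω] f')
    (hG : G =ᵐ[volume.restrict (interior Ω)] G') (hΓ : Γ =ᵐ[surfaceMeasure Ω] Γ') :
    HasGradients Ω f' G' Γ' φ where
  contDiff := hf.contDiff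
  memLp := (memLp_congr_ae hff').1 hf.memLp
  tendsto := hf.tendsto.congr fun _ => eLpNorm_congr_ae (ae_eq_rfl.sub hff')
  memLp_bulk := (memLp_congr_ae hG).1 hf.memLp_bulk
  tendsto_bulk := hf.tendsto_bulk.congr fun _ => eLpNorm_congr_ae (ae_eq_rfl.sub hG)
  memLp_surface := (memLp_congr_ae hΓ).1 hf.memLp_surface
  tendsto_surface := hf.tendsto_surface.congr fun _ => eLpNorm_congr_ae (ae_eq_rfl.sub hΓ)

lemma IsSmoothDomain.exists_ae_bound (h : IsSmoothDomain Ω) {E : Type*} [NormedAddCommGroup E]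
    {u : EuclideanSpace ℝ (Fin d) → E} (hu : ContinuousOn u Ω) :
    ∃ C, ∀ᵐ x ∂(invMeasure Ω), ‖u x‖ ≤ C := by
  obtain ⟨C, hC⟩ := h.isCompact.exists_bound_of_continuousOn hu
  exact ⟨C, h.ae_mem_invMeasure.mono hC⟩

/-- The product rule, with one `C¹` factor. -/
lemma HasGradients.contDiff_mul (h : IsSmoothDomain Ω) (hF : ContDiff ℝ 1 F)
    (hf : HasGradients Ω f G Γ φ) :
    HasGradients Ω (F * f) (fun x => F x • G x + f x • gradient F x)
      (fun x => F x • Γ x + f x • tangentialGradient Ω F x) fun n => F * φ n := by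
  have hgF := continuous_gradient hF
  obtain ⟨C, hC⟩ := h.exists_ae_bound hF.continuous.continuousOn
  obtain ⟨C', hC'⟩ := h.exists_ae_bound hgF.continuousOn
  have hCτ : ∀ᵐ x ∂(surfaceMeasure Ω), ‖tangentialGradient Ω F x‖ ≤ C' := by
    filter_upwards [h.ae_surfaceMeasure hC'] with x hx
    exact (norm_tangentialGradient_le F x).trans hx
  have hτ := (h.memLp_tangentialGradient hF).1
  refine ⟨fun n => hF.mul (hf.contDiff n),
    memLp_bounded_smul hF.continuous.aestronglyMeasurable hC hf.memLp, ?_,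
    (memLp_bounded_smul hF.continuous.aestronglyMeasurable (h.ae_restrict_interior hC)
      hf.memLp_bulk).add (memLp_smul_bounded hgF.aestronglyMeasurable (h.ae_restrict_interior hC')
      (h.memLp_restrict_interior hf.memLp)), ?_,
    (memLp_bounded_smul hF.continuous.aestronglyMeasurable (h.ae_surfaceMeasure hC)
      hf.memLp_surface).add (memLp_smul_bounded hτ hCτ (h.memLp_surfaceMeasure hf.memLp)), ?_⟩
  · refine tendsto_eLpNorm_of_le_mul (C := C) (fun n => ?_) hf.tendsto
    filter_upwards [hC] with x hx
    simp only [Pi.sub_apply, Pi.mul_apply]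
    rw [← mul_sub, norm_mul]
    exact mul_le_mul_of_nonneg_right hx (norm_nonneg _)
  · refine (tendsto_eLpNorm_product_rule (u := φ) (g := fun n => gradient (φ n))
      hF.continuous.aestronglyMeasurable (h.ae_restrict_interior hC) hgF.aestronglyMeasurable
      (h.ae_restrict_interior hC') (fun n => (hf.contDiff n).continuous.aestronglyMeasurable)
      (h.memLp_restrict_interior hf.memLp).1 (fun n => (h.memLp_gradient (hf.contDiff n)).1)
      hf.memLp_bulk.1 (tendsto_eLpNorm_of_measure_le h.inv_normConst_ne_top h.restrict_interior_le
        hf.tendsto) hf.tendsto_bulk).congr fun n => ?_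
    congr 2
    ext1 x
    exact (gradient_mul hF (hf.contDiff n) x).symm
  · refine (tendsto_eLpNorm_product_rule (u := φ) (g := fun n => tangentialGradient Ω (φ n))
      hF.continuous.aestronglyMeasurable (h.ae_surfaceMeasure hC) hτ hCτ
      (fun n => (hf.contDiff n).continuous.aestronglyMeasurable)
      (h.memLp_surfaceMeasure hf.memLp).1 (fun n => (h.memLp_tangentialGradient (hf.contDiff n)).1)
      hf.memLp_surface.1 (tendsto_eLpNorm_of_measure_le h.inv_normConst_ne_top h.surfaceMeasure_le
        hf.tendsto) hf.tendsto_surface).congr fun n => ?_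
    congr 2
    ext1 x
    exact (tangentialGradient_mul hF (hf.contDiff n) x).symm

/-- The chain rule for `C¹` functions with bounded derivative. -/
lemma HasGradients.exists_comp (h : IsSmoothDomain Ω) (hf : HasGradients Ω f G Γ φ) {ζ : ℝ → ℝ}
    (hζ : ContDiff ℝ 1 ζ) (hζ0 : ζ 0 = 0) {C : ℝ} (hC : ∀ t, |deriv ζ t| ≤ C) :
    ∃ ψ, HasGradients Ω (ζ ∘ f) (fun x => deriv ζ (f x) • G x) (fun x => deriv ζ (f x) • Γ x) ψ := by
  have h1 := tendstoInMeasure_of_tendsto_eLpNorm two_ne_zero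
    (fun n => (hf.contDiff n).continuous.aestronglyMeasurable) hf.memLp.1 hf.tendsto
  -- Almost everywhere convergence of `φ (ns i)` is needed for the factors `deriv ζ (φ (ns i))`,
  -- which are merely bounded and continuous in the value of `φ`; dominated convergence does the
  -- rest.
  obtain ⟨ns, hmono, hns⟩ := h1.exists_seq_tendsto_ae
  have hsub := hmono.tendsto_atTop
  have hζd := hζ.differentiable one_ne_zero
  have hζc : Continuous (deriv ζ) := hζ.continuous_deriv le_rfl
  have hLip : LipschitzWith C.toNNReal ζ := lipschitzWith_of_nnnorm_deriv_le hζd fun t => by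
    rw [← NNReal.coe_le_coe, Real.coe_toNNReal _ ((abs_nonneg _).trans (hC 0))]
    exact hC t
  have hlim : ∀ᵐ x ∂(invMeasure Ω),
      Tendsto (fun i => deriv ζ (φ (ns i) x)) atTop (𝓝 (deriv ζ (f x))) := by
    filter_upwards [hns] with x hx
    exact (hζc.tendsto _).comp hx
  have hfin1 := h.isFiniteMeasure_restrict_interior
  have hfin2 := h.isFiniteMeasure_surfaceMeasure
  have hfm := (h.memLp_restrict_interior hf.memLp).1
  have hfm' := (h.memLp_surfaceMeasure hf.memLp).1
  refine ⟨fun i => ζ ∘ φ (ns i), fun i => hζ.comp (hf.contDiff _),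
    hLip.comp_memLp hζ0 hf.memLp, ?_,
    memLp_bounded_smul (hζc.comp_aestronglyMeasurable hfm) (.of_forall fun x => hC _) hf.memLp_bulk,
    ?_,
    memLp_bounded_smul (hζc.comp_aestronglyMeasurable hfm') (.of_forall fun x => hC _)
      hf.memLp_surface, ?_⟩
  · refine tendsto_eLpNorm_of_le_mul (C := C.toNNReal) (fun n => .of_forall fun x => ?_)
      (hf.tendsto.comp hsub)
    exact hLip.norm_sub_le _ _
  · refine (tendsto_eLpNorm_chain_rule (b := fun i x => deriv ζ (φ (ns i) x))
      (g := fun i => gradient (φ (ns i)))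
      (fun i => (hζc.comp (hf.contDiff _).continuous).aestronglyMeasurable)
      (hζc.comp_aestronglyMeasurable hfm) (fun i x => hC _) (fun x => hC _)
      (h.ae_restrict_interior hlim) (fun i => (h.memLp_gradient (hf.contDiff _)).1) hf.memLp_bulk
      (hf.tendsto_bulk.comp hsub)).congr fun i => ?_
    congr 2
    ext1 x
    exact (gradient_comp (hf.contDiff _) hζd x).symm
  · refine (tendsto_eLpNorm_chain_rule (b := fun i x => deriv ζ (φ (ns i) x))
      (g := fun i => tangentialGradient Ω (φ (ns i)))
      (fun i => (hζc.comp (hf.contDiff _).continuous).aestronglyMeasurable)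
      (hζc.comp_aestronglyMeasurable hfm') (fun i x => hC _) (fun x => hC _)
      (h.ae_surfaceMeasure hlim) (fun i => (h.memLp_tangentialGradient (hf.contDiff _)).1)
      hf.memLp_surface (hf.tendsto_surface.comp hsub)).congr fun i => ?_
    congr 2
    ext1 x
    exact (tangentialGradient_comp (hf.contDiff _) hζd x).symm

/-- A `C¹` function with bounded derivative that equals `t²` on `[-M, M]`. -/
lemma exists_truncated_square {M : ℝ} (hM : 0 ≤ M) :
    ∃ ζ : ℝ → ℝ, ContDiff ℝ 1 ζ ∧ ζ 0 = 0 ∧ (∀ t, |deriv ζ t| ≤ 2 * M) ∧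
      ∀ t, |t| ≤ M → ζ t = t ^ 2 ∧ deriv ζ t = 2 * t := by
  -- The derivative `2t`, frozen beyond `±M`; its primitive from `0` is the required function.
  let ρ : ℝ → ℝ := fun t => 2 * max (-M) (min M t)
  have hρ : Continuous ρ := by fun_prop
  have hder : ∀ t, HasDerivAt (fun t => ∫ s in (0 : ℝ)..t, ρ s) (ρ t) t := fun t =>
    intervalIntegral.integral_hasDerivAt_right (hρ.intervalIntegrable _ _)
      (hρ.stronglyMeasurableAtFilter _ _) hρ.continuousAt
  have hder' : deriv (fun t => ∫ s in (0 : ℝ)..t, ρ s) = ρ := funext fun t => (hder t).deriv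
  have hρid : ∀ t, |t| ≤ M → ρ t = 2 * t := fun t ht => by
    have := abs_le.1 ht
    simp only [ρ]
    rw [min_eq_right this.2, max_eq_right this.1]
  refine ⟨fun t => ∫ s in (0 : ℝ)..t, ρ s, ?_, by simp, fun t => ?_, fun t ht => ⟨?_, ?_⟩⟩
  · exact contDiff_one_iff_deriv.2 ⟨fun t => (hder t).differentiableAt, by rwa [hder']⟩
  · rw [hder', abs_mul, abs_two]
    gcongr
    exact abs_le.2 ⟨le_max_left _ _, max_le (by linarith) (min_le_left _ _)⟩
  · have h1 : ∫ s in (0 : ℝ)..t, ρ s = ∫ s in (0 : ℝ)..t, 2 * s := by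
      refine intervalIntegral.integral_congr fun s hs => hρid s ?_
      refine le_trans ?_ ht
      have := abs_sub_left_of_mem_uIcc hs
      simpa using this
    have h2 : ∫ s in (0 : ℝ)..t, 2 * s = t ^ 2 := by
      rw [intervalIntegral.integral_const_mul, integral_id]
      ring
    exact h1.trans h2
  · rw [hder', hρid t ht]

/-- The chain rule for the square of a continuous function. -/
lemma HasGradients.exists_sq (h : IsSmoothDomain Ω) (hf : HasGradients Ω f G Γ φ)
    (hfc : ContinuousOn f Ω) :
    ∃ ψ, HasGradients Ω (f ^ 2) (fun x => (2 * f x) • G x) (fun x => (2 * f x) • Γ x) ψ := by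
  -- On `Ω`, which carries `μ`, the values of `f` stay in `[-M, M]`, where the truncated square and
  -- its derivative are exact.
  obtain ⟨M, hM⟩ := h.isCompact.exists_bound_of_continuousOn hfc
  have hM0 : 0 ≤ M := by
    obtain ⟨x, hx⟩ := h.nonempty_interior
    exact (norm_nonneg _).trans (hM x (interior_subset hx))
  obtain ⟨ζ, hζ, hζ0, hζC, hζsq⟩ := exists_truncated_square hM0
  obtain ⟨ψ, hψ⟩ := hf.exists_comp h hζ hζ0 hζC
  have hae := h.ae_mem_invMeasure
  refine ⟨ψ, hψ.congr_ae ?_ ?_ ?_⟩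
  · filter_upwards [hae] with x hx using (hζsq _ (hM x hx)).1
  · filter_upwards [h.ae_restrict_interior hae] with x hx
    rw [(hζsq _ (hM x hx)).2]
  · filter_upwards [h.ae_surfaceMeasure hae] with x hx
    rw [(hζsq _ (hM x hx)).2]

/-- The energy measure of `f`, tested against `h`. -/
lemma HasGradients.energyMeasure_eq (hΩ : IsSmoothDomain Ω) (ha : 0 < a)
    {h : EuclideanSpace ℝ (Fin d) → ℝ}
    {H η : EuclideanSpace ℝ (Fin d) → EuclideanSpace ℝ (Fin d)}
    {ψ χ : ℕ → EuclideanSpace ℝ (Fin d) → ℝ}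
    (hf : HasGradients Ω f G Γ φ) (hfc : ContinuousOn f Ω) (hh : HasGradients Ω h H η ψ)
    (hfh : HasGradients Ω (f * h) (fun x => h x • G x + f x • H x)
      (fun x => h x • Γ x + f x • η x) χ) :
    dirichletForm Ω a (f * h) f - dirichletForm Ω a (f ^ 2) h / 2 = (normConst Ω).toReal *
      ((∫ x in interior Ω, h x * ‖G x‖ ^ 2) + a * ∫ x, h x * ‖Γ x‖ ^ 2 ∂(surfaceMeasure Ω)) := by
  obtain ⟨ξ, hξ⟩ := hf.exists_sq hΩ hfc
  -- Pointwise `⟪h A + f B, A⟫ - ⟪2 f A, B⟫ / 2 = h ‖A‖²`, since the cross terms cancel. It is used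
  -- once in the interior and once on the boundary.
  have key : ∀ (ν : Measure (EuclideanSpace ℝ (Fin d)))
      (A B : EuclideanSpace ℝ (Fin d) → EuclideanSpace ℝ (Fin d)),
      MemLp (fun x => h x • A x + f x • B x) 2 ν → MemLp A 2 ν →
      MemLp (fun x => (2 * f x) • A x) 2 ν → MemLp B 2 ν →
      ∫ x, h x * ‖A x‖ ^ 2 ∂ν = (∫ x, inner ℝ (h x • A x + f x • B x) (A x) ∂ν) -
        (∫ x, inner ℝ ((2 * f x) • A x) (B x) ∂ν) / 2 := by
    intro ν A B h1 h2 h3 h4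
    rw [← integral_div, ← integral_sub (integrable_inner_of_memLp h1 h2)
      ((integrable_inner_of_memLp h3 h4).div_const 2)]
    refine integral_congr_ae (.of_forall fun x => ?_)
    simp only [inner_add_left, real_inner_smul_left, real_inner_self_eq_norm_sq,
      real_inner_comm (A x) (B x)]
    ring
  rw [hfh.dirichletForm_eq hΩ ha hf, hξ.dirichletForm_eq hΩ ha hh, gradientEnergy, gradientEnergy,
    key _ G H hfh.memLp_bulk hf.memLp_bulk hξ.memLp_bulk hh.memLp_bulk,
    key _ Γ η hfh.memLp_surface hf.memLp_surface hξ.memLp_surface hh.memLp_surface]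
  ring

end SRBD

/-! ### The functions of `D_0`, and the supremum of their increments. -/

namespace SRBD

variable {d : ℕ} {Ω : Set (EuclideanSpace ℝ (Fin d))} {a : ℝ}
  {f F : EuclideanSpace ℝ (Fin d) → ℝ}
  {G Γ : EuclideanSpace ℝ (Fin d) → EuclideanSpace ℝ (Fin d)}
  {φ : ℕ → EuclideanSpace ℝ (Fin d) → ℝ}

lemma IsSmoothDomain.integral_invMeasure (h : IsSmoothDomain Ω)
    {u : EuclideanSpace ℝ (Fin d) → ℝ} (hu : MemLp u 2 (invMeasure Ω)) :
    ∫ x, u x ∂(invMeasure Ω) = (normConst Ω).toReal *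
      ((∫ x in Ω, u x) + ∫ x, u x ∂(surfaceMeasure Ω)) := by
  have := h.isFiniteMeasure_bulkMeasure
  have := h.isFiniteMeasure_surfaceMeasure
  have h1 : MemLp u 2 (bulkMeasure Ω + surfaceMeasure Ω) := by
    rw [← h.inv_smul_invMeasure]
    exact hu.smul_measure h.inv_normConst_ne_top
  have h2 := h1.integrable one_le_two
  rw [invMeasure, integral_smul_measure, integral_add_measure h2.left_of_add_measure
    h2.right_of_add_measure, smul_eq_mul, bulkMeasure]

/-- `C¹` functions with gradient at most `1` on `Ω` belong to `D_0`. -/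
lemma mem_unitEnergyFunctions_of_contDiff (h : IsSmoothDomain Ω) (ha : 0 < a) (ha1 : a ≤ 1)
    (hF : ContDiff ℝ 1 F) (hF1 : ∀ x ∈ Ω, ‖fderiv ℝ F x‖ ≤ 1) : F ∈ unitEnergyFunctions Ω a := by
  have hFg := h.hasGradients_const hF
  refine ⟨⟨(mem_formDomain_iff h ha).2 ⟨_, _, _, hFg⟩, hF.continuous.continuousOn⟩, ?_⟩
  rintro η ⟨hη, -⟩
  obtain ⟨H, κ, ψ, hψ⟩ := (mem_formDomain_iff h ha).1 hη
  have hprod := hψ.contDiff_mul h hF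
  simp_rw [add_comm (F _ • _)] at hprod
  rw [hFg.energyMeasure_eq h ha hF.continuous.continuousOn hψ hprod,
    h.integral_invMeasure (u := fun x => |η x|) hψ.memLp.norm]
  have hb := h.isFiniteMeasure_bulkMeasure
  have hs := h.isFiniteMeasure_surfaceMeasure
  have hi := h.isFiniteMeasure_restrict_interior
  have hgrad : ∀ x ∈ Ω, ‖gradient F x‖ ^ 2 ≤ 1 := fun x hx => by
    rw [norm_gradient]
    exact pow_le_one₀ (norm_nonneg _) (hF1 x hx)
  have hτ : ∀ x ∈ Ω, ‖tangentialGradient Ω F x‖ ^ 2 ≤ 1 := fun x hx =>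
    (pow_le_pow_left₀ (norm_nonneg _) (norm_tangentialGradient_le F x) 2).trans (hgrad x hx)
  have key : ∀ (ν : Measure (EuclideanSpace ℝ (Fin d))) (w : EuclideanSpace ℝ (Fin d) → ℝ),
      Integrable (fun x => |η x|) ν → (∀ᵐ x ∂ν, x ∈ Ω) → (∀ x, 0 ≤ w x) → (∀ x ∈ Ω, w x ≤ 1) →
      ∫ x, η x * w x ∂ν ≤ ∫ x, |η x| ∂ν := by
    intro ν w hint hmem hw0 hw1
    refine (Real.le_norm_self _).trans (norm_integral_le_of_norm_le hint ?_)
    filter_upwards [hmem] with x hx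
    rw [norm_mul, Real.norm_eq_abs, Real.norm_of_nonneg (hw0 x)]
    exact mul_le_of_le_one_right (abs_nonneg _) (hw1 x hx)
  have hη1 : Integrable (fun x => |η x|) (volume.restrict Ω) := by
    have h1 : MemLp η 2 (bulkMeasure Ω + surfaceMeasure Ω) := by
      rw [← h.inv_smul_invMeasure]
      exact hψ.memLp.smul_measure h.inv_normConst_ne_top
    exact ((h1.integrable one_le_two).left_of_add_measure).abs
  have h1 := key (volume.restrict (interior Ω)) (fun x => ‖gradient F x‖ ^ 2)
    (((h.memLp_restrict_interior hψ.memLp).integrable one_le_two).abs)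
    (h.ae_restrict_interior h.ae_mem_invMeasure) (fun x => by positivity) hgrad
  have h2 := key (surfaceMeasure Ω) (fun x => ‖tangentialGradient Ω F x‖ ^ 2)
    (((h.memLp_surfaceMeasure hψ.memLp).integrable one_le_two).abs)
    (h.ae_surfaceMeasure h.ae_mem_invMeasure) (fun x => by positivity) hτ
  have h3 : ∫ x in interior Ω, |η x| ≤ ∫ x in Ω, |η x| :=
    setIntegral_mono_set hη1 (.of_forall fun x => abs_nonneg _) interior_subset.eventuallyLE
  have h4 : 0 ≤ ∫ x, |η x| ∂(surfaceMeasure Ω) := integral_nonneg fun x => abs_nonneg _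
  refine mul_le_mul_of_nonneg_left ?_ h.normConst_toReal_pos.le
  refine add_le_add (h1.trans h3) ?_
  -- This is where `a ≤ 1` enters: the boundary part of the energy measure stays below the boundary
  -- part of `μ`.
  calc a * _ ≤ a * ∫ x, |η x| ∂(surfaceMeasure Ω) := mul_le_mul_of_nonneg_left h2 ha.le
    _ ≤ _ := mul_le_of_le_one_left h4 ha1

/-- The energy measure of a function of `D_0` is at most Lebesgue measure in the interior. -/
lemma integral_mul_sq_norm_le (h : IsSmoothDomain Ω) (ha : 0 < a)
    (hf0 : f ∈ unitEnergyFunctions Ω a) (hf : HasGradients Ω f G Γ φ)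
    {η : EuclideanSpace ℝ (Fin d) → ℝ} (hη : ContDiff ℝ 1 η) (hη0 : ∀ x, 0 ≤ η x)
    (hsupp : ∀ x ∉ interior Ω, η x = 0) :
    ∫ x in interior Ω, η x * ‖G x‖ ^ 2 ≤ ∫ x in interior Ω, η x := by
  have hηg := h.hasGradients_const hη
  have h1 := hf0.2 η ⟨(mem_formDomain_iff h ha).2 ⟨_, _, _, hηg⟩, hη.continuous.continuousOn⟩
  have hprod := hf.contDiff_mul h hη
  rw [mul_comm η f] at hprod
  rw [hf.energyMeasure_eq h ha hf0.1.2 hηg hprod, h.integral_invMeasure (u := fun x => |η x|) hηg.memLp.norm] at h1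
  have h2 := le_of_mul_le_mul_left h1 h.normConst_toReal_pos
  -- Since `η` vanishes off the interior, the boundary contributes nothing to the right-hand side;
  -- the boundary energy on the left is nonnegative and can be dropped.
  have h3 : ∫ x, |η x| ∂(surfaceMeasure Ω) = 0 := by
    rw [surfaceMeasure]
    refine setIntegral_eq_zero_of_forall_eq_zero fun x hx => ?_
    rw [hsupp x hx.2, abs_zero]
  have h4 : ∫ x in Ω, |η x| = ∫ x in interior Ω, η x := by
    rw [setIntegral_eq_integral_of_forall_compl_eq_zero fun x hx => by
        rw [hsupp x fun h => hx (interior_subset h), abs_zero],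
      setIntegral_eq_integral_of_forall_compl_eq_zero fun x hx => hsupp x hx]
    simp_rw [abs_of_nonneg (hη0 _)]
  have h5 : 0 ≤ a * ∫ x, η x * ‖Γ x‖ ^ 2 ∂(surfaceMeasure Ω) :=
    mul_nonneg ha.le (integral_nonneg fun x => mul_nonneg (hη0 x) (by positivity))
  rw [h3, h4] at h2
  linarith

/-- Testing the weak gradient of a function of `D_0` against a probability density. -/
lemma abs_integral_mul_fderiv_le (h : IsSmoothDomain Ω) (ha : 0 < a)
    (hf0 : f ∈ unitEnergyFunctions Ω a) {η : EuclideanSpace ℝ (Fin d) → ℝ} (hη : ContDiff ℝ 1 η)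
    (hη0 : ∀ x, 0 ≤ η x) (hc : HasCompactSupport η) (hsupp : tsupport η ⊆ interior Ω)
    (v : EuclideanSpace ℝ (Fin d)) :
    |∫ x in interior Ω, f x * fderiv ℝ η x v| ≤ ‖v‖ * ∫ x in interior Ω, η x := by
  obtain ⟨G, Γ, φ, hf⟩ := (mem_formDomain_iff h ha).1 hf0.1.1
  have hfin := h.isFiniteMeasure_restrict_interior
  have hsq := integral_mul_sq_norm_le h ha hf0 hf hη hη0 fun x hx =>
    image_eq_zero_of_notMem_tsupport fun h => hx (hsupp h)
  rw [hf.integral_mul_fderiv h hη hc hsupp v, abs_neg]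
  obtain ⟨C, hC⟩ := hc.exists_bound_of_continuous hη.continuous
  have hηint : Integrable η (volume.restrict (interior Ω)) :=
    (hη.continuous.integrable_of_hasCompactSupport hc).integrableOn
  have hGint : Integrable (fun x => η x * ‖G x‖ ^ 2) (volume.restrict (interior Ω)) :=
    (hf.memLp_bulk.integrable_norm_pow two_ne_zero).bdd_mul hη.continuous.aestronglyMeasurable
      (.of_forall hC)
  have hint : Integrable (fun x => ‖v‖ * ((η x + η x * ‖G x‖ ^ 2) / 2))
      (volume.restrict (interior Ω)) := ((hηint.add hGint).div_const 2).const_mul _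
  rw [← Real.norm_eq_abs]
  refine (norm_integral_le_of_norm_le hint (.of_forall fun x => ?_)).trans ?_
  · rw [norm_mul, Real.norm_of_nonneg (hη0 x)]
    have h1 : ‖(inner ℝ (G x) v : ℝ)‖ ≤ ‖G x‖ * ‖v‖ := norm_inner_le_norm _ _
    -- This elementary inequality turns the integrated bound on `η ‖G‖²` directly into one on `η
    -- ‖G‖`, without a pointwise bound on `G`.
    have h2 : ‖G x‖ ≤ (1 + ‖G x‖ ^ 2) / 2 := by nlinarith [sq_nonneg (‖G x‖ - 1)]
    calc ‖(inner ℝ (G x) v : ℝ)‖ * η x ≤ ((1 + ‖G x‖ ^ 2) / 2 * ‖v‖) * η x := by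
          gcongr
          · exact hη0 x
          · exact h1.trans (by gcongr)
      _ = _ := by ring
  · rw [integral_const_mul, integral_div, integral_add hηint hGint]
    gcongr
    linarith

/-- Functions of `D_0` are locally `1`-Lipschitz in the interior. -/
lemma eventually_abs_sub_le_of_mem (h : IsSmoothDomain Ω) (ha : 0 < a)
    (hf0 : f ∈ unitEnergyFunctions Ω a) {z : EuclideanSpace ℝ (Fin d)} (hz : z ∈ interior Ω) :
    ∀ᶠ w in 𝓝 z, |f w - f z| ≤ dist w z := by
  obtain ⟨r, hr, hball⟩ := Metric.isOpen_iff.1 isOpen_interior z hz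
  have hfmem : MemLp f 2 (invMeasure Ω) := hf0.1.1.1
  have hfin := h.isFiniteMeasure_restrict_interior
  -- Values of `f` off `Ω` are unconstrained, so the convolution is taken with the extension by
  -- zero; near `z` only interior values enter.
  let f₁ := (interior Ω).indicator f
  have hf₁ : LocallyIntegrable f₁ volume :=
    ((integrable_indicator_iff isOpen_interior.measurableSet).2
      ((h.memLp_restrict_interior hfmem).integrable one_le_two)).locallyIntegrable
  have hcont : ∀ y ∈ interior Ω, ContinuousAt f₁ y := fun y hy => by
    refine ((hf0.1.2.mono interior_subset).continuousAt (isOpen_interior.mem_nhds hy)).congr ?_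
    filter_upwards [isOpen_interior.mem_nhds hy] with x hx
    exact (indicator_of_mem hx f).symm
  filter_upwards [Metric.ball_mem_nhds z (half_pos hr)] with w hw
  have hwi : w ∈ interior Ω := hball (Metric.ball_subset_ball (by linarith) hw)
  refine le_of_forall_pos_le_add fun ε hε => ?_
  obtain ⟨δ₁, hδ₁, h₁⟩ := Metric.continuousAt_iff.1 (hcont w hwi) (ε / 2) (by positivity)
  obtain ⟨δ₂, hδ₂, h₂⟩ := Metric.continuousAt_iff.1 (hcont z hz) (ε / 2) (by positivity)
  -- `δ₁` and `δ₂` make the mollification `ε / 2`-close to `f` at `w` and `z`; `r / 4` keeps the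
  -- mollifier centred at any point of the ball of radius `r / 2` inside the interior.
  obtain ⟨δ, hδ, hδle⟩ : ∃ δ > 0, δ ≤ δ₁ ∧ δ ≤ δ₂ ∧ δ ≤ r / 4 :=
    ⟨min δ₁ (min δ₂ (r / 4)), by positivity, min_le_left _ _,
      (min_le_right _ _).trans (min_le_left _ _), (min_le_right _ _).trans (min_le_right _ _)⟩
  let ψ : ContDiffBump (0 : EuclideanSpace ℝ (Fin d)) := ⟨δ / 2, δ, by positivity, by linarith⟩
  let ρ := ψ.normed volume
  have hρ : ContDiff ℝ 1 ρ := ψ.contDiff_normed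
  have hρc : HasCompactSupport ρ := ψ.hasCompactSupport_normed
  let Fδ := convolution ρ f₁ (ContinuousLinearMap.lsmul ℝ ℝ) volume
  have hder := hρc.hasFDerivAt_convolution_left (ContinuousLinearMap.lsmul ℝ ℝ) hρ hf₁
  have hbound : ∀ y ∈ Metric.ball z (r / 2), ‖fderiv ℝ Fδ y‖ ≤ 1 := by
    intro y hy
    refine ContinuousLinearMap.opNorm_le_bound _ zero_le_one fun v => ?_
    have hex : Integrable (fun t => (ContinuousLinearMap.lsmul ℝ ℝ).precompL
        (EuclideanSpace ℝ (Fin d)) (fderiv ℝ ρ (y - t)) (f₁ t)) volume :=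
      ((hρc.fderiv ℝ).convolutionExists_left _ (hρ.continuous_fderiv one_ne_zero) hf₁ y).integrable_swap
    let η : EuclideanSpace ℝ (Fin d) → ℝ := fun t => ρ (y - t)
    have hη : ContDiff ℝ 1 η := hρ.comp (contDiff_const.sub contDiff_id)
    have hηd : ∀ t, fderiv ℝ η t v = - fderiv ℝ ρ (y - t) v := fun t => by
      have h1 : HasFDerivAt (fun t => y - t)
          (-ContinuousLinearMap.id ℝ (EuclideanSpace ℝ (Fin d))) t := (hasFDerivAt_id t).const_sub y
      have h2 := (hρ.differentiable one_ne_zero (y - t)).hasFDerivAt.comp t h1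
      rw [show η = ρ ∘ fun t => y - t from rfl, h2.fderiv]
      simp
    have hηsupp : tsupport η ⊆ Metric.closedBall y δ := by
      refine closure_minimal (fun t ht => ?_) Metric.isClosed_closedBall
      have h1 : y - t ∈ Function.support ρ := ht
      rw [ψ.support_normed_eq, mem_ball_zero_iff, norm_sub_rev] at h1
      exact mem_closedBall_iff_norm.2 h1.le
    have hsub : Metric.closedBall y δ ⊆ interior Ω := fun t ht => hball <| by
      rw [Metric.mem_ball] at hy ⊢
      rw [Metric.mem_closedBall] at ht
      linarith [dist_triangle t y z, hδle.2.2]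
    have hηc : HasCompactSupport η :=
      (isCompact_closedBall y δ).of_isClosed_subset (isClosed_tsupport η) hηsupp
    -- The derivative of the mollified function is, up to sign, the weak derivative of `f` tested
    -- against the probability density `η = ρ (y - ·)`; hence it is at most `‖v‖`.
    have heq : fderiv ℝ Fδ y v = - ∫ t in interior Ω, f t * fderiv ℝ η t v := by
      rw [(hder y).fderiv, convolution_eq_swap, ContinuousLinearMap.integral_apply hex,
        ← integral_neg, ← integral_indicator isOpen_interior.measurableSet]
      refine integral_congr_ae (.of_forall fun t => ?_)
      by_cases ht : t ∈ interior Ω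
      · simp [ContinuousLinearMap.precompL_apply, f₁, ht, hηd, mul_comm]
      · simp [f₁, ht]
    have hone : ∫ t in interior Ω, η t = 1 := by
      rw [setIntegral_eq_integral_of_forall_compl_eq_zero fun t ht =>
        image_eq_zero_of_notMem_tsupport fun h => ht (hsub (hηsupp h))]
      exact (integral_sub_left_eq_self ρ volume y).trans ψ.integral_normed
    have hfin := abs_integral_mul_fderiv_le h ha hf0 hη (fun t => ψ.nonneg_normed _) hηc
      (hηsupp.trans hsub) v
    rw [hone, mul_one] at hfin
    rw [heq, norm_neg, one_mul]
    exact hfin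
  have hLip := (convex_ball z (r / 2)).norm_image_sub_le_of_norm_fderiv_le
    (fun y _ => (hder y).differentiableAt) hbound (Metric.mem_ball_self (half_pos hr)) hw
  have hclose : ∀ y ∈ interior Ω, (∀ ⦃x⦄, dist x y < δ → dist (f₁ x) (f₁ y) < ε / 2) →
      |Fδ y - f y| ≤ ε / 2 := by
    intro y hy hyδ
    have h1 := ψ.dist_normed_convolution_le (x₀ := y) hf₁.aestronglyMeasurable
      (fun x hx => (hyδ hx).le)
    rwa [show f₁ y = f y from indicator_of_mem hy f] at h1
  have e1 := abs_le.1 (hclose w hwi fun x hx => h₁ (hx.trans_le hδle.1))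
  have e2 := abs_le.1 (hclose z hz fun x hx => h₂ (hx.trans_le hδle.2.1))
  rw [one_mul, ← dist_eq_norm, ← dist_eq_norm, Real.dist_eq] at hLip
  have e3 := abs_le.1 hLip
  rw [abs_le]
  constructor <;> linarith [e1.1, e1.2, e2.1, e2.2, e3.1, e3.2]

/-- The increments of the functions of `D_0` have supremum `reachDist`. -/
lemma isLUB_increments (h : IsSmoothDomain Ω) (hconn : IsConnected Ω) (ha : 0 < a) (ha1 : a ≤ 1)
    {x y : EuclideanSpace ℝ (Fin d)} (hx : x ∈ Ω) (hy : y ∈ Ω) :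
    IsLUB (increments Ω a x y) (reachDist Ω x y) := by
  have hreach := exists_reach h.isCompact.isClosed hconn h.smooth hx hy
  constructor
  · rintro r ⟨f, hf, rfl⟩
    exact sub_le_of_reach h.isCompact h.smooth hf.1.2
      (fun z hz => eventually_abs_sub_le_of_mem h ha hf hz) (reach_reachDist hreach)
  · refine fun b hb => le_of_forall_lt fun L hL => ?_
    obtain ⟨L', hL', hL'2⟩ := exists_between hL
    obtain ⟨F, hF, hF1, hFL⟩ := exists_contDiff_of_lt_reachDist hx hy hreach hL'2
    exact hL'.trans_le (hFL.trans
      (hb ⟨F, mem_unitEnergyFunctions_of_contDiff h ha ha1 hF hF1, rfl⟩))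

lemma intrinsicDist_eq (h : IsSmoothDomain Ω) (hconn : IsConnected Ω) (ha : 0 < a) (ha1 : a ≤ 1)
    {x y : EuclideanSpace ℝ (Fin d)} (hx : x ∈ Ω) (hy : y ∈ Ω) :
    intrinsicDist Ω a x y = reachDist Ω x y := by
  have h1 := isLUB_increments h hconn ha ha1 hx hy
  exact h1.csSup_eq ⟨0, fun _ => 0,
    mem_unitEnergyFunctions_of_contDiff h ha ha1 contDiff_const (by simp), by simp⟩

lemma inducedDist_eq (h : IsSmoothDomain Ω) (hconn : IsConnected Ω)
    {x y : EuclideanSpace ℝ (Fin d)} (hx : x ∈ Ω) (hy : y ∈ Ω) :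
    inducedDist Ω x y = reachDist Ω x y :=
  (isLeast_pathLengths h.isCompact
    (exists_reach h.isCompact.isClosed hconn h.smooth hx hy)).csInf_eq

end SRBD

/-! ### Conclusion: both distances equal `reachDist`, which does not involve `a`. -/

theorem mainTheorem4 (d : ℕ) (hd : 2 ≤ d) (Ω : Set (EuclideanSpace ℝ (Fin d)))
    (hΩ_compact : IsCompact Ω) (hΩ_connected : IsConnected Ω)
    (hΩ_interior : (interior Ω).Nonempty) (hΩ_smooth : SRBD.HasSmoothBoundary Ω)
    (hΩ_boundary : IsConnected (frontier Ω)) :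
    (∀ a : ℝ, 0 < a → a ≤ 1 → ∀ x ∈ Ω, ∀ y ∈ Ω,
      IsLUB (SRBD.increments Ω a x y) (SRBD.intrinsicDist Ω a x y) ∧
      IsLeast (SRBD.pathLengths Ω x y) (SRBD.inducedDist Ω x y) ∧
      SRBD.intrinsicDist Ω a x y = SRBD.inducedDist Ω x y) ∧
    (Convex ℝ Ω → ∀ x ∈ Ω, ∀ y ∈ Ω, SRBD.inducedDist Ω x y = dist x y) ∧
    (∀ a a' : ℝ, 0 < a → a ≤ 1 → 0 < a' → a' ≤ 1 → ∀ x ∈ Ω, ∀ y ∈ Ω,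
      SRBD.intrinsicDist Ω a x y = SRBD.intrinsicDist Ω a' x y) := by
  have h : SRBD.IsSmoothDomain Ω :=
    ⟨⟨d - 1, by omega⟩, hΩ_compact, hΩ_interior, hΩ_smooth⟩
  refine ⟨fun a ha ha1 x hx y hy => ?_, fun hconv x hx y hy => ?_,
    fun a a' ha ha1 ha' ha1' x hx y hy => ?_⟩
  · rw [SRBD.intrinsicDist_eq h hΩ_connected ha ha1 hx hy,
      SRBD.inducedDist_eq h hΩ_connected hx hy]
    exact ⟨SRBD.isLUB_increments h hΩ_connected ha ha1 hx hy, SRBD.isLeast_pathLengths hΩ_compact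
      (SRBD.exists_reach hΩ_compact.isClosed hΩ_connected hΩ_smooth hx hy), rfl⟩
  · exact (SRBD.isLeast_pathLengths_of_convex hconv hx hy).csInf_eq
  · rw [SRBD.intrinsicDist_eq h hΩ_connected ha ha1 hx hy,
      SRBD.intrinsicDist_eq h hΩ_connected ha' ha1' hx hy]
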